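/- Let $(R,\mathfrak m)$ be a regular local domain with $\dim R\ge 2$ and field of fractions $K$; all local rings below are subrings of $K$. For local rings $A, B\subseteq K$, say that $B$ *dominates* $A$ if $A\subseteq B$ and $\mathfrak m_B\cap A=\mathfrak m_A$. A *local quadratic transform* of $A$ is a local ring $B$ on $\operatorname{Proj}A[\mathfrak m_A t]$, that is, $B=A[\mathfrak m_A/x]_P$ for some nonzero $x\in\mathfrak m_A$ and some prime ideal $P$, that dominates $A$. An *infinitely near point* to $R$ is a regular local ring $T$ with $\dim T\ge 2$ that dominates $R$ and is obtained from $R$ by a finite (possibly empty) sequence of local quadratic transforms. For an ideal $I$ of $R$, an infinitely near point $T$ is a *base point* of $I$ if the transform $I^T=a^{-1}IT$, where $aT$ is the smallest principal ideal of $T$ containing $IT$, is a proper ideal of $T$; and $I$ is *finitely supported* if it has only finitely many base points. For a regular local ring $T$ with field of fractions $K$, let $\operatorname{ord}_T$ denote the order function defined by the powers of $\mathfrak m_T$, and also the valuation ring $\{x/y : x,y\in T,\ y\ne 0,\ \operatorname{ord}_T(x)\ge\operatorname{ord}_T(y)\}$ of $K$. Let $I$ be a finitely supported $\mathfrak m$-primary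 ideal of $R$, let $\overline{R[It]}$ be the integral closure of the Rees algebra $R[It]$ in its field of fractions, graded by the degree in $t$, and let $S$ be a local ring on $\operatorname{Proj}\overline{R[It]}$ that dominates $R$. If $S$ is a unique factorization domain, then $S$ is a regular local ring. Moreover, either $S=\operatorname{ord}_T$ for some base point $T$ of $I$, or $S$ is an infinitely near point to $R$. -/

import Mathlib

open Polynomial IsLocalRing

noncomputable section

namespace FinSupp

section NormalizedRees

variable {R : Type*} [CommRing R] (K : Type*) [Field K] [Algebra R K]

/-- The Rees algebra `R[It] = ⨁ Iⁿ tⁿ`, viewed inside `K[t]`. -/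
def reesIn (I : Ideal R) : Subalgebra R K[X] :=
  (reesAlgebra I).map (Polynomial.mapAlgHom (Algebra.ofId R K))

/-- The integral closure of the Rees algebra `R[It]`. It is taken in `K[t]`; when `K` is the field
of fractions of `R` and `I ≠ 0`, the field of fractions of `R[It]` is `K(t)`, and as `K[t]` is
integrally closed in `K(t)` this is the integral closure of `R[It]` in its field of fractions. -/
def normRees (I : Ideal R) : Subalgebra R K[X] :=
  (integralClosure (reesIn K I) K[X]).restrictScalars R

/-- The elements of degree `n`, that is, of the form `c tⁿ`, of the integral closure of `R[It]`. -/
def normReesPiece (I : Ideal R) (n : ℕ) : Submodule R (normRees K I) :=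
  (LinearMap.range ((Polynomial.monomial n : K →ₗ[K] K[X]).restrictScalars R)).comap
    (normRees K I).val.toLinearMap

variable {K}

theorem mem_normRees {I : Ideal R} {f : K[X]} : f ∈ normRees K I ↔ IsIntegral (reesIn K I) f :=
  Iff.rfl

theorem mem_normReesPiece {I : Ideal R} {n : ℕ} {f : normRees K I} :
    f ∈ normReesPiece K I n ↔ ∃ c : K, monomial n c = (f : K[X]) :=
  Iff.rfl

theorem monomial_coeff_mem_reesIn {I : Ideal R} {f : K[X]} (hf : f ∈ reesIn K I) (n : ℕ) :
    monomial n (f.coeff n) ∈ reesIn K I := by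
  obtain ⟨g, hg, rfl⟩ := hf
  refine ⟨monomial n (g.coeff n), ?_, by simp⟩
  exact reesAlgebra.monomial_mem.2 (hg n)

/-- The ring homomorphism `K[t] → K[t][u]`, `t ↦ t u`. -/
def twist : K[X] →+* K[X][X] := eval₂RingHom (C.comp C) (C X * X)

theorem coeff_twist (f : K[X]) (n : ℕ) : (twist f).coeff n = monomial n (f.coeff n) := by
  have : twist f = f.sum fun i a => monomial i (monomial i a) := by
    simp only [twist, coe_eval₂RingHom, eval₂_eq_sum]
    refine Finset.sum_congr rfl fun i _ => ?_
    simp [mul_pow, ← mul_assoc, ← C_mul_X_pow_eq_monomial]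
  rw [this, Polynomial.sum, finsetSum_coeff]
  simp only [coeff_monomial]
  rw [Finset.sum_ite_eq']
  split_ifs with h
  · rfl
  · simp [notMem_support_iff.1 h]

theorem monomial_coeff_mem_normRees {I : Ideal R} {f : K[X]} (hf : f ∈ normRees K I) (n : ℕ) :
    monomial n (f.coeff n) ∈ normRees K I := by
  rw [mem_normRees] at hf ⊢
  let ψ : (reesIn K I)[X] →+* K[X][X] := mapRingHom (algebraMap (reesIn K I) K[X])
  have hψ : Function.Injective ψ := map_injective _ Subtype.val_injective
  have hmem : ∀ a : reesIn K I, (twist.comp (algebraMap (reesIn K I) K[X])) a ∈ ψ.rangeS := by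
    intro a
    have h : twist (a : K[X]) ∈ lifts (algebraMap (reesIn K I) K[X]) := by
      rw [lifts_iff_coeff_lifts]
      intro k
      rw [coeff_twist]
      exact ⟨⟨_, monomial_coeff_mem_reesIn a.2 k⟩, rfl⟩
    obtain ⟨q, hq⟩ := (mem_lifts _).1 h
    exact ⟨q, hq⟩
  let e : (reesIn K I)[X] ≃+* ψ.rangeS := RingEquiv.ofBijective ψ.rangeSRestrict
    ⟨fun x y hxy => hψ congr(($hxy : K[X][X])), ψ.rangeSRestrict_surjective⟩
  let φ : reesIn K I →+* (reesIn K I)[X] :=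
    e.symm.toRingHom.comp ((twist.comp (algebraMap (reesIn K I) K[X])).codRestrict ψ.rangeS hmem)
  let := Polynomial.algebra (reesIn K I) K[X]
  have hcomp : (algebraMap (reesIn K I)[X] K[X][X]).comp φ = twist.comp (algebraMap (reesIn K I) K[X]) := by
    ext1 a
    have : (e (φ a) : K[X][X]) = twist (algebraMap (reesIn K I) K[X] a) := by simp [φ]
    exact this
  have hint : IsIntegral (reesIn K I)[X] (twist f) := hf.map_of_comp_eq φ twist hcomp
  have := Polynomial.isIntegral_iff_isIntegral_coeff.1 hint n
  rwa [coeff_twist] at this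

/-- The homogeneous component of degree `n`. -/
def component (I : Ideal R) (n : ℕ) (f : normRees K I) : normReesPiece K I n :=
  ⟨⟨monomial n ((f : K[X]).coeff n), monomial_coeff_mem_normRees f.2 n⟩, ⟨_, rfl⟩⟩

instance (I : Ideal R) : SetLike.GradedMonoid (normReesPiece K I) where
  one_mem := ⟨1, rfl⟩
  mul_mem := by
    rintro i j f g ⟨a, ha⟩ ⟨b, hb⟩
    refine ⟨a * b, ?_⟩
    have ha' : monomial i a = (f : K[X]) := ha
    have hb' : monomial j b = (g : K[X]) := hb
    change monomial (i + j) (a * b) = (f : K[X]) * (g : K[X])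
    rw [← ha', ← hb', monomial_mul_monomial]

theorem component_coe (I : Ideal R) (x : DirectSum ℕ fun n => normReesPiece K I n) (n : ℕ) :
    component I n (DirectSum.coeAddMonoidHom (normReesPiece K I) x) = x n := by
  classical
  have hadd : ∀ f g : normRees K I, component I n (f + g) = component I n f + component I n g := by
    intro f g
    apply Subtype.ext
    apply Subtype.ext
    simp [component]
  have hzero : component I n (0 : normRees K I) = 0 := by
    apply Subtype.ext
    apply Subtype.ext
    simp [component]
  induction x using DirectSum.induction_on with
  | zero => simpa using hzero
  | add x y hx hy => rw [map_add, hadd, hx, hy, DirectSum.add_apply]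
  | of i f =>
    rw [DirectSum.coeAddMonoidHom_of]
    obtain ⟨f, c, hc⟩ := f
    have hc' : monomial i c = (f : K[X]) := hc
    rcases eq_or_ne i n with rfl | h
    · rw [DirectSum.of_eq_same]
      apply Subtype.ext
      apply Subtype.ext
      simp [component, ← hc']
    · rw [DirectSum.of_eq_of_ne _ _ _ h.symm]
      apply Subtype.ext
      apply Subtype.ext
      simp [component, ← hc', coeff_monomial, h]

/-- The integral closure of `R[It]` is graded by the degree in `t`. -/
instance (I : Ideal R) : GradedAlgebra (normReesPiece K I) where
  decompose' f := DFinsupp.mk (f : K[X]).support fun n => component I n f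
  left_inv f := by
    classical
    apply Subtype.ext
    ext n
    have h := component_coe I (DFinsupp.mk (f : K[X]).support fun n => component I n f) n
    have h' := congrArg (fun z : normReesPiece K I n => ((z : normRees K I) : K[X]).coeff n) h
    rw [DFinsupp.mk_apply] at h'
    split_ifs at h' with hn
    · simpa [component] using h'
    · simpa [component, notMem_support_iff.1 hn] using h'
  right_inv x := by
    classical
    refine DFinsupp.ext fun n => ?_
    rw [DFinsupp.mk_apply]
    split_ifs with h
    · exact component_coe I x n
    · rw [← component_coe I x n]
      apply Subtype.ext
      apply Subtype.ext
      simp [component, notMem_support_iff.1 h]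

end NormalizedRees
section Points

variable {K : Type*} [Field K]

/-- The affine chart `A[𝔪/x]` of the blowup of the maximal ideal `𝔪` of a local subring `A`. -/
def quadraticChart (A : LocalSubring K) (x : A.toSubring) : Subring K :=
  Subring.closure ((A.toSubring : Set K) ∪
    {k | ∃ y ∈ maximalIdeal A.toSubring, k = (y : K) / (x : K)})

/-- `B` is a local quadratic transform of `A`: a local ring on `Proj A[𝔪 t]`, that is,
`B = A[𝔪/x]_P` for some nonzero `x ∈ 𝔪` and some prime `P`, that dominates `A`. -/
def IsLocalQuadraticTransform (A B : LocalSubring K) : Prop :=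
  (∃ x ∈ maximalIdeal A.toSubring, x ≠ 0 ∧
    ∃ (P : Ideal (quadraticChart A x)) (_ : P.IsPrime),
      B = LocalSubring.ofPrime (quadraticChart A x) P) ∧
  A ≤ B

/-- `S` is an infinitely near point to `A`: a regular local ring of dimension at least two that
dominates `A` and is obtained from `A` by a finite, possibly empty, sequence of local quadratic
transforms. The order on `LocalSubring K` is domination. -/
def IsInfinitelyNear (A S : LocalSubring K) : Prop :=
  IsRegularLocalRing S.toSubring ∧ 2 ≤ ringKrullDim S.toSubring ∧ A ≤ S ∧
    Relation.ReflTransGen IsLocalQuadraticTransform A S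

/-- The order of an element of a local ring: the supremum of the `n` with `x ∈ 𝔪ⁿ`. -/
def ord (A : Type*) [CommRing A] [IsLocalRing A] (x : A) : ℕ∞ :=
  ⨆ (n : ℕ) (_ : x ∈ maximalIdeal A ^ n), (n : ℕ∞)

/-- The order valuation ring of a (regular) local subring `T` with field of fractions `K`: the
fractions `x / y` of elements of `T` with `ord x ≥ ord y`. -/
def ordValuationRing (T : LocalSubring K) : Set K :=
  {k | ∃ x y : T.toSubring, y ≠ 0 ∧ ord T.toSubring y ≤ ord T.toSubring x ∧ k = (x : K) / (y : K)}

variable {R : Type*} [CommRing R] [Algebra R K]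

/-- The extension `IS` of the ideal `I` of `R` to a subring `S` of `K` containing `R`. -/
def extension (I : Ideal R) (S : Subring K) : Ideal S :=
  Ideal.span {s | ∃ r ∈ I, (s : K) = algebraMap R K r}

/-- `J` is the transform of `I` in `S`: `J = a⁻¹ IS`, where `aS` is the smallest principal ideal of
`S` containing `IS`. -/
def IsTransform (I : Ideal R) (S : Subring K) (J : Ideal S) : Prop :=
  ∃ a : S, a ≠ 0 ∧
    IsLeast {P : Ideal S | P.IsPrincipal ∧ extension I S ≤ P} (Ideal.span {a}) ∧
    Ideal.span {a} * J = extension I S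

/-- `S` is a local ring on `Proj` of the integral closure of `R[It]`: the ring of all fractions
`a tⁿ / b tⁿ` of homogeneous elements of equal degree with denominator outside a point of `Proj`. -/
def IsOnNormalizedBlowup (I : Ideal R) (S : LocalSubring K) : Prop :=
  ∃ p : ProjectiveSpectrum (normReesPiece K I),
    (S.toSubring : Set K) = {k | ∃ n : ℕ, ∃ a ∈ normReesPiece K I n, ∃ b ∈ normReesPiece K I n,
      b ∉ p.asHomogeneousIdeal ∧ k = (a : K[X]).coeff n / (b : K[X]).coeff n}

variable [IsLocalRing R]

/-- `S` is a base point of `I`: an infinitely near point to `R` in which the transform of `I` is a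
proper ideal. -/
def IsBasePoint (I : Ideal R) (S : LocalSubring K) : Prop :=
  IsInfinitelyNear (LocalSubring.range (algebraMap R K)) S ∧
    ∃ J : Ideal S.toSubring, IsTransform I S.toSubring J ∧ J ≠ ⊤

variable (K) in
/-- `I` is finitely supported: it has only finitely many base points. -/
def IsFinitelySupported (I : Ideal R) : Prop :=
  {S : LocalSubring K | IsBasePoint I S}.Finite

end Points

end FinSupp

end

noncomputable section

namespace FinSupp

/-! ### Analytic independence: the associated graded ring of a regular local ring -/

section QuasiRegular

/-! The idea is to climb from `R` towards `S` through quadratic transforms. If `𝔪_T` becomes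
principal in `S`, then `S` dominates a regular quadratic transform of `T`
(`exists_isQuadraticCenter`). Suppose this holds for every base point `T` reached below `S`. There
are finitely many, and `R` is one, so take a maximal `T`; its transform `T'` below `S` is strictly
larger and hence not a base point. Then `IT'` is principal. Since `T'` is normal, the universal
property of the normalized blowup (`IsOnNormalizedBlowup.le_of_extension_eq`) gives `S ≤ T'`, hence
`S = T'`. In dimension at least two this is an infinitely near point; otherwise it is the order
valuation ring of `T`.

What remains is that `𝔪_T S` is principal when `S` is factorial
(`IsGoodPoint.exists_forall_div_mem`). First, the transform `J` of `I` in a base point `T` is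
`𝔪_T`-primary (`IsGoodPoint.eq_maximalIdeal_of_transform_le`): for a prime `𝔭 ≠ 𝔪_T` containing `J`,
a local ring `D` inside `T_𝔭` dominating `T` can be chosen so that the climb below `D` runs through,
making `I` principal in `T_𝔭`; but `J` lies in `𝔭` and in no proper principal ideal. Next, `JS` is
principal and proper, so a prime element of `S` divides all of `J`, and therefore all of `𝔪_T`. Thus
the gcd `b` of `𝔪_T` in `S` is a nonunit.

If `b` does not generate `𝔪_T S`, every element of `𝔪_T` is `b` times a nonunit of `S`. Avoidance
yields a form `f` generating a power of `𝔪_T` at all base points where `𝔪_T` is principal, and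
factoriality yields a valuation ring `V` dominating `S` in which `f` does not generate that power.
The center `T'` of `V` on the blowup of `T` is therefore no base point, so `I` is principal there
and `S ≤ T'`. But the exceptional prime of `T'` is then a product of `b` and a nonunit of `S`, both
still nonunits in `T'`: a contradiction.

Factoriality of regular local rings is not used. The substitute is that `I` extends, after the first
transform, to an ideal containing a product of primes, a property preserved by strict transforms. -/

theorem eval_smul_of_isHomogeneous {ι R : Type*} [CommRing R] {F : MvPolynomial ι R}
    {n : ℕ} (hF : F.IsHomogeneous n) {A : Type*} [CommRing A] (φ : R →+* A) (t : A) (x : ι → A) :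
    MvPolynomial.eval₂ φ (fun i => t * x i) F = t ^ n * MvPolynomial.eval₂ φ x F := by
  simp only [MvPolynomial.eval₂_eq, Finset.mul_sum]
  refine Finset.sum_congr rfl fun d hd => ?_
  have hdeg : ∑ i ∈ d.support, d i = n := by
    have := hF (MvPolynomial.mem_support_iff.1 hd)
    rw [← this, Finsupp.weight_apply, Finsupp.sum]
    simp
  simp only [mul_pow, Finset.prod_mul_distrib, Finset.prod_pow_eq_pow_sum, hdeg]
  ring

theorem isPrime_map_C {ι R : Type*} [CommRing R] (p : Ideal R) [p.IsPrime] :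
    (p.map (MvPolynomial.C : R →+* MvPolynomial ι R)).IsPrime := by
  have : p = RingHom.ker (Ideal.Quotient.mk p) := (Ideal.mk_ker).symm
  rw [this, ← MvPolynomial.ker_map]
  exact RingHom.ker_isPrime _

theorem comap_map_C {ι R : Type*} [CommRing R] (p : Ideal R) :
    (p.map (MvPolynomial.C : R →+* MvPolynomial ι R)).comap MvPolynomial.C = p := by
  classical
  ext r
  rw [Ideal.mem_comap, MvPolynomial.mem_map_C_iff]
  refine ⟨fun h => by simpa using h 0, fun h m => ?_⟩
  rw [MvPolynomial.coeff_C]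
  split_ifs
  · exact h
  · exact p.zero_mem

/-- Extending primes to the polynomial ring is strictly monotone, because contraction recovers them;
chains below `p` therefore extend. -/
theorem height_le_height_map_C {ι R : Type*} [CommRing R] (p : Ideal R) [p.IsPrime] :
    p.height ≤ (p.map (MvPolynomial.C : R →+* MvPolynomial ι R)).height := by
  let f : PrimeSpectrum R → PrimeSpectrum (MvPolynomial ι R) := fun q =>
    ⟨q.asIdeal.map MvPolynomial.C, isPrime_map_C q.asIdeal⟩
  have hf : StrictMono f := by
    refine (Monotone.strictMono_of_injective ?_ ?_)
    · exact fun a b hab => Ideal.map_mono hab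
    · intro a b hab
      ext1
      have := congrArg (fun q => Ideal.comap MvPolynomial.C q.asIdeal) hab
      simpa only [f, comap_map_C] using this
  have := Order.height_le_height_apply_of_strictMono f hf ⟨p, ‹_›⟩
  rwa [← PrimeSpectrum.height_eq_orderHeight, ← PrimeSpectrum.height_eq_orderHeight] at this

variable {ι R : Type*} [CommRing R] [IsLocalRing R] {x : ι → R}

theorem exists_isHomogeneous_of_mem_pow (hx : Ideal.span (Set.range x) = maximalIdeal R)
    {n : ℕ} {f : R} (hf : f ∈ maximalIdeal R ^ n) :
    ∃ F : MvPolynomial ι R, F.IsHomogeneous n ∧ MvPolynomial.eval x F = f := by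
  induction n generalizing f with
  | zero => exact ⟨MvPolynomial.C f, MvPolynomial.isHomogeneous_C _ _, by simp⟩
  | succ n ih =>
    rw [pow_succ] at hf
    refine Submodule.mul_induction_on hf ?_ ?_
    · intro g hg y hy
      obtain ⟨G, hG, rfl⟩ := ih hg
      rw [← hx] at hy
      refine Submodule.span_induction (p := fun y _ => ∃ F : MvPolynomial ι R,
        F.IsHomogeneous (n + 1) ∧ MvPolynomial.eval x F = MvPolynomial.eval x G * y) ?_ ?_ ?_ ?_ hy
      · rintro _ ⟨i, rfl⟩
        exact ⟨G * MvPolynomial.X i, hG.mul (MvPolynomial.isHomogeneous_X _ _), by simp⟩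
      · exact ⟨0, MvPolynomial.isHomogeneous_zero _ _ _, by simp⟩
      · rintro y z - - ⟨F₁, h₁, e₁⟩ ⟨F₂, h₂, e₂⟩
        exact ⟨F₁ + F₂, h₁.add h₂, by simp [e₁, e₂, mul_add]⟩
      · rintro r y - ⟨F₁, h₁, e₁⟩
        refine ⟨MvPolynomial.C r * F₁, ?_, by simp [e₁]; ring⟩
        simpa using (MvPolynomial.isHomogeneous_C _ r).mul h₁
    · rintro y z ⟨F₁, h₁, e₁⟩ ⟨F₂, h₂, e₂⟩
      exact ⟨F₁ + F₂, h₁.add h₂, by simp [e₁, e₂]⟩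

theorem eval_mem_pow_of_isHomogeneous (hx : Ideal.span (Set.range x) = maximalIdeal R)
    {n : ℕ} {F : MvPolynomial ι R} (hF : F.IsHomogeneous n) {J : Ideal R}
    (hJ : ∀ d, F.coeff d ∈ J) : MvPolynomial.eval x F ∈ J * maximalIdeal R ^ n := by
  rw [MvPolynomial.eval_eq]
  refine Ideal.sum_mem _ fun d hd => Ideal.mul_mem_mul (hJ d) ?_
  have hdeg : ∑ i ∈ d.support, d i = n := by
    have := hF (MvPolynomial.mem_support_iff.1 hd)
    rw [← this, Finsupp.weight_apply, Finsupp.sum]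
    simp
  rw [← hdeg, ← Finset.prod_pow_eq_pow_sum]
  exact Ideal.prod_mem_prod fun i _ =>
    Ideal.pow_mem_pow (hx ▸ Ideal.subset_span ⟨i, rfl⟩) _

theorem eval_mem_pow_succ_of_isHomogeneous (hx : Ideal.span (Set.range x) = maximalIdeal R)
    {n : ℕ} {F : MvPolynomial ι R} (hF : F.IsHomogeneous n)
    (h0 : MvPolynomial.map (residue R) F = 0) :
    MvPolynomial.eval x F ∈ maximalIdeal R ^ (n + 1) := by
  rw [pow_succ']
  refine eval_mem_pow_of_isHomogeneous hx hF fun d => ?_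
  rw [← residue_eq_zero_iff, ← MvPolynomial.coeff_map, h0, MvPolynomial.coeff_zero]

variable [Finite ι] [IsNoetherianRing R]

/-- A system of parameters generating the maximal ideal is analytically independent. -/
theorem map_residue_eq_zero_of_eval_eq_zero (hx : Ideal.span (Set.range x) = maximalIdeal R)
    (hd : (Nat.card ι : ℕ∞) ≤ (maximalIdeal R).height) {F : MvPolynomial ι R} {n : ℕ}
    (hF : F.IsHomogeneous n) (h0 : MvPolynomial.eval x F = 0) :
    MvPolynomial.map (residue R) F = 0 := by
  classical
  by_contra hne
  have hFm : F ∉ (maximalIdeal R).map (MvPolynomial.C : R →+* MvPolynomial ι R) := by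
    rwa [← ker_residue, ← MvPolynomial.ker_map, RingHom.mem_ker]
  set M := (maximalIdeal R).map (MvPolynomial.C : R →+* MvPolynomial ι R) with hM
  have hMp : M.IsPrime := isPrime_map_C _
  have hxm : ∀ i, x i ∈ maximalIdeal R := fun i => hx ▸ Ideal.subset_span ⟨i, rfl⟩
  rcases isEmpty_or_nonempty ι with hι | ⟨⟨i₀⟩⟩
  · apply hne
    rw [MvPolynomial.eq_C_of_isEmpty F] at h0 ⊢
    rw [MvPolynomial.eval_C] at h0
    simp [h0]
  -- These are the minors involving `i₀`, one fewer than the variables. A nonzero reduction of `F`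
  -- would make `M` minimal over them, and Krull's height theorem would bound the height of `M` by
  -- `card ι - 1`.
  let s : Set (MvPolynomial ι R) := (fun i => MvPolynomial.X i₀ * MvPolynomial.C (x i) -
    MvPolynomial.X i * MvPolynomial.C (x i₀)) '' {i | i ≠ i₀}
  have hsM : Ideal.span s ≤ M := by
    rw [Ideal.span_le]
    rintro _ ⟨i, -, rfl⟩
    exact M.sub_mem (M.mul_mem_left _ (Ideal.mem_map_of_mem _ (hxm i)))
      (M.mul_mem_left _ (Ideal.mem_map_of_mem _ (hxm i₀)))
  have hXM : (MvPolynomial.X i₀ : MvPolynomial ι R) ∉ M := by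
    intro h
    have := MvPolynomial.mem_map_C_iff.1 h (Finsupp.single i₀ 1)
    simp only [MvPolynomial.coeff_X, if_true] at this
    exact (maximalIdeal.isMaximal R).ne_top ((Ideal.eq_top_iff_one _).2 this)
  have hmin : M ∈ (Ideal.span s).minimalPrimes := by
    refine ⟨⟨hMp, hsM⟩, ?_⟩
    rintro q ⟨hq, hsq⟩ hqM
    have hrel : ∀ i, Ideal.Quotient.mk q (MvPolynomial.X i₀ * MvPolynomial.C (x i)) =
        Ideal.Quotient.mk q (MvPolynomial.C (x i₀) * MvPolynomial.X i) := by
      intro i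
      rcases eq_or_ne i i₀ with rfl | hi
      · rw [mul_comm]
      · rw [Ideal.Quotient.eq, mul_comm (MvPolynomial.C (x i₀))]
        exact hsq (Ideal.subset_span ⟨i, hi, rfl⟩)
    let φ : R →+* MvPolynomial ι R ⧸ q := (Ideal.Quotient.mk q).comp MvPolynomial.C
    -- Modulo `q` the vectors `X i₀ • x` and `x i₀ • X` agree, so homogeneity gives `(X i₀)ⁿ F(x) =
    -- (x i₀)ⁿ F(X)`. As `F(x) = 0` and `F ∉ q`, this puts `x i₀` in `q`, and then every `x i`.
    have h1 := eval_smul_of_isHomogeneous hF φ (Ideal.Quotient.mk q (MvPolynomial.X i₀))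
      (fun i => φ (x i))
    have h2 := eval_smul_of_isHomogeneous hF φ (φ (x i₀))
      (fun i => Ideal.Quotient.mk q (MvPolynomial.X i))
    have h3 : MvPolynomial.eval₂ φ (fun i => φ (x i)) F = 0 := by
      have := MvPolynomial.eval₂_comp_left φ (RingHom.id R) x F
      rw [MvPolynomial.eval₂_id, h0, map_zero] at this
      simpa [Function.comp_def] using this.symm
    have h4 : MvPolynomial.eval₂ φ (fun i => Ideal.Quotient.mk q (MvPolynomial.X i)) F =
        Ideal.Quotient.mk q F := by
      have := MvPolynomial.eval₂_comp_left (Ideal.Quotient.mk q) MvPolynomial.C MvPolynomial.X F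
      rw [MvPolynomial.eval₂_eta] at this
      exact this.symm
    have h5 : (fun i => Ideal.Quotient.mk q (MvPolynomial.X i₀) * φ (x i)) =
        fun i => φ (x i₀) * Ideal.Quotient.mk q (MvPolynomial.X i) := by
      funext i
      simpa [φ] using hrel i
    rw [h5, h2, h3, mul_zero, h4] at h1
    have hFq : Ideal.Quotient.mk q F ≠ 0 := fun h => hFm (hqM (Ideal.Quotient.eq_zero_iff_mem.1 h))
    have hx0 : φ (x i₀) = 0 := eq_zero_of_pow_eq_zero ((mul_eq_zero.1 h1).resolve_right hFq)
    rw [hM, Ideal.map_le_iff_le_comap, ← hx, Ideal.span_le]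
    rintro _ ⟨i, rfl⟩
    have := hrel i
    rw [map_mul, map_mul] at this
    change _ = φ (x i₀) * _ at this
    rw [hx0, zero_mul] at this
    have hX : Ideal.Quotient.mk q (MvPolynomial.X i₀) ≠ 0 :=
      fun h => hXM (hqM (Ideal.Quotient.eq_zero_iff_mem.1 h))
    exact Ideal.mem_comap.2
      (Ideal.Quotient.eq_zero_iff_mem.1 ((mul_eq_zero.1 this).resolve_left hX))
  have hsfin : s.Finite := Set.Finite.image _ (Set.toFinite _)
  have hle := Ideal.height_le_card_of_mem_minimalPrimes_span hsfin hmin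
  have hcard : s.ncard < Nat.card ι := by
    refine (Set.ncard_image_le (Set.toFinite _)).trans_lt ?_
    rw [← Set.ncard_univ]
    exact Set.ncard_lt_ncard ⟨Set.subset_univ _, fun h => h (Set.mem_univ i₀) rfl⟩ (Set.toFinite _)
  have := (hd.trans (height_le_height_map_C (ι := ι) (maximalIdeal R))).trans hle
  exact absurd (by exact_mod_cast this) (not_le.2 hcard)

/-- The associated graded ring of a regular local ring is a polynomial ring. -/
theorem map_residue_eq_zero_of_eval_mem (hx : Ideal.span (Set.range x) = maximalIdeal R)
    (hd : (Nat.card ι : ℕ∞) ≤ (maximalIdeal R).height) {F : MvPolynomial ι R} {n : ℕ}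
    (hF : F.IsHomogeneous n) (h0 : MvPolynomial.eval x F ∈ maximalIdeal R ^ (n + 1)) :
    MvPolynomial.map (residue R) F = 0 := by
  -- An element of `𝔪ⁿ⁺¹` is the value of a form of degree `n` with coefficients in `𝔪`; subtracting
  -- it changes the value to zero without changing the reduction.
  obtain ⟨G, hG, hGF⟩ : ∃ G : MvPolynomial ι R, G.IsHomogeneous n ∧
      MvPolynomial.map (residue R) G = 0 ∧ MvPolynomial.eval x G = MvPolynomial.eval x F := by
    generalize MvPolynomial.eval x F = f at h0
    rw [pow_succ] at h0
    refine Submodule.mul_induction_on h0 ?_ ?_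
    · intro g hg y hy
      obtain ⟨G, hG, rfl⟩ := exists_isHomogeneous_of_mem_pow hx hg
      refine ⟨MvPolynomial.C y * G, ?_, ?_, by simp [mul_comm]⟩
      · simpa using (MvPolynomial.isHomogeneous_C _ y).mul hG
      · simp [(residue_eq_zero_iff y).2 hy]
    · rintro y z ⟨F₁, h₁, r₁, e₁⟩ ⟨F₂, h₂, r₂, e₂⟩
      exact ⟨F₁ + F₂, h₁.add h₂, by simp [r₁, r₂], by simp [e₁, e₂]⟩
  have := map_residue_eq_zero_of_eval_eq_zero hx hd (hF.sub hG) (by simp [hGF.2])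
  rwa [map_sub, hGF.1, sub_zero] at this

end QuasiRegular

/-! ### Regular local domains are integrally closed -/

section RegularNormal

theorem height_maximalIdeal_eq_spanFinrank (R : Type*) [CommRing R] [IsRegularLocalRing R] :
    (maximalIdeal R).height = ((maximalIdeal R).spanFinrank : ℕ∞) := by
  have h1 := IsRegularLocalRing.spanFinrank_maximalIdeal (R := R)
  have h2 := maximalIdeal_height_eq_ringKrullDim (R := R)
  rw [← h1] at h2
  exact_mod_cast h2

/-- The class of `x₀` is nonzero in `𝔪/𝔪²`, so it extends to a basis, which Nakayama's lemma lifts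
to a minimal generating system. -/
theorem exists_generators_of_notMem_sq {R : Type*} [CommRing R] [IsRegularLocalRing R] {x₀ : R}
    (hx₀ : x₀ ∈ maximalIdeal R) (hx₀' : x₀ ∉ maximalIdeal R ^ 2) :
    ∃ (n : ℕ) (y : Fin n → R), Ideal.span (insert x₀ (Set.range y)) = maximalIdeal R ∧
      (n + 1 : ℕ∞) = (maximalIdeal R).height := by
  classical
  let π := (maximalIdeal R).toCotangent
  let v₀ : CotangentSpace R := π ⟨x₀, hx₀⟩
  have hv₀ : v₀ ≠ 0 := by
    intro h
    exact hx₀' ((Ideal.toCotangent_eq_zero _ _).1 h)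
  have hli : LinearIndepOn (ResidueField R) id ({v₀} : Set (CotangentSpace R)) :=
    LinearIndepOn.singleton hv₀
  obtain ⟨b, hb, hvb, -, hspan, hlib⟩ :
      ∃ b : Set (CotangentSpace R), ({v₀} : Set _) ⊆ b ∧ v₀ ∈ b ∧ b ⊆ Set.univ ∧
        (Set.univ : Set (CotangentSpace R)) ⊆ Submodule.span (ResidueField R) b ∧
        LinearIndepOn (ResidueField R) id b := by
    obtain ⟨b, h1, h2, h3, h4⟩ := exists_linearIndepOn_id_extension hli (Set.subset_univ _)
    exact ⟨b, h2, h2 rfl, h1, h3, h4⟩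
  have hspan' : Submodule.span (ResidueField R) b = ⊤ := by
    rw [eq_top_iff]
    exact fun v _ => hspan (Set.mem_univ v)
  have hbfin : b.Finite := by
    have := hlib.finite
    exact Set.toFinite b
  have hcard : b.ncard = Module.finrank (ResidueField R) (CotangentSpace R) := by
    let B : Module.Basis b (ResidueField R) (CotangentSpace R) :=
      Module.Basis.mk hlib (by rw [← hspan']; simp)
    rw [Module.finrank_eq_nat_card_basis B, Set.ncard]
    rfl
  have hsurj : Function.Surjective π := Ideal.toCotangent_surjective _
  choose g hg using hsurj
  -- The lifting is adjusted at `v₀` so that `x₀` itself is among the generators.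
  let g' : CotangentSpace R → maximalIdeal R := fun v => if v = v₀ then ⟨x₀, hx₀⟩ else g v
  have hg' : ∀ v, π (g' v) = v := by
    intro v
    by_cases h : v = v₀
    · simp [g', h, v₀]
    · simp [g', h, hg]
  have himg : π '' (g' '' b) = b := by
    rw [← Set.image_comp]
    convert Set.image_id b using 2 with v
    exact hg' v
  have htop : Submodule.span R (g' '' b) = ⊤ := by
    rw [← CotangentSpace.span_image_eq_top_iff]
    change Submodule.span (ResidueField R) (π '' (g' '' b)) = ⊤
    rw [himg, hspan']
  have hc : (b \ {v₀}).ncard + 1 = b.ncard := Set.ncard_sdiff_singleton_add_one hvb hbfin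
  have : Finite (b \ {v₀} : Set _) := hbfin.sdiff
  let e : Fin (b \ {v₀}).ncard ≃ (b \ {v₀} : Set _) := (Finite.equivFin _).symm
  refine ⟨(b \ {v₀}).ncard, fun i => g' (e i), ?_, ?_⟩
  · have hset : insert x₀ (Set.range fun i => ((g' (e i) : maximalIdeal R) : R)) =
        Subtype.val '' (g' '' b) := by
      ext r
      constructor
      · rintro (rfl | ⟨i, rfl⟩)
        · exact ⟨_, ⟨v₀, hvb, rfl⟩, by simp [g']⟩
        · exact ⟨_, ⟨_, (e i).2.1, rfl⟩, rfl⟩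
      · rintro ⟨_, ⟨v, hv, rfl⟩, rfl⟩
        by_cases h : v = v₀
        · left
          simp [g', h]
        · right
          exact ⟨e.symm ⟨v, hv, h⟩, by simp⟩
    rw [hset]
    have := congrArg (Submodule.map (maximalIdeal R).subtype) htop
    rw [Submodule.map_span, Submodule.map_subtype_top] at this
    exact this
  · rw [height_maximalIdeal_eq_spanFinrank, spanFinrank_maximalIdeal_eq_finrank_cotangentSpace,
      ← hcard, ← hc]
    push_cast
    rfl

/-- A factorial ring is completely integrally closed: once `a / b` is reduced, all powers of the
denominator divide `h`, so the denominator is a unit. -/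
theorem dvd_of_forall_pow_dvd_mul_pow {A : Type*} [CommRing A] [IsDomain A]
    [UniqueFactorizationMonoid A] {a b h : A} (hh : h ≠ 0) (hb : b ≠ 0)
    (H : ∀ k : ℕ, b ^ k ∣ h * a ^ k) : b ∣ a := by
  obtain ⟨a', b', c, hrel, rfl, rfl⟩ := UniqueFactorizationMonoid.exists_reduced_factors' a b hb
  have hc : c ≠ 0 := left_ne_zero_of_mul hb
  have hdvd : ∀ k : ℕ, b' ^ k ∣ h := by
    intro k
    have h1 := H k
    rw [mul_pow, mul_pow, mul_left_comm] at h1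
    have h2 := (mul_dvd_mul_iff_left (pow_ne_zero k hc)).1 h1
    exact (IsRelPrime.pow hrel.symm).dvd_of_dvd_mul_right h2
  have hu : IsUnit b' := by
    by_contra hu
    obtain ⟨n, hn⟩ := FiniteMultiplicity.of_not_isUnit hu hh
    exact hn (hdvd _)
  exact mul_dvd_mul_left c hu.dvd

theorem exists_isHomogeneous_mul_eq {σ k : Type*} [Field k] {F G : MvPolynomial σ k} {l n : ℕ}
    (hF : F.IsHomogeneous l) (hG : G.IsHomogeneous n) (hF0 : F ≠ 0) (h : G ∣ F) :
    n ≤ l ∧ ∃ N : MvPolynomial σ k, N.IsHomogeneous (l - n) ∧ F = G * N := by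
  let := MvPolynomial.gradedAlgebra (σ := σ) (R := k)
  obtain ⟨N, rfl⟩ := h
  have key := DirectSum.coe_decompose_mul_of_left_mem (MvPolynomial.homogeneousSubmodule σ k)
    (b := N) l hG
  rw [DirectSum.decompose_of_mem_same _ hF] at key
  split_ifs at key with hnl
  · exact ⟨hnl, _, (DirectSum.decompose (MvPolynomial.homogeneousSubmodule σ k) N (l - n)).2, key⟩
  · exact absurd key hF0

theorem exists_lift_isHomogeneous {σ R k : Type*} [CommRing R] [CommRing k] (φ : R →+* k)
    (hφ : Function.Surjective φ) {N : MvPolynomial σ k} {n : ℕ} (hN : N.IsHomogeneous n) :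
    ∃ M : MvPolynomial σ R, M.IsHomogeneous n ∧ MvPolynomial.map φ M = N := by
  obtain ⟨M, rfl⟩ := MvPolynomial.map_surjective φ hφ N
  refine ⟨MvPolynomial.homogeneousComponent n M,
    MvPolynomial.homogeneousComponent_isHomogeneous _ _, ?_⟩
  ext d
  have := MvPolynomial.homogeneousComponent_of_mem (m := n) hN
  rw [if_pos rfl] at this
  conv_rhs => rw [← this]
  simp only [MvPolynomial.coeff_map, MvPolynomial.coeff_homogeneousComponent]
  split_ifs <;> simp

theorem exists_mem_pow_notMem_pow_succ {R : Type*} [CommRing R] [IsLocalRing R]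
    [IsNoetherianRing R] {f : R} (hf : f ≠ 0) :
    ∃ n : ℕ, f ∈ maximalIdeal R ^ n ∧ f ∉ maximalIdeal R ^ (n + 1) := by
  classical
  have hex : ∃ n : ℕ, f ∉ maximalIdeal R ^ n := by
    by_contra! h
    apply hf
    have : f ∈ ⨅ i : ℕ, maximalIdeal R ^ i := by
      rw [Ideal.mem_iInf]
      exact h
    rwa [Ideal.iInf_pow_eq_bot_of_isLocalRing _ (maximalIdeal.isMaximal R).ne_top] at this
  have h0 : Nat.find hex ≠ 0 := by
    intro h
    have := Nat.find_spec hex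
    rw [h] at this
    simp at this
  refine ⟨Nat.find hex - 1, ?_, ?_⟩
  · by_contra h
    exact Nat.find_min hex (by omega) h
  · rw [Nat.sub_add_cancel (by omega)]
    exact Nat.find_spec hex

variable {ι R : Type*} [CommRing R] [IsLocalRing R] [IsNoetherianRing R] {x : ι → R}

theorem exists_initialForm (hx : Ideal.span (Set.range x) = maximalIdeal R) {f : R} (hf : f ≠ 0) :
    ∃ (n : ℕ) (F : MvPolynomial ι R), F.IsHomogeneous n ∧ MvPolynomial.eval x F = f ∧
      MvPolynomial.map (residue R) F ≠ 0 := by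
  obtain ⟨n, hn, hn'⟩ := exists_mem_pow_notMem_pow_succ hf
  obtain ⟨F, hF, rfl⟩ := exists_isHomogeneous_of_mem_pow hx hn
  exact ⟨n, F, hF, rfl, fun h => hn' (eval_mem_pow_succ_of_isHomogeneous hx hF h)⟩

variable [Finite ι]

/-- Two homogeneous forms with the same value and nonzero reductions have equal reductions. -/
theorem map_residue_eq_of_eval_eq (hx : Ideal.span (Set.range x) = maximalIdeal R)
    (hd : (Nat.card ι : ℕ∞) ≤ (maximalIdeal R).height) {F G : MvPolynomial ι R} {n m : ℕ}
    (hF : F.IsHomogeneous n) (hG : G.IsHomogeneous m)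
    (hF0 : MvPolynomial.map (residue R) F ≠ 0) (hG0 : MvPolynomial.map (residue R) G ≠ 0)
    (h : MvPolynomial.eval x F = MvPolynomial.eval x G) :
    n = m ∧ MvPolynomial.map (residue R) F = MvPolynomial.map (residue R) G := by
  have hpow : ∀ {H : MvPolynomial ι R} {p : ℕ}, H.IsHomogeneous p →
      MvPolynomial.eval x H ∈ maximalIdeal R ^ p := by
    intro H p hH
    simpa using eval_mem_pow_of_isHomogeneous hx hH (J := ⊤) (fun _ => trivial)
  rcases lt_trichotomy n m with hnm | rfl | hnm
  · exact absurd (map_residue_eq_zero_of_eval_mem hx hd hF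
      (h ▸ Ideal.pow_le_pow_right hnm (hpow hG))) hF0
  · refine ⟨rfl, ?_⟩
    have := map_residue_eq_zero_of_eval_eq_zero hx hd (hF.sub hG) (by simp [h])
    rwa [map_sub, sub_eq_zero] at this
  · exact absurd (map_residue_eq_zero_of_eval_mem hx hd hG
      (h ▸ Ideal.pow_le_pow_right hnm (hpow hF))) hG0

/-- This is Krull's intersection theorem in `R / (g)`. -/
theorem mem_of_forall_mem_sup_pow {g f : R}
    (h : ∀ l : ℕ, f ∈ Ideal.span {g} ⊔ maximalIdeal R ^ l) : f ∈ Ideal.span {g} := by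
  by_cases hg : IsUnit g
  · rw [Ideal.span_singleton_eq_top.2 hg]
    trivial
  have hne : Ideal.span {g} ≠ ⊤ := fun h => hg (Ideal.span_singleton_eq_top.1 h)
  have : Nontrivial (R ⧸ Ideal.span {g}) := Ideal.Quotient.nontrivial_iff.2 hne
  have hloc : IsLocalRing (R ⧸ Ideal.span {g}) :=
    IsLocalRing.of_surjective' _ Ideal.Quotient.mk_surjective
  rw [← Ideal.Quotient.eq_zero_iff_mem, ← Ideal.mem_bot,
    ← Ideal.iInf_pow_eq_bot_of_isLocalRing ((maximalIdeal R).map (Ideal.Quotient.mk _)) ?_,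
    Ideal.mem_iInf]
  · intro l
    rw [← Ideal.map_pow]
    obtain ⟨a, ha, b, hb, rfl⟩ := Submodule.mem_sup.1 (h l)
    rw [map_add, Ideal.Quotient.eq_zero_iff_mem.2 ha, zero_add]
    exact Ideal.mem_map_of_mem _ hb
  · intro htop
    have h1 : Ideal.comap (Ideal.Quotient.mk (Ideal.span {g}))
      ((maximalIdeal R).map (Ideal.Quotient.mk _)) = ⊤ := by rw [htop, Ideal.comap_top]
    rw [Ideal.comap_map_of_surjective _ Ideal.Quotient.mk_surjective, ← RingHom.ker_eq_comap_bot,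
      Ideal.mk_ker, sup_eq_left.2 (le_maximalIdeal hne)] at h1
    exact (maximalIdeal.isMaximal R).ne_top h1

/-- Initial forms multiply, so `H` passes to the polynomial ring over the residue field. That ring
is factorial, so the initial form of `g` divides that of `f`; a lift of the quotient cancels the
leading term of `f`. -/
theorem exists_sub_mul_mem_pow_succ [IsDomain R] (hx : Ideal.span (Set.range x) = maximalIdeal R)
    (hd : (Nat.card ι : ℕ∞) ≤ (maximalIdeal R).height) {f g h : R} {l : ℕ} (hg : g ≠ 0)
    (hh : h ≠ 0) (H : ∀ k : ℕ, g ^ k ∣ h * f ^ k) (hf : f ∈ maximalIdeal R ^ l) :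
    ∃ s, f - g * s ∈ maximalIdeal R ^ (l + 1) := by
  by_cases hf' : f ∈ maximalIdeal R ^ (l + 1)
  · exact ⟨0, by simpa using hf'⟩
  have hf0 : f ≠ 0 := by
    rintro rfl
    exact hf' (Ideal.zero_mem _)
  obtain ⟨F, hF, rfl⟩ := exists_isHomogeneous_of_mem_pow hx hf
  have hF0 : MvPolynomial.map (residue R) F ≠ 0 := fun h0 =>
    hf' (eval_mem_pow_succ_of_isHomogeneous hx hF h0)
  obtain ⟨n, G, hG, rfl, hG0⟩ := exists_initialForm hx hg
  obtain ⟨p, P, hP, rfl, hP0⟩ := exists_initialForm hx hh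
  have hdvd : MvPolynomial.map (residue R) G ∣ MvPolynomial.map (residue R) F := by
    refine dvd_of_forall_pow_dvd_mul_pow hP0 hG0 fun k => ?_
    obtain ⟨r, hr⟩ := H k
    have hr0 : r ≠ 0 := by
      rintro rfl
      rw [mul_zero] at hr
      exact (mul_ne_zero hh (pow_ne_zero k hf0)) hr
    obtain ⟨q, M, hM, rfl, hM0⟩ := exists_initialForm hx hr0
    have := (map_residue_eq_of_eval_eq hx hd (hP.mul (hF.pow k)) ((hG.pow k).mul hM) ?_ ?_ ?_).2
    · rw [map_mul, map_mul, map_pow, map_pow] at this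
      exact ⟨_, this⟩
    · rw [map_mul, map_pow]
      exact mul_ne_zero hP0 (pow_ne_zero k hF0)
    · rw [map_mul, map_pow]
      exact mul_ne_zero (pow_ne_zero k hG0) hM0
    · simpa using hr
  obtain ⟨hnl, N, hN, hFN⟩ := exists_isHomogeneous_mul_eq (hF.map _) (hG.map _) hF0 hdvd
  obtain ⟨M, hM, rfl⟩ := exists_lift_isHomogeneous (residue R) residue_surjective hN
  refine ⟨MvPolynomial.eval x M, ?_⟩
  rw [← map_mul, ← map_sub]
  have hGM := hG.mul hM
  rw [Nat.add_sub_cancel' hnl] at hGM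
  exact eval_mem_pow_succ_of_isHomogeneous hx (hF.sub hGM) (by rw [map_sub, map_mul, hFN, sub_self])

end RegularNormal

/-- An integral `z = f / g` is almost integral: some `h ≠ 0` has `gᵏ ∣ h fᵏ` for all `k`. Since `z -
s` is again integral, this kind of divisibility survives replacing `f` by `f - g s`, so the leading
terms of `f` can be removed one after another. -/
theorem mem_range_of_isIntegral_of_isRegularLocalRing {R K : Type*} [CommRing R] [IsDomain R]
    [IsRegularLocalRing R] [Field K] [Algebra R K] [IsFractionRing R K] {z : K}
    (hz : IsIntegral R z) : ∃ y, algebraMap R K y = z := by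
  have hfg : (maximalIdeal R).FG := (maximalIdeal R).fg_of_isNoetherianRing
  have hgfin : Finite (maximalIdeal R).generators := Submodule.FG.finite_generators hfg
  let x : (maximalIdeal R).generators → R := Subtype.val
  have hx : Ideal.span (Set.range x) = maximalIdeal R := by
    rw [Subtype.range_coe]
    exact Submodule.span_generators _
  have hd : (Nat.card (maximalIdeal R).generators : ℕ∞) ≤ (maximalIdeal R).height := by
    rw [height_maximalIdeal_eq_spanFinrank, ← Submodule.FG.generators_ncard hfg]
    rfl
  obtain ⟨h, hh, hz'⟩ := hz.isAlmostIntegral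
  have hh0 : h ≠ 0 := nonZeroDivisors.ne_zero hh
  obtain ⟨f, ⟨g, hgR⟩, rfl⟩ := IsLocalization.exists_mk'_eq (nonZeroDivisors R) z
  have hg : g ≠ 0 := nonZeroDivisors.ne_zero hgR
  have hinj : Function.Injective (algebraMap R K) := IsFractionRing.injective R K
  have hgK : algebraMap R K g ≠ 0 := by simpa using hg
  have hzfg : IsLocalization.mk' K f ⟨g, hgR⟩ = algebraMap R K f / algebraMap R K g :=
    IsFractionRing.mk'_eq_div _
  rw [hzfg] at hz' ⊢
  have hc : ∀ s : R, ∀ k : ℕ, g ^ k ∣ h * (f - g * s) ^ k := by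
    intro s k
    have : h • (algebraMap R K f / algebraMap R K g - algebraMap R K s) ^ k ∈
        (algebraMap R K).range := by
      rw [sub_eq_add_neg, add_pow, Finset.smul_sum]
      refine sum_mem fun i _ => ?_
      rw [mul_assoc, ← smul_mul_assoc]
      refine mul_mem (hz' i) ?_
      exact ⟨(-s) ^ (k - i) * (k.choose i : R), by simp⟩
    obtain ⟨r, hr⟩ := this
    refine ⟨r, hinj ?_⟩
    rw [Algebra.smul_def] at hr
    simp only [map_mul, map_pow, map_sub, hr]
    have hfg : algebraMap R K f - algebraMap R K g * algebraMap R K s =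
      algebraMap R K g * (algebraMap R K f / algebraMap R K g - algebraMap R K s) := by
      field_simp
    rw [hfg, mul_pow]
    ring
  have hmem : f ∈ Ideal.span {g} := by
    refine mem_of_forall_mem_sup_pow fun l => ?_
    suffices ∃ s, f - g * s ∈ maximalIdeal R ^ l by
      obtain ⟨s, hs⟩ := this
      refine Submodule.mem_sup.2 ⟨g * s, Ideal.mul_mem_right _ _ (Ideal.mem_span_singleton_self g),
        _, hs, by ring⟩
    induction l with
    | zero => exact ⟨0, by simp⟩
    | succ l ih =>
      obtain ⟨s, hs⟩ := ih
      obtain ⟨t, ht⟩ := exists_sub_mul_mem_pow_succ hx hd hg hh0 (hc s) hs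
      exact ⟨s + t, by rwa [mul_add, ← sub_sub]⟩
  obtain ⟨s, rfl⟩ := Ideal.mem_span_singleton.1 hmem
  exact ⟨s, by rw [map_mul]; field_simp⟩

/-! ### Lifting regularity from a hypersurface -/

section RegularQuotient

/-- A Noetherian local ring is regular if its quotient by a nonzerodivisor is. -/
theorem isRegularLocalRing_of_quotient_span_singleton {B : Type*} [CommRing B] [IsLocalRing B]
    [IsNoetherianRing B] {x : B} (hx : x ∈ maximalIdeal B) (hx' : x ∈ nonZeroDivisors B)
    (h : IsRegularLocalRing (B ⧸ Ideal.span {x})) : IsRegularLocalRing B := by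
  classical
  apply IsRegularLocalRing.of_spanFinrank_maximalIdeal_le
  set π := Ideal.Quotient.mk (Ideal.span {x}) with hπ
  have hsurj : Function.Surjective π := Ideal.Quotient.mk_surjective
  have hdim := ringKrullDim_quotient_succ_le_of_nonZeroDivisor hx'
  rw [← IsRegularLocalRing.spanFinrank_maximalIdeal] at hdim
  refine le_trans ?_ hdim
  have hfg := (maximalIdeal (B ⧸ Ideal.span {x})).fg_of_isNoetherianRing
  obtain ⟨s, hs, hspan⟩ := Submodule.FG.exists_span_finset_card_eq_spanFinrank hfg
  rw [← hs]
  let t : Finset B := insert x (s.image (Function.surjInv hsurj))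
  have ht : Ideal.span (t : Set B) = maximalIdeal B := by
    have hcomap : (maximalIdeal (B ⧸ Ideal.span {x})).comap π = maximalIdeal B :=
      (((local_hom_TFAE π).out 0 4).1 (IsLocalHom.of_surjective π hsurj))
    have hmap : (Ideal.span (t : Set B)).map π = maximalIdeal (B ⧸ Ideal.span {x}) := by
      rw [Ideal.map_span, ← hspan]
      apply le_antisymm
      · rw [Ideal.span_le]
        rintro _ ⟨b, hb, rfl⟩
        rcases Finset.mem_insert.1 (Finset.mem_coe.1 hb) with rfl | hb
        · rw [hπ, Ideal.Quotient.eq_zero_iff_mem.2 (Ideal.mem_span_singleton_self b)]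
          exact Submodule.zero_mem _
        · obtain ⟨c, hc, rfl⟩ := Finset.mem_image.1 hb
          rw [Function.surjInv_eq hsurj]
          exact Submodule.subset_span hc
      · refine Submodule.span_mono fun c hc => ?_
        exact ⟨Function.surjInv hsurj c, Finset.mem_insert_of_mem (Finset.mem_image_of_mem _ hc),
          Function.surjInv_eq _ _⟩
    rw [← hcomap, ← hmap, Ideal.comap_map_of_surjective _ hsurj, ← RingHom.ker_eq_comap_bot, hπ,
      Ideal.mk_ker, left_eq_sup]
    exact Ideal.span_mono (by simp [t])
  have hcard : t.card ≤ s.card + 1 :=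
    (Finset.card_insert_le _ _).trans (Nat.add_le_add_right Finset.card_image_le 1)
  have hle : (maximalIdeal B).spanFinrank ≤ s.card + 1 := by
    rw [← ht]
    refine le_trans (Submodule.spanFinrank_span_le_ncard_of_finite (Finset.finite_toSet t)) ?_
    rwa [Set.ncard_coe_finset]
  exact_mod_cast hle

/-- `B / xB` is the localization of the regular ring `C / xC` at the image of `P`, and `x` is a
nonzerodivisor in `B`. -/
theorem isRegularLocalRing_localization_of_quotient {C B : Type*} [CommRing C] [IsDomain C]
    [IsNoetherianRing C] {x : C} (hx : x ≠ 0) (hreg : IsRegularRing (C ⧸ Ideal.span {x}))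
    (P : Ideal C) [P.IsPrime] (hxP : x ∈ P) [CommRing B] [Algebra C B]
    [IsLocalization.AtPrime B P] : IsRegularLocalRing B := by
  have hloc : IsLocalRing B := IsLocalization.AtPrime.isLocalRing B P
  have hN : IsNoetherianRing B := IsLocalization.isNoetherianRing P.primeCompl B inferInstance
  have hdom : IsDomain B := IsLocalization.isDomain_of_le_nonZeroDivisors B
    P.primeCompl_le_nonZeroDivisors
  have hinj : Function.Injective (algebraMap C B) :=
    IsLocalization.injective B P.primeCompl_le_nonZeroDivisors
  refine isRegularLocalRing_of_quotient_span_singleton (x := algebraMap C B x) ?_ ?_ ?_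
  · exact (IsLocalization.AtPrime.to_map_mem_maximal_iff B P x).2 hxP
  · rw [mem_nonZeroDivisors_iff_ne_zero]
    exact fun h => hx (hinj (by simpa using h))
  have hle : Ideal.span {x} ≤ P := (Ideal.span_singleton_le_iff_mem _).2 hxP
  set π := Ideal.Quotient.mk (Ideal.span {x})
  have hP' : (P.map π).IsPrime := by
    apply Ideal.map_isPrime_of_surjective Ideal.Quotient.mk_surjective
    rwa [Ideal.mk_ker]
  have hcomap : (P.map π).comap π = P := by
    rw [Ideal.comap_map_of_surjective _ Ideal.Quotient.mk_surjective, ← RingHom.ker_eq_comap_bot,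
      Ideal.mk_ker, sup_eq_left.2 hle]
  have hM : Algebra.algebraMapSubmonoid (C ⧸ Ideal.span {x}) P.primeCompl =
      (P.map π).primeCompl := by
    ext c
    constructor
    · rintro ⟨c, hc, rfl⟩ hmem
      apply hc
      change c ∈ P
      rw [← hcomap]
      exact hmem
    · intro hc
      obtain ⟨c, rfl⟩ := Ideal.Quotient.mk_surjective c
      exact ⟨c, fun h => hc (Ideal.mem_map_of_mem _ h), rfl⟩
  have h1 : IsLocalization (P.map π).primeCompl
      (B ⧸ (Ideal.span {x}).map (algebraMap C B)) := by
    rw [← hM]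
    infer_instance
  have h2 := IsRegularLocalRing.of_ringEquiv (IsLocalization.algEquiv (P.map π).primeCompl
    (Localization.AtPrime (P.map π)) (B ⧸ (Ideal.span {x}).map (algebraMap C B))).toRingEquiv
  exact IsRegularLocalRing.of_ringEquiv (Ideal.quotEquivOfEq
    (by rw [Ideal.map_span, Set.image_singleton]) :
    (B ⧸ (Ideal.span {x}).map (algebraMap C B)) ≃+* (B ⧸ Ideal.span {algebraMap C B x}))

end RegularQuotient

/-! ### Homogenization of polynomials -/

section Homogenize

variable {σ R : Type*} [CommRing R]

/-- The homogenization of degree `N` of a polynomial of total degree at most `N`. -/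
def homogenize (N : ℕ) (F : MvPolynomial σ R) : MvPolynomial (Option σ) R :=
  ∑ i ∈ Finset.range (N + 1),
    MvPolynomial.rename some (MvPolynomial.homogeneousComponent i F) * MvPolynomial.X none ^ (N - i)

theorem homogenize_isHomogeneous (N : ℕ) (F : MvPolynomial σ R) :
    (homogenize N F).IsHomogeneous N := by
  refine MvPolynomial.IsHomogeneous.sum _ _ _ fun i hi => ?_
  have h1 := (MvPolynomial.homogeneousComponent_isHomogeneous i F).rename_isHomogeneous
    (f := (some : σ → Option σ))
  have h2 := (MvPolynomial.isHomogeneous_X R (none : Option σ)).pow (N - i)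
  have := h1.mul h2
  rwa [one_mul, Nat.add_sub_cancel' (Nat.lt_succ_iff.1 (Finset.mem_range.1 hi))] at this

theorem sum_homogeneousComponent_of_le {N : ℕ} {F : MvPolynomial σ R} (hN : F.totalDegree ≤ N) :
    ∑ i ∈ Finset.range (N + 1), MvPolynomial.homogeneousComponent i F = F := by
  conv_rhs => rw [← MvPolynomial.sum_homogeneousComponent F]
  refine (Finset.sum_subset (Finset.range_mono (by omega)) fun i _ hi => ?_).symm
  exact MvPolynomial.homogeneousComponent_eq_zero _ _ (by simpa using hi)

theorem map_eq_zero_of_map_homogenize_eq_zero {k : Type*} [CommRing k] (φ : R →+* k) {N : ℕ}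
    {F : MvPolynomial σ R} (hN : F.totalDegree ≤ N)
    (h : MvPolynomial.map φ (homogenize N F) = 0) : MvPolynomial.map φ F = 0 := by
  let δ : MvPolynomial (Option σ) k →ₐ[k] MvPolynomial σ k :=
    MvPolynomial.aeval fun o => o.elim 1 MvPolynomial.X
  have h1 : ∀ G : MvPolynomial σ R, δ (MvPolynomial.map φ (MvPolynomial.rename some G)) =
      MvPolynomial.map φ G := by
    intro G
    rw [MvPolynomial.map_rename, MvPolynomial.aeval_rename]
    exact MvPolynomial.aeval_X_left_apply (MvPolynomial.map φ G)
  have h2 := congrArg δ h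
  rw [homogenize, map_sum, map_sum, map_zero] at h2
  conv_lhs => rw [← sum_homogeneousComponent_of_le hN, map_sum]
  rw [← h2]
  refine Finset.sum_congr rfl fun i _ => ?_
  rw [map_mul, map_mul, h1]
  simp [δ]

/-- This turns polynomials in the fractions `yᵢ / x₀`, the elements of a blowup chart, into forms in
generators of the maximal ideal, to which analytic independence applies. -/
theorem eval_homogenize {K : Type*} [Field K] [Algebra R K] {x₀ : R} {y : σ → R}
    (hx₀ : algebraMap R K x₀ ≠ 0) {N : ℕ} {F : MvPolynomial σ R} (hN : F.totalDegree ≤ N) :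
    algebraMap R K (MvPolynomial.eval (fun o : Option σ => o.elim x₀ y) (homogenize N F)) =
      algebraMap R K x₀ ^ N *
        MvPolynomial.aeval (fun i => algebraMap R K (y i) / algebraMap R K x₀) F := by
  conv_rhs => rw [← sum_homogeneousComponent_of_le hN, map_sum, Finset.mul_sum]
  rw [homogenize, map_sum, map_sum]
  refine Finset.sum_congr rfl fun i hi => ?_
  have hi' : i ≤ N := Nat.lt_succ_iff.1 (Finset.mem_range.1 hi)
  have h1 := eval_smul_of_isHomogeneous (MvPolynomial.homogeneousComponent_isHomogeneous i F)
    (algebraMap R K) (algebraMap R K x₀) (fun i => algebraMap R K (y i) / algebraMap R K x₀)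
  have h2 : (fun i => algebraMap R K x₀ * (algebraMap R K (y i) / algebraMap R K x₀)) =
      fun i => algebraMap R K (y i) := by
    funext i
    field_simp
  rw [h2] at h1
  rw [MvPolynomial.aeval_def, ← Nat.sub_add_cancel hi', pow_add, mul_assoc, ← h1,
    Nat.sub_add_cancel hi', map_mul, MvPolynomial.eval_rename, map_mul, map_pow]
  have h3 := MvPolynomial.eval₂_comp_left (algebraMap R K) (RingHom.id R) y
    (MvPolynomial.homogeneousComponent i F)
  rw [MvPolynomial.eval₂_id, RingHom.comp_id] at h3
  simp only [MvPolynomial.eval_X, Option.elim_none, map_pow]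
  rw [mul_comm]
  congr 1

end Homogenize

/-! ### Domination and localization inside a field -/

section LocalSubrings

variable {K : Type*} [Field K]

theorem mem_maximalIdeal_iff_of_le {A B : LocalSubring K} (h : A ≤ B) {a : K}
    (ha : a ∈ A.toSubring) :
    (⟨a, ha⟩ : A.toSubring) ∈ maximalIdeal A.toSubring ↔
      (⟨a, h.1 ha⟩ : B.toSubring) ∈ maximalIdeal B.toSubring := by
  have := h.2
  have hiff := isUnit_map_iff (Subring.inclusion h.1) (⟨a, ha⟩ : A.toSubring)
  rw [mem_maximalIdeal, mem_maximalIdeal, mem_nonunits_iff, mem_nonunits_iff, not_iff_not]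
  exact hiff.symm

/-- In a local subring of a field the units are the elements with inverse in the subring. -/
theorem isUnit_iff_inv_mem {A : Subring K} {a : K} (ha : a ∈ A) (h0 : a ≠ 0) :
    IsUnit (⟨a, ha⟩ : A) ↔ a⁻¹ ∈ A := by
  constructor
  · rintro ⟨u, hu⟩
    have h1 : ((u⁻¹ : Aˣ) : A) * (⟨a, ha⟩ : A) = 1 := by rw [← hu]; simp
    have h2 : (((u⁻¹ : Aˣ) : A) : K) * a = 1 := congrArg Subtype.val h1
    rw [← eq_inv_of_mul_eq_one_left h2]
    exact Subtype.property _
  · intro h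
    exact IsUnit.of_mul_eq_one ⟨a⁻¹, h⟩ (Subtype.ext (mul_inv_cancel₀ h0))

theorem mem_maximalIdeal_iff_inv_notMem {A : LocalSubring K} {a : K} (ha : a ∈ A.toSubring)
    (h0 : a ≠ 0) : (⟨a, ha⟩ : A.toSubring) ∈ maximalIdeal A.toSubring ↔ a⁻¹ ∉ A.toSubring := by
  rw [mem_maximalIdeal, mem_nonunits_iff, isUnit_iff_inv_mem ha h0]

/-- Domination says that no nonunit of `A` becomes invertible in `B`; in this form it can be checked
inside `K`, without maximal ideals of subtypes. -/
theorem le_iff_inv_mem {A B : LocalSubring K} :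
    A ≤ B ↔ A.toSubring ≤ B.toSubring ∧ ∀ a ∈ A.toSubring, a ≠ 0 → a⁻¹ ∈ B.toSubring →
      a⁻¹ ∈ A.toSubring := by
  constructor
  · rintro h
    refine ⟨h.1, fun a ha h0 hi => ?_⟩
    by_contra hn
    exact (mem_maximalIdeal_iff_inv_notMem (h.1 ha) h0).1
      ((mem_maximalIdeal_iff_of_le h ha).1 ((mem_maximalIdeal_iff_inv_notMem ha h0).2 hn)) hi
  · rintro ⟨h, H⟩
    refine ⟨h, ⟨fun a ha => ?_⟩⟩
    have h0 : (a : K) ≠ 0 := by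
      intro h0
      have : Subring.inclusion h a = 0 := Subtype.ext h0
      rw [this] at ha
      exact not_isUnit_zero ha
    exact (isUnit_iff_inv_mem a.2 h0).2 (H a a.2 h0 ((isUnit_iff_inv_mem (h a.2) h0).1 ha))

theorem mem_ofPrime_iff {A : Subring K} {P : Ideal A} [P.IsPrime] {k : K} :
    k ∈ (LocalSubring.ofPrime A P).toSubring ↔ ∃ a s : A, s ∉ P ∧ k = a / s := by
  have hne : ∀ s : A, s ∉ P → (s : K) ≠ 0 := by
    rintro s hs h0
    exact hs ((Subtype.ext h0 : s = 0) ▸ P.zero_mem)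
  constructor
  · intro hk
    obtain ⟨a, s, has⟩ := IsLocalization.exists_mk'_eq P.primeCompl
      (⟨k, hk⟩ : (LocalSubring.ofPrime A P).toSubring)
    refine ⟨a, s, s.2, ?_⟩
    rw [IsLocalization.mk'_eq_iff_eq_mul] at has
    have := congrArg Subtype.val has
    rw [eq_div_iff (hne _ s.2)]
    exact this.symm
  · rintro ⟨a, s, hs, rfl⟩
    let w := IsLocalization.mk' (LocalSubring.ofPrime A P).toSubring a (⟨s, hs⟩ : P.primeCompl)
    have hw : w * algebraMap A _ s = algebraMap A _ a := IsLocalization.mk'_spec _ a ⟨s, hs⟩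
    have := congrArg Subtype.val hw
    have h2 : (a : K) / s = (w : K) := by
      rw [div_eq_iff (hne s hs)]
      exact this.symm
    rw [h2]
    exact w.2

theorem div_pow_mem {T : LocalSubring K} {B : Subring K} (hTB : T.toSubring ≤ B)
    {x : T.toSubring} (hx : ∀ y ∈ maximalIdeal T.toSubring, (y : K) / x ∈ B) {n : ℕ}
    {f : T.toSubring} (hf : f ∈ maximalIdeal T.toSubring ^ n) : (f : K) / (x : K) ^ n ∈ B := by
  induction n generalizing f with
  | zero => simpa using hTB f.2
  | succ n ih =>
    rw [pow_succ] at hf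
    refine Submodule.mul_induction_on hf ?_ ?_
    · intro g hg y hy
      have := B.mul_mem (ih hg) (hx y hy)
      rwa [div_mul_div_comm, ← pow_succ] at this
    · intro y z hy hz
      have := B.add_mem hy hz
      rwa [← add_div] at this

theorem subset_quadraticChart (T : LocalSubring K) (x : T.toSubring) :
    T.toSubring ≤ quadraticChart T x := fun _ ha => Subring.subset_closure (Or.inl ha)

theorem div_mem_quadraticChart {T : LocalSubring K} {x y : T.toSubring}
    (hy : y ∈ maximalIdeal T.toSubring) : (y : K) / x ∈ quadraticChart T x :=
  Subring.subset_closure (Or.inr ⟨y, hy, rfl⟩)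

theorem quadraticChart_le {T : LocalSubring K} {x : T.toSubring} {B : Subring K}
    (hTB : T.toSubring ≤ B) (hx : ∀ y ∈ maximalIdeal T.toSubring, (y : K) / x ∈ B) :
    quadraticChart T x ≤ B := by
  rw [quadraticChart, Subring.closure_le]
  rintro k (hk | ⟨y, hy, rfl⟩)
  · exact hTB hk
  · exact hx y hy

end LocalSubrings

/-! ### Charts of the blowup of a regular local ring -/

section Chart

variable {K : Type*} [Field K] {T : LocalSubring K} {n : ℕ} {x₀ : T.toSubring}
  {y : Fin n → T.toSubring}

theorem mem_quadraticChart_iff (hx₀ : x₀ ≠ 0)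
    (hspan : Ideal.span (insert x₀ (Set.range y)) = maximalIdeal T.toSubring) {k : K} :
    k ∈ quadraticChart T x₀ ↔ ∃ F : MvPolynomial (Fin n) T.toSubring,
      MvPolynomial.aeval (fun i => (y i : K) / (x₀ : K)) F = k := by
  have hx₀' : (x₀ : K) ≠ 0 := fun h => hx₀ (Subtype.ext h)
  constructor
  · intro hk
    have hle : quadraticChart T x₀ ≤ (MvPolynomial.aeval (R := T.toSubring)
        (fun i => (y i : K) / (x₀ : K))).toRingHom.range := by
      refine quadraticChart_le ?_ ?_
      · intro t ht
        exact ⟨MvPolynomial.C ⟨t, ht⟩, by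
          simp only [AlgHom.toRingHom_eq_coe, RingHom.coe_coe, MvPolynomial.aeval_C]; rfl⟩
      · intro z hz
        rw [← hspan] at hz
        refine Submodule.span_induction
          (p := fun (z : T.toSubring) _ => (z : K) / x₀ ∈ (MvPolynomial.aeval
          (R := T.toSubring) (fun i => (y i : K) / (x₀ : K))).toRingHom.range) ?_ ?_ ?_ ?_ hz
        · rintro _ (rfl | ⟨i, rfl⟩)
          · rw [div_self hx₀']
            exact one_mem _
          · exact ⟨MvPolynomial.X i, by simp⟩
        · simp
        · intro a b _ _ ha hb
          have := add_mem ha hb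
          rwa [← add_div] at this
        · intro r a _ ha
          obtain ⟨G, hG⟩ := ha
          refine ⟨MvPolynomial.C r * G, ?_⟩
          rw [map_mul, hG]
          simp only [AlgHom.toRingHom_eq_coe, RingHom.coe_coe, MvPolynomial.aeval_C]
          exact (mul_div_assoc (r : K) (a : K) (x₀ : K)).symm
    obtain ⟨F, hF⟩ := hle hk
    exact ⟨F, hF⟩
  · rintro ⟨F, rfl⟩
    have hy : ∀ i, y i ∈ maximalIdeal T.toSubring := fun i =>
      hspan ▸ Ideal.subset_span (Or.inr ⟨i, rfl⟩)
    rw [MvPolynomial.aeval_def, MvPolynomial.eval₂_eq]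
    refine sum_mem fun d _ => mul_mem ?_ (prod_mem fun i _ => pow_mem ?_ _)
    · exact subset_quadraticChart T x₀ (Subtype.property _)
    · exact div_mem_quadraticChart (hy i)

theorem span_range_option_elim
    (hspan : Ideal.span (insert x₀ (Set.range y)) = maximalIdeal T.toSubring) :
    Ideal.span (Set.range fun o : Option (Fin n) => o.elim x₀ y) = maximalIdeal T.toSubring := by
  rw [← hspan]
  congr 1
  ext r
  constructor
  · rintro ⟨_ | i, rfl⟩
    · exact Or.inl rfl
    · exact Or.inr ⟨i, rfl⟩
  · rintro (rfl | ⟨i, rfl⟩)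
    · exact ⟨none, rfl⟩
    · exact ⟨some i, rfl⟩

theorem card_option_le (hd : (n + 1 : ℕ∞) = (maximalIdeal T.toSubring).height) :
    (Nat.card (Option (Fin n)) : ℕ∞) ≤ (maximalIdeal T.toSubring).height := by
  rw [← hd]
  simp

/-- The generator of the maximal ideal in a chart of the blowup. -/
def chartElem (T : LocalSubring K) (x₀ : T.toSubring) : quadraticChart T x₀ :=
  ⟨x₀, subset_quadraticChart T x₀ x₀.2⟩

/-- The evaluation homomorphism from a polynomial ring onto a chart of the blowup. -/
def chartEval (hx₀ : x₀ ≠ 0)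
    (hspan : Ideal.span (insert x₀ (Set.range y)) = maximalIdeal T.toSubring) :
    MvPolynomial (Fin n) T.toSubring →+* quadraticChart T x₀ :=
  (MvPolynomial.aeval (R := T.toSubring) (fun i => (y i : K) / (x₀ : K))).toRingHom.codRestrict _
    fun F => (mem_quadraticChart_iff hx₀ hspan).2 ⟨F, rfl⟩

theorem chartEval_surjective (hx₀ : x₀ ≠ 0)
    (hspan : Ideal.span (insert x₀ (Set.range y)) = maximalIdeal T.toSubring) :
    Function.Surjective (chartEval hx₀ hspan) := by
  rintro ⟨k, hk⟩
  obtain ⟨F, hF⟩ := (mem_quadraticChart_iff hx₀ hspan).1 hk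
  exact ⟨F, Subtype.ext hF⟩

variable [IsRegularLocalRing T.toSubring]

/-- The special fibre of a chart of the blowup of a regular local ring is an affine space. -/
theorem map_residue_eq_zero_of_aeval_eq_mul (hx₀ : x₀ ≠ 0)
    (hspan : Ideal.span (insert x₀ (Set.range y)) = maximalIdeal T.toSubring)
    (hd : (n + 1 : ℕ∞) = (maximalIdeal T.toSubring).height)
    {F G : MvPolynomial (Fin n) T.toSubring}
    (h : MvPolynomial.aeval (fun i => (y i : K) / (x₀ : K)) F =
      (x₀ : K) * MvPolynomial.aeval (fun i => (y i : K) / (x₀ : K)) G) :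
    MvPolynomial.map (residue T.toSubring) F = 0 := by
  have hx₀' : (x₀ : K) ≠ 0 := fun h => hx₀ (Subtype.ext h)
  -- Homogenizing both sides in one common degree turns the relation into an equality whose right
  -- side has the extra factor `x₀`, so the form of degree `N` takes a value in `𝔪ᴺ⁺¹`.
  set N := max F.totalDegree G.totalDegree
  have hF := eval_homogenize (K := K) (y := y) (x₀ := x₀) hx₀' (le_max_left _ _ : F.totalDegree ≤ N)
  have hG := eval_homogenize (K := K) (y := y) (x₀ := x₀) hx₀'
    (le_max_right _ _ : G.totalDegree ≤ N)
  have hspan' := span_range_option_elim hspan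
  refine map_eq_zero_of_map_homogenize_eq_zero (residue T.toSubring) (le_max_left _ _ : _ ≤ N) ?_
  refine map_residue_eq_zero_of_eval_mem hspan' (card_option_le hd)
    (homogenize_isHomogeneous N F) ?_
  have hFG : MvPolynomial.eval (fun o : Option (Fin n) => o.elim x₀ y) (homogenize N F) =
      x₀ * MvPolynomial.eval (fun o : Option (Fin n) => o.elim x₀ y) (homogenize N G) := by
    have hinj : Function.Injective (algebraMap T.toSubring K) := Subtype.val_injective
    apply hinj
    rw [map_mul, hF, hG]
    change (x₀ : K) ^ N * MvPolynomial.aeval (fun i => (y i : K) / (x₀ : K)) F =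
      (x₀ : K) * ((x₀ : K) ^ N * MvPolynomial.aeval (fun i => (y i : K) / (x₀ : K)) G)
    rw [h]
    ring
  rw [hFG, pow_succ']
  refine Ideal.mul_mem_mul (hspan ▸ Ideal.subset_span (Or.inl rfl)) ?_
  simpa using eval_mem_pow_of_isHomogeneous hspan' (homogenize_isHomogeneous N G) (J := ⊤)
    (fun _ => trivial)

/-- One inclusion is analytic independence; the other holds because `t = x₀ · (t / x₀)` in the chart
for each `t` in the maximal ideal. -/
theorem ker_mk_comp_chartEval (hx₀ : x₀ ≠ 0)
    (hspan : Ideal.span (insert x₀ (Set.range y)) = maximalIdeal T.toSubring)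
    (hd : (n + 1 : ℕ∞) = (maximalIdeal T.toSubring).height) :
    RingHom.ker ((Ideal.Quotient.mk (Ideal.span {chartElem T x₀})).comp (chartEval hx₀ hspan)) =
      RingHom.ker (MvPolynomial.map (residue T.toSubring) :
        MvPolynomial (Fin n) T.toSubring →+* _) := by
  have hx₀K : (x₀ : K) ≠ 0 := fun h => hx₀ (Subtype.ext h)
  apply le_antisymm
  · intro F hF
    rw [RingHom.mem_ker, RingHom.comp_apply, Ideal.Quotient.eq_zero_iff_dvd] at hF
    obtain ⟨c, hc⟩ := hF
    obtain ⟨G, rfl⟩ := chartEval_surjective hx₀ hspan c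
    exact map_residue_eq_zero_of_aeval_eq_mul hx₀ hspan hd (congrArg Subtype.val hc)
  · rw [MvPolynomial.ker_map, ker_residue, Ideal.map_le_iff_le_comap]
    intro t ht
    rw [Ideal.mem_comap, RingHom.mem_ker, RingHom.comp_apply, Ideal.Quotient.eq_zero_iff_dvd]
    refine ⟨⟨(t : K) / x₀, div_mem_quadraticChart ht⟩, Subtype.ext ?_⟩
    have h1 : (chartEval hx₀ hspan (MvPolynomial.C t) : K) = t := by
      change MvPolynomial.aeval _ (MvPolynomial.C t) = (t : K)
      rw [MvPolynomial.aeval_C]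
      rfl
    rw [h1]
    exact (mul_div_cancel₀ (t : K) hx₀K).symm

/-- The special fibre of a chart of the blowup as a polynomial ring. -/
def chartQuotientEquiv (hx₀ : x₀ ≠ 0)
    (hspan : Ideal.span (insert x₀ (Set.range y)) = maximalIdeal T.toSubring)
    (hd : (n + 1 : ℕ∞) = (maximalIdeal T.toSubring).height) :
    MvPolynomial (Fin n) (ResidueField T.toSubring) ≃+*
      (quadraticChart T x₀ ⧸ Ideal.span {chartElem T x₀}) :=
  (RingHom.quotientKerEquivOfSurjective
    (f := (MvPolynomial.map (residue T.toSubring) : MvPolynomial (Fin n) T.toSubring →+* _))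
    (MvPolynomial.map_surjective _ residue_surjective)).symm.trans <|
  (Ideal.quotEquivOfEq (ker_mk_comp_chartEval hx₀ hspan hd).symm).trans <|
  RingHom.quotientKerEquivOfSurjective
    (Ideal.Quotient.mk_surjective.comp (chartEval_surjective hx₀ hspan))

theorem isNoetherianRing_quadraticChart (hx₀ : x₀ ≠ 0)
    (hspan : Ideal.span (insert x₀ (Set.range y)) = maximalIdeal T.toSubring) :
    IsNoetherianRing (quadraticChart T x₀) :=
  isNoetherianRing_of_surjective _ _ _ (chartEval_surjective hx₀ hspan)

theorem chartElem_prime (hx₀ : x₀ ≠ 0)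
    (hspan : Ideal.span (insert x₀ (Set.range y)) = maximalIdeal T.toSubring)
    (hd : (n + 1 : ℕ∞) = (maximalIdeal T.toSubring).height) : Prime (chartElem T x₀) := by
  rw [← Ideal.span_singleton_prime]
  · rw [← Ideal.Quotient.isDomain_iff_prime]
    exact MulEquiv.isDomain _ (chartQuotientEquiv hx₀ hspan hd).symm.toMulEquiv
  · exact fun h => hx₀ (Subtype.ext (congrArg (fun z : quadraticChart T x₀ => (z : K)) h))

/-- Modulo `x₀` the chart is a polynomial ring over a field, which is regular, and regularity lifts
along the nonzerodivisor `x₀`. -/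
theorem isRegularLocalRing_ofPrime_quadraticChart (hx₀ : x₀ ≠ 0)
    (hspan : Ideal.span (insert x₀ (Set.range y)) = maximalIdeal T.toSubring)
    (hd : (n + 1 : ℕ∞) = (maximalIdeal T.toSubring).height)
    (P : Ideal (quadraticChart T x₀)) [P.IsPrime] (hP : chartElem T x₀ ∈ P) :
    IsRegularLocalRing (LocalSubring.ofPrime (quadraticChart T x₀) P).toSubring := by
  have := isNoetherianRing_quadraticChart hx₀ hspan
  exact isRegularLocalRing_localization_of_quotient (chartElem_prime hx₀ hspan hd).ne_zero
    (IsRegularRing.of_ringEquiv (chartQuotientEquiv hx₀ hspan hd)) P hP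

end Chart

/-! ### The order function of a local ring -/

section Order

variable {A : Type*} [CommRing A] [IsLocalRing A]

theorem natCast_le_ord_iff {f : A} {n : ℕ} : (n : ℕ∞) ≤ ord A f ↔ f ∈ maximalIdeal A ^ n := by
  constructor
  · intro h
    by_contra hf
    have hn : n ≠ 0 := by
      rintro rfl
      simp at hf
    have hle : ord A f ≤ ((n - 1 : ℕ) : ℕ∞) := by
      refine iSup₂_le fun k hk => ?_
      have hkn : k < n := by
        by_contra hkn
        exact hf (Ideal.pow_le_pow_right (not_lt.1 hkn) hk)
      exact_mod_cast (by omega : k ≤ n - 1)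
    have : n ≤ n - 1 := by exact_mod_cast h.trans hle
    omega
  · intro h
    exact le_iSup₂ (f := fun (n : ℕ) (_ : f ∈ maximalIdeal A ^ n) => (n : ℕ∞)) n h

theorem ord_le_natCast {f : A} {n : ℕ} (hf : f ∉ maximalIdeal A ^ (n + 1)) : ord A f ≤ n := by
  by_contra h
  rw [not_le] at h
  apply hf
  rw [← natCast_le_ord_iff]
  push_cast
  exact Order.add_one_le_of_lt h

end Order

/-! ### The quadratic transform centered in a dominating ring -/

section Center

variable {K : Type*} [Field K]

/-- `T'` is the local quadratic transform of the regular local ring `T` in which the maximal ideal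
of `T` is generated by `x`. -/
structure IsQuadraticCenter (T : LocalSubring K) (x : T.toSubring) (T' : LocalSubring K) :
    Prop where
  mem : x ∈ maximalIdeal T.toSubring
  transform : IsLocalQuadraticTransform T T'
  regular : IsRegularLocalRing T'.toSubring
  div_mem : ∀ y ∈ maximalIdeal T.toSubring, (y : K) / x ∈ T'.toSubring
  prime : Prime (Subring.inclusion transform.2.1 x)
  exists_mul_mem : ∀ k ∈ T'.toSubring, ∃ s ∈ T'.toSubring, s ≠ 0 ∧ s⁻¹ ∈ T'.toSubring ∧
    ∃ n : ℕ, k * s * (x : K) ^ n ∈ T.toSubring ∧ s * (x : K) ^ n ∈ T.toSubring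
  eq_ord : ringKrullDim T'.toSubring < 2 → (T'.toSubring : Set K) = ordValuationRing T

variable {T : LocalSubring K}

theorem two_le_height [IsRegularLocalRing T.toSubring] (hdim : 2 ≤ ringKrullDim T.toSubring) :
    2 ≤ (maximalIdeal T.toSubring).height := by
  rw [← maximalIdeal_height_eq_ringKrullDim] at hdim
  exact WithBot.coe_le_coe.1 hdim

/-- If the two rings agreed, `x` would generate the maximal ideal of `T`, which has height at least
two. -/
theorem IsQuadraticCenter.lt [IsRegularLocalRing T.toSubring]
    (hdim : 2 ≤ ringKrullDim T.toSubring) {x : T.toSubring} {T' : LocalSubring K}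
    (h : IsQuadraticCenter T x T') : T < T' := by
  refine lt_of_le_of_ne h.transform.2 ?_
  rintro rfl
  have hx0 : (x : K) ≠ 0 := fun h0 => h.prime.ne_zero (Subtype.ext h0)
  have hm : maximalIdeal T.toSubring = Ideal.span {x} := by
    apply le_antisymm
    · intro y hy
      exact Ideal.mem_span_singleton.2 ⟨⟨_, h.div_mem y hy⟩,
        Subtype.ext (mul_div_cancel₀ (y : K) hx0).symm⟩
    · exact (Ideal.span_singleton_le_iff_mem _).2 h.mem
  have h2 := two_le_height hdim
  rw [hm] at h2
  have h1 := Ideal.height_span_singleton_le_one (x := x) h.mem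
  exact absurd (h2.trans h1) (by decide)

/-- For `a`, `b` in the maximal ideal of `T`, the element `ab / x = (a / x) b` lies in the maximal
ideal of `D`. So `x ∈ 𝔪²` would put `x / x = 1` there. -/
theorem notMem_sq_of_div_mem {D : LocalSubring K} (hTD : T ≤ D) {x : T.toSubring} (hx0 : x ≠ 0)
    (hdiv : ∀ y ∈ maximalIdeal T.toSubring, (y : K) / x ∈ D.toSubring) :
    x ∉ maximalIdeal T.toSubring ^ 2 := by
  intro hx2
  have key : ∀ f ∈ maximalIdeal T.toSubring ^ 2, ∃ h : (f : K) / x ∈ D.toSubring,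
      (⟨_, h⟩ : D.toSubring) ∈ maximalIdeal D.toSubring := by
    intro f hf
    rw [pow_two] at hf
    refine Submodule.mul_induction_on hf ?_ ?_
    · intro a ha b hb
      have hb' := (mem_maximalIdeal_iff_of_le hTD b.2).1 hb
      have hmem := Ideal.mul_mem_left _ (⟨_, hdiv a ha⟩ : D.toSubring) hb'
      have heq : ((a * b : T.toSubring) : K) / x = (a : K) / x * b := by
        push_cast
        ring
      exact ⟨heq ▸ D.toSubring.mul_mem (hdiv a ha) (hTD.1 b.2),
        by convert hmem using 1; exact Subtype.ext heq⟩
    · rintro a b ⟨ha, ha'⟩ ⟨hb, hb'⟩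
      have hmem := Ideal.add_mem _ ha' hb'
      have heq : ((a + b : T.toSubring) : K) / x = (a : K) / x + (b : K) / x := by
        push_cast
        ring
      exact ⟨heq ▸ D.toSubring.add_mem ha hb, by convert hmem using 1; exact Subtype.ext heq⟩
  obtain ⟨h1, h2⟩ := key x hx2
  have hx0' : (x : K) ≠ 0 := fun h => hx0 (Subtype.ext h)
  have h3 : (⟨_, h1⟩ : D.toSubring) = 1 := Subtype.ext (div_self hx0')
  rw [h3] at h2
  exact (maximalIdeal.isMaximal D.toSubring).ne_top ((Ideal.eq_top_iff_one _).2 h2)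

variable [IsRegularLocalRing T.toSubring] {n : ℕ} {x₀ : T.toSubring} {y : Fin n → T.toSubring}

/-- This compares orders in `T` with divisibility by the exceptional element: an element of the
chart times `x₀ᴺ` has order at least `N`, with a larger order only if the element vanishes on the
exceptional divisor. -/
theorem exists_homogenize_eq (hx₀ : x₀ ≠ 0)
    (hspan : Ideal.span (insert x₀ (Set.range y)) = maximalIdeal T.toSubring)
    (hd : (n + 1 : ℕ∞) = (maximalIdeal T.toSubring).height)
    (F : MvPolynomial (Fin n) T.toSubring) {N : ℕ} (hN : F.totalDegree ≤ N) :
    ∃ t ∈ maximalIdeal T.toSubring ^ N, (t : K) = (chartEval hx₀ hspan F : K) * (x₀ : K) ^ N ∧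
      (t ∈ maximalIdeal T.toSubring ^ (N + 1) → chartElem T x₀ ∣ chartEval hx₀ hspan F) := by
  have hx₀' : (x₀ : K) ≠ 0 := fun h => hx₀ (Subtype.ext h)
  have hspan' := span_range_option_elim hspan
  refine ⟨MvPolynomial.eval (fun o : Option (Fin n) => o.elim x₀ y) (homogenize N F), ?_, ?_, ?_⟩
  · simpa using eval_mem_pow_of_isHomogeneous hspan' (homogenize_isHomogeneous N F) (J := ⊤)
      (fun _ => trivial)
  · rw [mul_comm]
    exact eval_homogenize (K := K) (y := y) (x₀ := x₀) hx₀' hN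
  · intro h
    have h1 := map_residue_eq_zero_of_eval_mem hspan' (card_option_le hd)
      (homogenize_isHomogeneous N F) h
    have h2 : F ∈ RingHom.ker (MvPolynomial.map (residue T.toSubring) :
        MvPolynomial (Fin n) T.toSubring →+* _) :=
      map_eq_zero_of_map_homogenize_eq_zero (residue T.toSubring) hN h1
    rw [← ker_mk_comp_chartEval hx₀ hspan hd, RingHom.mem_ker, RingHom.comp_apply,
      Ideal.Quotient.eq_zero_iff_dvd] at h2
    exact h2

theorem exists_mul_pow_mem {c : K} (hx₀ : x₀ ≠ 0)
    (hspan : Ideal.span (insert x₀ (Set.range y)) = maximalIdeal T.toSubring)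
    (hd : (n + 1 : ℕ∞) = (maximalIdeal T.toSubring).height) (hc : c ∈ quadraticChart T x₀) :
    ∃ M : ℕ, ∀ N, M ≤ N → c * (x₀ : K) ^ N ∈ T.toSubring := by
  obtain ⟨F, hF⟩ := chartEval_surjective hx₀ hspan ⟨c, hc⟩
  refine ⟨F.totalDegree, fun N hN => ?_⟩
  obtain ⟨t, -, ht, -⟩ := exists_homogenize_eq hx₀ hspan hd F hN
  rw [hF] at ht
  exact ht ▸ t.2

theorem eq_span_of_ringKrullDim_lt_two (hx₀ : x₀ ≠ 0)
    (hspan : Ideal.span (insert x₀ (Set.range y)) = maximalIdeal T.toSubring)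
    (hd : (n + 1 : ℕ∞) = (maximalIdeal T.toSubring).height)
    (P : Ideal (quadraticChart T x₀)) [P.IsPrime] (hP : chartElem T x₀ ∈ P)
    (hdim : ringKrullDim (LocalSubring.ofPrime (quadraticChart T x₀) P).toSubring < 2) :
    P = Ideal.span {chartElem T x₀} := by
  by_contra hne
  have hprime := chartElem_prime hx₀ hspan hd
  have hXp : (Ideal.span {chartElem T x₀}).IsPrime :=
    (Ideal.span_singleton_prime hprime.ne_zero).2 hprime
  have hlt : Ideal.span {chartElem T x₀} < P :=
    lt_of_le_of_ne ((Ideal.span_singleton_le_iff_mem _).2 hP) (Ne.symm hne)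
  have hlt' : (⊥ : Ideal (quadraticChart T x₀)) < Ideal.span {chartElem T x₀} := by
    rw [bot_lt_iff_ne_bot, Ne, Ideal.span_singleton_eq_bot]
    exact hprime.ne_zero
  have h1 := Ideal.height_add_one_le_of_lt_of_isPrime hlt'
  have h2 := Ideal.height_add_one_le_of_lt_of_isPrime hlt
  rw [IsLocalization.AtPrime.ringKrullDim_eq_height P] at hdim
  have h3 : P.height < 2 := WithBot.coe_lt_coe.1 hdim
  have h4 : (2 : ℕ∞) ≤ P.height := by
    calc (2 : ℕ∞) = 0 + 1 + 1 := by norm_num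
      _ ≤ (⊥ : Ideal (quadraticChart T x₀)).height + 1 + 1 := by gcongr; exact zero_le
      _ ≤ (Ideal.span {chartElem T x₀}).height + 1 := by gcongr
      _ ≤ P.height := h2
  exact absurd h3 (not_lt.2 h4)

/-- A denominator outside `(x₀)` has order exactly `N` after multiplication by `x₀ᴺ`. Conversely,
numerator and denominator of a fraction in the order valuation ring are divided by `x₀` to the order
of the denominator. -/
theorem ofPrime_span_eq_ordValuationRing (hx₀ : x₀ ≠ 0)
    (hspan : Ideal.span (insert x₀ (Set.range y)) = maximalIdeal T.toSubring)
    (hd : (n + 1 : ℕ∞) = (maximalIdeal T.toSubring).height)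
    (P : Ideal (quadraticChart T x₀)) [P.IsPrime] (hP : P = Ideal.span {chartElem T x₀}) :
    ((LocalSubring.ofPrime (quadraticChart T x₀) P).toSubring : Set K) = ordValuationRing T := by
  have hx₀' : (x₀ : K) ≠ 0 := fun h => hx₀ (Subtype.ext h)
  have hspan' := span_range_option_elim hspan
  ext k
  rw [SetLike.mem_coe, mem_ofPrime_iff]
  constructor
  · rintro ⟨c, s, hs, rfl⟩
    obtain ⟨F, rfl⟩ := chartEval_surjective hx₀ hspan c
    obtain ⟨G, rfl⟩ := chartEval_surjective hx₀ hspan s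
    obtain ⟨t, ht, htF, -⟩ := exists_homogenize_eq hx₀ hspan hd F
      (le_max_left F.totalDegree G.totalDegree)
    obtain ⟨u, hu, huG, hu'⟩ := exists_homogenize_eq hx₀ hspan hd G
      (le_max_right F.totalDegree G.totalDegree)
    have hu1 : u ∉ maximalIdeal T.toSubring ^ (max F.totalDegree G.totalDegree + 1) := by
      intro h
      apply hs
      rw [hP]
      exact Ideal.mem_span_singleton.2 (hu' h)
    refine ⟨t, u, ?_, (ord_le_natCast hu1).trans (natCast_le_ord_iff.2 ht), ?_⟩
    · rintro rfl
      exact hu1 (Ideal.zero_mem _)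
    · rw [htF, huG, mul_div_mul_right _ _ (pow_ne_zero _ hx₀')]
  · rintro ⟨f, g, hg, hfg, rfl⟩
    obtain ⟨m, hm, hm'⟩ := exists_mem_pow_notMem_pow_succ hg
    have hf : f ∈ maximalIdeal T.toSubring ^ m :=
      natCast_le_ord_iff.1 ((natCast_le_ord_iff.2 hm).trans hfg)
    have hfC := div_pow_mem (subset_quadraticChart T x₀)
      (fun y hy => div_mem_quadraticChart (x := x₀) hy) hf
    have hgC := div_pow_mem (subset_quadraticChart T x₀)
      (fun y hy => div_mem_quadraticChart (x := x₀) hy) hm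
    refine ⟨⟨_, hfC⟩, ⟨_, hgC⟩, ?_, by
      rw [div_div_div_cancel_right₀ (pow_ne_zero _ hx₀')]⟩
    rw [hP, Ideal.mem_span_singleton]
    rintro ⟨c, hc⟩
    obtain ⟨F, rfl⟩ := chartEval_surjective hx₀ hspan c
    obtain ⟨t, ht, htF, -⟩ := exists_homogenize_eq hx₀ hspan hd F le_rfl
    set N := F.totalDegree
    have hc' : (g : K) / (x₀ : K) ^ m = (x₀ : K) * (chartEval hx₀ hspan F : K) :=
      congrArg (fun z : quadraticChart T x₀ => (z : K)) hc
    -- The right side has order at least `m + N + 1`, whereas the initial form of `g` times the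
    -- `N`-th power of a variable is a nonzero form of degree `m + N`.
    have hgt : g * x₀ ^ N = x₀ ^ (m + 1) * t := by
      apply Subtype.ext
      push_cast
      rw [htF]
      rw [div_eq_iff (pow_ne_zero _ hx₀')] at hc'
      rw [hc']
      ring
    obtain ⟨H, hH, rfl⟩ := exists_isHomogeneous_of_mem_pow hspan' hm
    have hH0 : MvPolynomial.map (residue T.toSubring) H ≠ 0 := fun h0 =>
      hm' (eval_mem_pow_succ_of_isHomogeneous hspan' hH h0)
    have hHN := hH.mul ((MvPolynomial.isHomogeneous_X T.toSubring (none : Option (Fin n))).pow N)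
    have h0 := map_residue_eq_zero_of_eval_mem hspan' (card_option_le hd) hHN (by
      rw [map_mul, map_pow, MvPolynomial.eval_X, Option.elim_none, hgt]
      have hx₀m : x₀ ∈ maximalIdeal T.toSubring := hspan ▸ Ideal.subset_span (Or.inl rfl)
      have := Ideal.mul_mem_mul (Ideal.pow_mem_pow hx₀m (m + 1)) ht
      rw [← pow_add] at this
      convert this using 2
      ring)
    rw [map_mul, map_pow, MvPolynomial.map_X] at h0
    rcases mul_eq_zero.1 h0 with h | h
    · exact hH0 h
    · exact MvPolynomial.X_ne_zero _ (eq_zero_of_pow_eq_zero h)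

/-- A local ring dominating a regular local ring `T`, in which the maximal ideal of `T` becomes
principal, dominates a local quadratic transform of `T`. -/
theorem exists_isQuadraticCenter {D : LocalSubring K} (hTD : T ≤ D) {x : T.toSubring}
    (hx : x ∈ maximalIdeal T.toSubring) (hx0 : x ≠ 0)
    (hdiv : ∀ y ∈ maximalIdeal T.toSubring, (y : K) / x ∈ D.toSubring) :
    ∃ T' : LocalSubring K, IsQuadraticCenter T x T' ∧ T' ≤ D := by
  have hx0' : (x : K) ≠ 0 := fun h => hx0 (Subtype.ext h)
  obtain ⟨n, y, hspan, hd⟩ := exists_generators_of_notMem_sq hx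
    (notMem_sq_of_div_mem hTD hx0 hdiv)
  have hCD : quadraticChart T x ≤ D.toSubring := quadraticChart_le hTD.1 hdiv
  -- `P` is the center of `D` on the chart, so localizing at it gives a ring dominated by `D`.
  let P : Ideal (quadraticChart T x) := (maximalIdeal D.toSubring).comap (Subring.inclusion hCD)
  have hPp : P.IsPrime := Ideal.comap_isPrime _ _
  have hxP : chartElem T x ∈ P := (mem_maximalIdeal_iff_of_le hTD x.2).1 hx
  have hne : ∀ s : quadraticChart T x, s ∉ P → (s : K) ≠ 0 := by
    rintro s hs h0
    exact hs ((Subtype.ext h0 : s = 0) ▸ P.zero_mem)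
  have hsD : ∀ s : quadraticChart T x, s ∉ P → (s : K)⁻¹ ∈ D.toSubring := by
    intro s hs
    by_contra h
    exact hs ((mem_maximalIdeal_iff_inv_notMem (hCD s.2) (hne s hs)).2 h)
  have hsT' : ∀ s : quadraticChart T x, s ∉ P →
      (s : K)⁻¹ ∈ (LocalSubring.ofPrime (quadraticChart T x) P).toSubring := by
    intro s hs
    exact mem_ofPrime_iff.2 ⟨1, s, hs, by simp⟩
  have hCT' := LocalSubring.le_ofPrime (quadraticChart T x) P
  have hT'D : LocalSubring.ofPrime (quadraticChart T x) P ≤ D := by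
    rw [le_iff_inv_mem]
    constructor
    · intro k hk
      obtain ⟨a, s, hs, rfl⟩ := mem_ofPrime_iff.1 hk
      rw [div_eq_mul_inv]
      exact mul_mem (hCD a.2) (hsD s hs)
    · intro k hk hk0 hkD
      obtain ⟨a, s, hs, rfl⟩ := mem_ofPrime_iff.1 hk
      have ha0 : (a : K) ≠ 0 := by
        rintro h
        rw [h, zero_div] at hk0
        exact hk0 rfl
      refine mem_ofPrime_iff.2 ⟨s, a, fun ha => ?_, by rw [inv_div]⟩
      refine (mem_maximalIdeal_iff_inv_notMem (hCD a.2) ha0).1 ha ?_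
      have : (a : K)⁻¹ = (a / s : K)⁻¹ * (s : K)⁻¹ := by
        rw [inv_div, div_mul_eq_mul_div, mul_inv_cancel₀ (hne s hs), one_div]
      rw [this]
      exact mul_mem hkD (hsD s hs)
  have hTT' : T ≤ LocalSubring.ofPrime (quadraticChart T x) P := by
    rw [le_iff_inv_mem]
    refine ⟨(subset_quadraticChart T x).trans hCT', fun a ha h0 hi => ?_⟩
    exact (le_iff_inv_mem.1 hTD).2 a ha h0 (hT'D.1 hi)
  have hreg := isRegularLocalRing_ofPrime_quadraticChart hx0 hspan hd P hxP
  refine ⟨LocalSubring.ofPrime (quadraticChart T x) P, ⟨hx, ⟨⟨x, hx, hx0, P, hPp, rfl⟩, hTT'⟩,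
    hreg, fun y hy => hCT' (div_mem_quadraticChart hy), ?_, ?_, ?_⟩, hT'D⟩
  · have hprime := chartElem_prime hx0 hspan hd
    have hXp : (Ideal.span {chartElem T x}).IsPrime :=
      (Ideal.span_singleton_prime hprime.ne_zero).2 hprime
    have hdisj : Disjoint (P.primeCompl : Set (quadraticChart T x))
        (Ideal.span {chartElem T x} : Set (quadraticChart T x)) := by
      rw [Set.disjoint_left]
      intro s hs hs'
      exact hs ((Ideal.span_singleton_le_iff_mem _).2 hxP hs')
    have := IsLocalization.isPrime_of_isPrime_disjoint P.primeCompl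
      (LocalSubring.ofPrime (quadraticChart T x) P).toSubring _ hXp hdisj
    rw [Ideal.map_span, Set.image_singleton, Ideal.span_singleton_prime] at this
    · exact this
    · intro h
      exact hx0' (congrArg Subtype.val h)
  · intro k hk
    obtain ⟨a, s, hs, rfl⟩ := mem_ofPrime_iff.1 hk
    obtain ⟨M₁, h₁⟩ := exists_mul_pow_mem hx0 hspan hd a.2
    obtain ⟨M₂, h₂⟩ := exists_mul_pow_mem hx0 hspan hd s.2
    refine ⟨s, hCT' s.2, hne s hs, hsT' s hs, max M₁ M₂, ?_, h₂ _ (le_max_right _ _)⟩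
    rw [div_mul_cancel₀ _ (hne s hs)]
    exact h₁ _ (le_max_left _ _)
  · intro hdim
    exact ofPrime_span_eq_ordValuationRing hx0 hspan hd P
      (eq_span_of_ringKrullDim_lt_two hx0 hspan hd P hxP hdim)

end Center

/-! ### Ideals containing a product of primes -/

section PrimeProducts

variable {A : Type*} [CommRing A] [IsDomain A]

theorem exists_prime_dvd_of_dvd_prod {γ : A} (hγ : ¬IsUnit γ) {s : Multiset A}
    (hs : ∀ p ∈ s, Prime p) (h : γ ∣ s.prod) : ∃ p ∈ s, p ∣ γ := by
  induction s using Multiset.induction_on with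
  | empty => exact absurd (isUnit_of_dvd_one (by simpa using h)) hγ
  | cons p s ih =>
    obtain ⟨t, ht⟩ := h
    rw [Multiset.prod_cons] at ht
    have hp : Prime p := hs p (Multiset.mem_cons_self p s)
    rcases hp.dvd_or_dvd (ht ▸ dvd_mul_right p s.prod) with hpγ | ⟨t', rfl⟩
    · exact ⟨p, Multiset.mem_cons_self p s, hpγ⟩
    · have ht' : s.prod = γ * t' := mul_left_cancel₀ hp.ne_zero (by rw [ht]; ring)
      obtain ⟨q, hq, hqγ⟩ := ih (fun q hq => hs q (Multiset.mem_cons_of_mem hq)) ⟨t', ht'⟩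
      exact ⟨q, Multiset.mem_cons_of_mem hq, hqγ⟩

/-- An ideal containing a product of primes is contained in a smallest principal ideal. -/
theorem exists_isLeast_principal (L : Ideal A) {s : Multiset A} (hs : ∀ p ∈ s, Prime p)
    (h : s.prod ∈ L) :
    ∃ (a : A) (J : Ideal A), a ≠ 0 ∧
      IsLeast {P : Ideal A | P.IsPrincipal ∧ L ≤ P} (Ideal.span {a}) ∧
      Ideal.span {a} * J = L ∧ ∃ s' : Multiset A, (∀ p ∈ s', Prime p) ∧ s'.prod ∈ J := by
  induction hn : s.card generalizing s L with
  | zero =>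
    rw [Multiset.card_eq_zero.1 hn, Multiset.prod_zero] at h
    have hL : L = ⊤ := (Ideal.eq_top_iff_one L).2 h
    refine ⟨1, ⊤, one_ne_zero, ⟨⟨⟨⟨1, rfl⟩⟩, by simp⟩, ?_⟩, by simp [hL], 0, by simp⟩
    rintro P ⟨-, hP⟩
    exact le_top.trans (hL ▸ hP)
  | succ n ih =>
    -- Such a prime is split off from `L`. When none is left, a nonunit generator of a principal
    -- ideal above `L` would divide the product and so have one of these primes as a factor, whose
    -- ideal would contain `L`.
    by_cases hex : ∃ p ∈ s, L ≤ Ideal.span {p}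
    · obtain ⟨p, hps, hLp⟩ := hex
      have hp := hs p hps
      obtain ⟨s', rfl⟩ := Multiset.exists_cons_of_mem hps
      let L' : Ideal A := Submodule.comap (LinearMap.mulLeft A p) L
      have hL' : ∀ t, t ∈ L' ↔ p * t ∈ L := fun t => Iff.rfl
      have hLL' : Ideal.span {p} * L' = L := by
        apply le_antisymm
        · rw [Ideal.span_singleton_mul_le_iff]
          exact fun z hz => hz
        · intro l hl
          obtain ⟨t, rfl⟩ := Ideal.mem_span_singleton.1 (hLp hl)
          exact Ideal.mul_mem_mul (Ideal.mem_span_singleton_self p) hl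
      obtain ⟨a, J, ha, ⟨-, hmin⟩, haJ, hJ⟩ := ih L' (s := s')
        (fun q hq => hs q (Multiset.mem_cons_of_mem hq)) (by
          rw [hL', ← Multiset.prod_cons]
          exact h) (by simpa using hn)
      have hpaJ : Ideal.span {p * a} * J = L := by
        rw [← Ideal.span_singleton_mul_span_singleton, mul_assoc, haJ, hLL']
      refine ⟨p * a, J, mul_ne_zero hp.ne_zero ha, ⟨⟨⟨⟨_, rfl⟩⟩, hpaJ ▸ Ideal.mul_le_left⟩, ?_⟩,
        hpaJ, hJ⟩
      rintro P ⟨⟨⟨γ, rfl⟩⟩, hγ⟩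
      change Ideal.span {p * a} ≤ Ideal.span {γ}
      rw [Ideal.span_singleton_le_span_singleton]
      change L ≤ Ideal.span {γ} at hγ
      by_cases hpγ : p ∣ γ
      · obtain ⟨γ', rfl⟩ := hpγ
        refine mul_dvd_mul_left p ?_
        rw [← Ideal.span_singleton_le_span_singleton]
        refine hmin ⟨⟨⟨_, rfl⟩⟩, fun t ht => ?_⟩
        have := Ideal.mem_span_singleton.1 (hγ ((hL' t).1 ht))
        exact Ideal.mem_span_singleton.2 ((mul_dvd_mul_iff_left hp.ne_zero).1 this)
      · refine Dvd.dvd.mul_left ?_ p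
        rw [← Ideal.span_singleton_le_span_singleton]
        refine hmin ⟨⟨⟨_, rfl⟩⟩, fun t ht => ?_⟩
        obtain ⟨c, hc⟩ := Ideal.mem_span_singleton.1 (hγ ((hL' t).1 ht))
        obtain ⟨c', rfl⟩ := (hp.dvd_or_dvd (hc ▸ dvd_mul_right p t)).resolve_left hpγ
        exact Ideal.mem_span_singleton.2 ⟨c', mul_left_cancel₀ hp.ne_zero (by rw [hc]; ring)⟩
    · push Not at hex
      refine ⟨1, L, one_ne_zero, ⟨⟨⟨⟨1, rfl⟩⟩, by simp⟩, ?_⟩, by simp, s, hs, h⟩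
      rintro P ⟨⟨⟨γ, rfl⟩⟩, hγ⟩
      change L ≤ Ideal.span {γ} at hγ
      have hu : IsUnit γ := by
        by_contra hu
        obtain ⟨p, hp, hpγ⟩ := exists_prime_dvd_of_dvd_prod hu hs
          (Ideal.mem_span_singleton.1 (hγ h))
        exact hex p hp (hγ.trans (Ideal.span_singleton_le_span_singleton.2 hpγ))
      change _ ≤ Ideal.span {γ}
      rw [Ideal.span_singleton_eq_top.2 hu]
      exact le_top

/-- An inclusion of `J` in `(p)` would give `L ≤ (a p)`, and leastness would make `a p` divide `a`.
-/
theorem not_le_span_prime_of_isLeast {L J : Ideal A} {a : A} (ha : a ≠ 0)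
    (hleast : IsLeast {P : Ideal A | P.IsPrincipal ∧ L ≤ P} (Ideal.span {a}))
    (haJ : Ideal.span {a} * J = L) {p : A} (hp : ¬IsUnit p) : ¬J ≤ Ideal.span {p} := by
  intro hJp
  have h1 : L ≤ Ideal.span {a * p} := by
    rw [← haJ, ← Ideal.span_singleton_mul_span_singleton]
    exact Ideal.mul_mono_right hJp
  have h2 : a * p ∣ a := Ideal.span_singleton_le_span_singleton.1 (hleast.2 ⟨⟨⟨_, rfl⟩⟩, h1⟩)
  have h3 : a * p ∣ a * 1 := by rwa [mul_one]
  exact hp (isUnit_of_dvd_one ((mul_dvd_mul_iff_left ha).1 h3))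

/-- Each prime of the product divides `γ` or `t` and can be cancelled there. If no factor of `γ`
found this way lay in `𝔭`, what remains of `γ` would stay in `𝔭` and divide `u`. -/
theorem exists_prime_dvd_of_mul_prod_eq {𝔭 : Ideal A} [𝔭.IsPrime] {s : Multiset A}
    (hs : ∀ p ∈ s, Prime p) {u γ t : A} (hu : u ∉ 𝔭) (hγ : γ ∈ 𝔭) (h : u * s.prod = γ * t) :
    ∃ p ∈ 𝔭, Prime p ∧ p ∣ γ := by
  induction s using Multiset.induction_on generalizing γ t with
  | empty =>
    rw [Multiset.prod_zero, mul_one] at h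
    exact absurd (h ▸ 𝔭.mul_mem_right t hγ) hu
  | cons p s ih =>
    have hp : Prime p := hs p (Multiset.mem_cons_self p s)
    have hs' : ∀ q ∈ s, Prime q := fun q hq => hs q (Multiset.mem_cons_of_mem hq)
    rw [Multiset.prod_cons] at h
    have hdvd : p ∣ γ * t := ⟨u * s.prod, by rw [← h]; ring⟩
    rcases hp.dvd_or_dvd hdvd with ⟨γ', rfl⟩ | ⟨t', rfl⟩
    · by_cases hp𝔭 : p ∈ 𝔭
      · exact ⟨p, hp𝔭, hp, dvd_mul_right _ _⟩
      · have hγ' : γ' ∈ 𝔭 := (Ideal.IsPrime.mem_or_mem ‹_› hγ).resolve_left hp𝔭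
        obtain ⟨q, hq, hq', hqγ⟩ := ih hs' (γ := γ') (t := t) hγ'
          (mul_left_cancel₀ hp.ne_zero (by linear_combination h))
        exact ⟨q, hq, hq', hqγ.mul_left p⟩
    · exact ih hs' (t := t') hγ (mul_left_cancel₀ hp.ne_zero (by linear_combination h))

theorem dvd_of_dvd_mul_pow_of_not_dvd {x q a : A} (hx : Prime x) (hq : ¬x ∣ q) {m : ℕ}
    (h : q ∣ a * x ^ m) : q ∣ a := by
  induction m with
  | zero => simpa using h
  | succ m ih =>
    apply ih
    obtain ⟨c, hc⟩ := h
    have : x ∣ q * c := ⟨a * x ^ m, by rw [← hc]; ring⟩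
    obtain ⟨c', rfl⟩ := (hx.dvd_or_dvd this).resolve_left hq
    exact ⟨c', mul_left_cancel₀ hx.ne_zero (by linear_combination hc)⟩

end PrimeProducts

/-! ### Strict transforms of prime elements -/

section StrictTransform

variable {K : Type*} [Field K] {T T' : LocalSubring K} {x : T.toSubring}

/-- A prime element is, in a local quadratic transform, a power of the exceptional prime times a
prime or a unit. -/
theorem IsQuadraticCenter.exists_strictTransform (h : IsQuadraticCenter T x T')
    {p : T.toSubring} (hp : Prime p) :
    ∃ (n : ℕ) (q : T'.toSubring), Subring.inclusion h.transform.2.1 p =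
      Subring.inclusion h.transform.2.1 x ^ n * q ∧ (IsUnit q ∨ Prime q) := by
  have := h.regular
  set ι := Subring.inclusion h.transform.2.1 with hι
  have hinj : Function.Injective ι := Subring.inclusion_injective _
  have hp0 : ι p ≠ 0 := fun h0 => hp.ne_zero (hinj (by simpa using h0))
  obtain ⟨n, q, hxq, hpq⟩ := WfDvdMonoid.max_power_factor hp0 h.prime.irreducible
  refine ⟨n, q, hpq, ?_⟩
  by_cases hu : IsUnit q
  · exact Or.inl hu
  right
  have hq0 : q ≠ 0 := by
    rintro rfl
    exact hxq (dvd_zero _)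
  have hpK : (p : K) = (x : K) ^ n * (q : K) := congrArg Subtype.val hpq
  -- Divisibility by `p` in `T` gives divisibility by `q` in `T'`; the unit `s` and the power of the
  -- prime `x`, which does not divide `q`, can be dropped.
  have key : ∀ (k s : T'.toSubring) (m : ℕ) (t : T.toSubring), IsUnit s →
      (t : K) = k * s * (x : K) ^ m → p ∣ t → q ∣ k := by
    rintro k s m t hs ht hpt
    have h1 : q ∣ ι t := (Dvd.intro_left _ hpq.symm).trans (map_dvd ι hpt)
    have h2 : ι t = k * s * ι x ^ m := Subtype.ext ht
    rw [h2] at h1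
    exact (hs.dvd_mul_right).1 (dvd_of_dvd_mul_pow_of_not_dvd h.prime hxq h1)
  refine ⟨hq0, hu, ?_⟩
  rintro a b ⟨e, hab⟩
  have habK : (a : K) * b = q * e := congrArg Subtype.val hab
  obtain ⟨sa, hsa, hsa0, hsa', na, ha₁, ha₂⟩ := h.exists_mul_mem a a.2
  obtain ⟨sb, hsb, hsb0, hsb', nb, hb₁, hb₂⟩ := h.exists_mul_mem b b.2
  obtain ⟨se, hse, hse0, hse', ne, he₁, he₂⟩ := h.exists_mul_mem e e.2
  -- The relation `a b = q e` is moved down to `T` by clearing all denominators; the extra factor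
  -- `xⁿ` turns `q` into `p`.
  have hdvd : p ∣ (⟨_, ha₁⟩ * ⟨_, hb₁⟩) * ⟨_, he₂⟩ * x ^ n := by
    refine ⟨⟨_, he₁⟩ * ⟨_, ha₂⟩ * ⟨_, hb₂⟩, Subtype.ext ?_⟩
    push_cast
    rw [hpK]
    linear_combination (sa * sb * se * (x : K) ^ (na + nb + ne + n)) * habK
  rcases hp.dvd_or_dvd hdvd with hd | hd
  · rcases hp.dvd_or_dvd hd with hd | hd
    · rcases hp.dvd_or_dvd hd with hd | hd
      · exact Or.inl (key a ⟨sa, hsa⟩ na _ ((isUnit_iff_inv_mem hsa hsa0).2 hsa') rfl hd)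
      · exact Or.inr (key b ⟨sb, hsb⟩ nb _ ((isUnit_iff_inv_mem hsb hsb0).2 hsb') rfl hd)
    · exact absurd (isUnit_of_dvd_one (key 1 ⟨se, hse⟩ ne _
        ((isUnit_iff_inv_mem hse hse0).2 hse') (by simp) hd)) hu
  · exact absurd (isUnit_of_dvd_one (key 1 1 n _ isUnit_one (by simp) hd)) hu

theorem IsQuadraticCenter.exists_prime_multiset (h : IsQuadraticCenter T x T')
    {s : Multiset T.toSubring} (hs : ∀ p ∈ s, Prime p) :
    ∃ (u : T'.toSubring) (s' : Multiset T'.toSubring), IsUnit u ∧ (∀ p ∈ s', Prime p) ∧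
      Subring.inclusion h.transform.2.1 s.prod = u * s'.prod := by
  induction s using Multiset.induction_on with
  | empty => exact ⟨1, 0, isUnit_one, by simp, by simp⟩
  | cons p s ih =>
    obtain ⟨u, s', hu, hs', he⟩ := ih fun q hq => hs q (Multiset.mem_cons_of_mem hq)
    obtain ⟨n, q, hpq, hq⟩ := h.exists_strictTransform (hs p (Multiset.mem_cons_self p s))
    have hs'' : ∀ p ∈ Multiset.replicate n (Subring.inclusion h.transform.2.1 x) + s',
        Prime p := by
      intro r hr
      rcases Multiset.mem_add.1 hr with hr | hr
      · rw [Multiset.eq_of_mem_replicate hr]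
        exact h.prime
      · exact hs' r hr
    rcases hq with hq | hq
    · refine ⟨q * u, Multiset.replicate n (Subring.inclusion h.transform.2.1 x) + s', hq.mul hu,
        hs'', ?_⟩
      rw [Multiset.prod_cons, map_mul, he, hpq, Multiset.prod_add, Multiset.prod_replicate]
      ring
    · refine ⟨u, q ::ₘ (Multiset.replicate n (Subring.inclusion h.transform.2.1 x) + s'), hu,
        ?_, ?_⟩
      · intro r hr
        rcases Multiset.mem_cons.1 hr with rfl | hr
        · exact hq
        · exact hs'' r hr
      · rw [Multiset.prod_cons, Multiset.prod_cons, map_mul, he, hpq, Multiset.prod_add,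
          Multiset.prod_replicate]
        ring

end StrictTransform

/-! ### Local rings on the normalized blowup and their universal property -/

section Blowup

variable {R K : Type*} [CommRing R] [Field K] [Algebra R K] {I : Ideal R}

theorem mem_reesIn_iff {f : K[X]} :
    f ∈ reesIn K I ↔ ∃ g : R[X], (∀ i, g.coeff i ∈ I ^ i) ∧ g.map (algebraMap R K) = f :=
  Iff.rfl

theorem monomial_mem_reesIn {n : ℕ} {r : R} (hr : r ∈ I ^ n) :
    monomial n (algebraMap R K r) ∈ reesIn K I :=
  mem_reesIn_iff.2 ⟨monomial n r, reesAlgebra.monomial_mem.2 hr, by simp⟩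

theorem monomial_mem_normRees {n : ℕ} {r : R} (hr : r ∈ I ^ n) :
    monomial n (algebraMap R K r) ∈ normRees K I :=
  mem_normRees.2 (isIntegral_algebraMap (x := (⟨_, monomial_mem_reesIn hr⟩ : reesIn K I)))

theorem algebraMap_div_pow_mem {A : Subring K} (hRA : ∀ r, algebraMap R K r ∈ A) {z : K}
    (hz : ∀ i ∈ I, algebraMap R K i / z ∈ A) {n : ℕ} {r : R} (hr : r ∈ I ^ n) :
    algebraMap R K r / z ^ n ∈ A := by
  induction n generalizing r with
  | zero => simpa using hRA r
  | succ n ih =>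
    rw [pow_succ] at hr
    refine Submodule.mul_induction_on hr ?_ ?_
    · intro g hg y hy
      have := A.mul_mem (ih hg) (hz y hy)
      rwa [div_mul_div_comm, ← pow_succ, ← map_mul] at this
    · intro y w hy hw
      have := A.add_mem hy hw
      rwa [← add_div, ← map_add] at this

/-- If the extension of `I` to an integrally closed ring `A` is contained in `zA`, then the
integral closure of `Iⁿ` is contained in `zⁿA`. -/
theorem div_pow_mem_of_monomial_mem_normRees {A : Subring K} (hRA : ∀ r, algebraMap R K r ∈ A)
    (hA : ∀ k : K, IsIntegral A k → k ∈ A) {z : K} (hz : ∀ i ∈ I, algebraMap R K i / z ∈ A)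
    {n : ℕ} {c : K} (hc : monomial n c ∈ normRees K I) : c / z ^ n ∈ A := by
  rw [mem_normRees] at hc
  -- The substitution `t ↦ t / z` carries `R[It]` into `A[t]`, so `(c / zⁿ) tⁿ` is integral over
  -- `A[t]`, which forces its coefficient to be integral over `A`.
  let θ : K[X] →+* K[X] := compRingHom (C z⁻¹ * X)
  have hθ : ∀ (f : K[X]) (i : ℕ), (θ f).coeff i = f.coeff i * z⁻¹ ^ i := fun f i =>
    comp_C_mul_X_coeff
  let ψ : A[X] →+* K[X] := mapRingHom A.subtype
  have hψ : Function.Injective ψ := map_injective _ Subtype.val_injective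
  have hmem : ∀ a : reesIn K I, (θ.comp (algebraMap (reesIn K I) K[X])) a ∈ ψ.rangeS := by
    intro a
    have h : θ (a : K[X]) ∈ lifts A.subtype := by
      rw [lifts_iff_coeff_lifts]
      intro k
      obtain ⟨g, hg, hga⟩ := mem_reesIn_iff.1 a.2
      rw [hθ, ← hga, coeff_map, inv_pow, ← div_eq_mul_inv]
      exact ⟨⟨_, algebraMap_div_pow_mem hRA hz (hg k)⟩, rfl⟩
    obtain ⟨q, hq⟩ := (mem_lifts _).1 h
    exact ⟨q, hq⟩
  let e : A[X] ≃+* ψ.rangeS := RingEquiv.ofBijective ψ.rangeSRestrict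
    ⟨fun x y hxy => hψ (congrArg Subtype.val hxy), ψ.rangeSRestrict_surjective⟩
  let φ : reesIn K I →+* A[X] :=
    e.symm.toRingHom.comp ((θ.comp (algebraMap (reesIn K I) K[X])).codRestrict ψ.rangeS hmem)
  let := Polynomial.algebra A K
  have hcomp : (algebraMap A[X] K[X]).comp φ = θ.comp (algebraMap (reesIn K I) K[X]) := by
    ext1 a
    have : (e (φ a) : K[X]) = θ (algebraMap (reesIn K I) K[X] a) := by simp [φ]
    exact this
  have hθc : IsIntegral A[X] (θ (monomial n c)) := hc.map_of_comp_eq φ θ hcomp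
  have := Polynomial.isIntegral_iff_isIntegral_coeff.1 hθc n
  rw [hθ, coeff_monomial, if_pos rfl, inv_pow, ← div_eq_mul_inv] at this
  exact hA _ this

theorem mk_monomial_mem_of_forall {p : Ideal (normRees K I)}
    (h : ∀ (r : R) (hr : r ∈ I ^ 1),
      (⟨monomial 1 (algebraMap R K r), monomial_mem_normRees hr⟩ : normRees K I) ∈ p)
    {n : ℕ} (hn : n ≠ 0) {r : R} (hr : r ∈ I ^ n) :
    (⟨monomial n (algebraMap R K r), monomial_mem_normRees hr⟩ : normRees K I) ∈ p := by
  obtain ⟨m, rfl⟩ := Nat.exists_eq_succ_of_ne_zero hn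
  have hr' := hr
  rw [Nat.succ_eq_add_one, pow_succ'] at hr'
  suffices ∃ hmem : monomial (m + 1) (algebraMap R K r) ∈ normRees K I,
      (⟨_, hmem⟩ : normRees K I) ∈ p from this.2
  refine Submodule.mul_induction_on hr' ?_ ?_
  · intro a ha b hb
    have ha' : a ∈ I ^ 1 := by rwa [pow_one]
    have := p.mul_mem_left ⟨_, monomial_mem_normRees (K := K) hb⟩ (h a ha')
    have heq : monomial (m + 1) (algebraMap R K (a * b)) =
        monomial m (algebraMap R K b) * monomial 1 (algebraMap R K a) := by
      rw [monomial_mul_monomial, map_mul, mul_comm]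
    exact ⟨heq ▸ mul_mem (monomial_mem_normRees hb) (monomial_mem_normRees ha'), by
      convert this using 1; exact Subtype.ext heq⟩
  · rintro a b ⟨ha, ha'⟩ ⟨hb, hb'⟩
    have := p.add_mem ha' hb'
    have heq : monomial (m + 1) (algebraMap R K (a + b)) =
        monomial (m + 1) (algebraMap R K a) + monomial (m + 1) (algebraMap R K b) := by
      rw [map_add, map_add]
    exact ⟨heq ▸ add_mem ha hb, by convert this using 1; exact Subtype.ext heq⟩

/-- The elements of positive degree of the integral closure of `R[It]` are nilpotent modulo
the ideal generated by `It`. -/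
theorem pow_mem_of_forall_mk_monomial_mem {p : Ideal (normRees K I)}
    (h : ∀ (r : R) (hr : r ∈ I ^ 1),
      (⟨monomial 1 (algebraMap R K r), monomial_mem_normRees hr⟩ : normRees K I) ∈ p)
    {n : ℕ} (hn : n ≠ 0) {f : normRees K I} (hf : f ∈ normReesPiece K I n) : ∃ d, f ^ d ∈ p := by
  obtain ⟨c, hc⟩ := mem_normReesPiece.1 hf
  obtain ⟨q, hq, hq0⟩ := mem_normRees.1 f.2
  set d := q.natDegree with hd
  refine ⟨d, ?_⟩
  have hrees : ∀ i < d, ∃ r ∈ I ^ (n * (d - i)), algebraMap R K r =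
      (q.coeff i : K[X]).coeff (n * (d - i)) := by
    intro i _
    obtain ⟨g, hg, hg'⟩ := mem_reesIn_iff.1 (q.coeff i).2
    exact ⟨_, hg _, by rw [← hg', coeff_map]⟩
  -- This is the part of degree `n d` of an integral equation. Its coefficients have degree `n (d -
  -- i) > 0`, so the corresponding elements of the Rees algebra lie in `p`.
  have hcd : c ^ d = - ∑ i ∈ Finset.range d, (q.coeff i : K[X]).coeff (n * (d - i)) * c ^ i := by
    rw [eval₂_eq_sum_range, ← hd, Finset.sum_range_succ, hd, hq.coeff_natDegree, ← hd, map_one,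
      one_mul, ← hc] at hq0
    have h1 := congrArg (fun g : K[X] => g.coeff (n * d)) hq0
    simp only [coeff_add, finsetSum_coeff, coeff_zero, monomial_pow] at h1
    rw [coeff_monomial, if_pos rfl] at h1
    rw [eq_neg_iff_add_eq_zero, add_comm, ← h1]
    congr 1
    refine Finset.sum_congr rfl fun i hi => ?_
    have hid : i ≤ d := (Finset.mem_range.1 hi).le
    have : n * d = n * (d - i) + n * i := by rw [← mul_add, Nat.sub_add_cancel hid]
    rw [this, coeff_mul_monomial]
    rfl
  have hfd : (f : K[X]) ^ d = - ∑ i ∈ Finset.range d,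
      monomial (n * (d - i)) ((q.coeff i : K[X]).coeff (n * (d - i))) * (f : K[X]) ^ i := by
    rw [← hc]
    simp only [monomial_pow, monomial_mul_monomial]
    rw [hcd, map_neg, map_sum]
    congr 1
    refine Finset.sum_congr rfl fun i hi => ?_
    rw [← mul_add, Nat.sub_add_cancel (Finset.mem_range.1 hi).le]
  choose! r hr hr' using hrees
  have hmem : ∀ i ∈ Finset.range d, ∃ w : normRees K I, w ∈ p ∧ (w : K[X]) =
      monomial (n * (d - i)) ((q.coeff i : K[X]).coeff (n * (d - i))) * (f : K[X]) ^ i := by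
    intro i hi
    have hid := Finset.mem_range.1 hi
    have h1 := mk_monomial_mem_of_forall h
      (Nat.mul_ne_zero hn (Nat.sub_ne_zero_of_lt hid)) (hr i hid)
    refine ⟨_, p.mul_mem_right (f ^ i) h1, ?_⟩
    rw [← hr' i hid]
    rfl
  choose! w hw hw' using hmem
  have : f ^ d = - ∑ i ∈ Finset.range d, w i := by
    apply Subtype.ext
    push_cast
    rw [hfd]
    congr 1
    exact Finset.sum_congr rfl fun i hi => (hw' i hi).symm
  rw [this]
  exact p.neg_mem (p.sum_mem hw)

/-- A point of `Proj` does not contain the irrelevant ideal. Since positive degrees are nilpotent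
modulo `It`, it misses `a t` for some `a ∈ I`. This `a` generates the extension of `I` to `S`, and
any denominator of degree `n` outside the point is a unit of `S` times `aⁿ`. -/
theorem IsOnNormalizedBlowup.exists_generator {S : LocalSubring K}
    (hS : IsOnNormalizedBlowup I S) :
    ∃ a ∈ I, algebraMap R K a ≠ 0 ∧ (∀ i ∈ I, algebraMap R K i / algebraMap R K a ∈ S.toSubring) ∧
      ∀ s ∈ S.toSubring, ∃ (n : ℕ) (c e : K), monomial n c ∈ normRees K I ∧
        monomial n e ∈ normRees K I ∧ e ≠ 0 ∧ s = c / e ∧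
        e / algebraMap R K a ^ n ∈ S.toSubring ∧ algebraMap R K a ^ n / e ∈ S.toSubring := by
  obtain ⟨p, hp⟩ := hS
  have hmemS : ∀ k : K, k ∈ S.toSubring ↔ ∃ n : ℕ, ∃ a ∈ normReesPiece K I n,
      ∃ b ∈ normReesPiece K I n, b ∉ p.asHomogeneousIdeal ∧
        k = (a : K[X]).coeff n / (b : K[X]).coeff n := fun k => by
    rw [← SetLike.mem_coe, hp]
    rfl
  have hpp : p.asHomogeneousIdeal.toIdeal.IsPrime := p.isPrime
  obtain ⟨a, ha, hap⟩ : ∃ (r : R) (hr : r ∈ I ^ 1),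
      (⟨monomial 1 (algebraMap R K r), monomial_mem_normRees hr⟩ : normRees K I) ∉
        p.asHomogeneousIdeal.toIdeal := by
    by_contra! hcon
    apply p.not_irrelevant_le
    rw [HomogeneousIdeal.irrelevant_le]
    intro n hn f hf
    obtain ⟨d, hd⟩ := pow_mem_of_forall_mk_monomial_mem hcon hn.ne' hf
    exact hpp.mem_of_pow_mem d hd
  have hpiece : ∀ {n : ℕ} {c : K} (hc : monomial n c ∈ normRees K I),
      (⟨_, hc⟩ : normRees K I) ∈ normReesPiece K I n := fun hc => ⟨_, rfl⟩
  have ha0 : algebraMap R K a ≠ 0 := by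
    intro h0
    apply hap
    convert p.asHomogeneousIdeal.toIdeal.zero_mem
    simp [h0]
  have hapow : ∀ n : ℕ, ∃ hn : monomial n (algebraMap R K a ^ n) ∈ normRees K I,
      (⟨_, hn⟩ : normRees K I) ∉ p.asHomogeneousIdeal.toIdeal := by
    intro n
    have h1 : (monomial 1 (algebraMap R K a)) ^ n = monomial n (algebraMap R K a ^ n) := by
      rw [monomial_pow, one_mul]
    refine ⟨h1 ▸ pow_mem (monomial_mem_normRees ha) n, fun h => hap (hpp.mem_of_pow_mem n ?_)⟩
    convert h using 1
    exact Subtype.ext h1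
  refine ⟨a, by rwa [pow_one] at ha, ha0, fun i hi => ?_, fun s hs => ?_⟩
  · rw [hmemS]
    exact ⟨1, _, hpiece (monomial_mem_normRees (by rwa [pow_one])), _,
      hpiece (monomial_mem_normRees ha), hap, by simp⟩
  · obtain ⟨n, f, hf, g, hg, hgp, rfl⟩ := (hmemS s).1 hs
    obtain ⟨c, hc⟩ := mem_normReesPiece.1 hf
    obtain ⟨e, he⟩ := mem_normReesPiece.1 hg
    obtain ⟨hn, hnp⟩ := hapow n
    have he0 : e ≠ 0 := by
      rintro rfl
      have hg0 : g = 0 := Subtype.ext (by rw [← he]; simp)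
      rw [hg0] at hgp
      exact hgp p.asHomogeneousIdeal.toIdeal.zero_mem
    refine ⟨n, c, e, hc ▸ f.2, he ▸ g.2, he0, by simp [← hc, ← he], ?_, ?_⟩
    · rw [hmemS]
      exact ⟨n, g, hg, _, hpiece hn, hnp, by simp [← he]⟩
    · rw [hmemS]
      exact ⟨n, _, hpiece hn, g, hg, hgp, by simp [← he]⟩

/-- A local ring on the normalized blowup of `I` is dominated by every integrally closed local ring
in which `I` becomes principal, as soon as some local ring dominates both. -/
theorem IsOnNormalizedBlowup.le_of_extension_eq {S T V : LocalSubring K}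
    (hS : IsOnNormalizedBlowup I S) (hSV : S ≤ V) (hTV : T ≤ V)
    (hRT : ∀ r, algebraMap R K r ∈ T.toSubring) (hT : ∀ k : K, IsIntegral T.toSubring k →
      k ∈ T.toSubring) {z : T.toSubring} (hz : extension I T.toSubring = Ideal.span {z}) :
    S ≤ T := by
  obtain ⟨a, ha, ha0, haS, hfrac⟩ := hS.exists_generator
  have hdvd : ∀ i ∈ I, ∃ t ∈ T.toSubring, algebraMap R K i = z * t := by
    intro i hi
    have h1 : (⟨_, hRT i⟩ : T.toSubring) ∈ extension I T.toSubring :=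
      Ideal.subset_span ⟨i, hi, rfl⟩
    rw [hz] at h1
    obtain ⟨t, ht⟩ := Ideal.mem_span_singleton.1 h1
    exact ⟨t, t.2, congrArg Subtype.val ht⟩
  have hz0 : (z : K) ≠ 0 := by
    intro h0
    obtain ⟨t, -, ht⟩ := hdvd a ha
    rw [h0, zero_mul] at ht
    exact ha0 ht
  have hzdiv : ∀ i ∈ I, algebraMap R K i / z ∈ T.toSubring := by
    intro i hi
    obtain ⟨t, ht, hit⟩ := hdvd i hi
    rwa [hit, mul_div_cancel_left₀ _ hz0]
  -- `z` lies in the extension of `I`, which `a` generates in `S` and hence in `V`.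
  have hza : (z : K) / algebraMap R K a ∈ V.toSubring := by
    have hzm : z ∈ extension I T.toSubring := hz ▸ Ideal.mem_span_singleton_self z
    refine Submodule.span_induction (p := fun (w : T.toSubring) _ =>
      (w : K) / algebraMap R K a ∈ V.toSubring) ?_ ?_ ?_ ?_ hzm
    · rintro w ⟨i, hi, hw⟩
      rw [hw]
      exact hSV.1 (haS i hi)
    · simp
    · intro w v _ _ hw hv
      have := add_mem hw hv
      rwa [← add_div] at this
    · intro r w _ hw
      have := mul_mem (hTV.1 r.2) hw
      rwa [← mul_div_assoc] at this
  have hTV' := (le_iff_inv_mem.1 hTV).2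
  have hST : S.toSubring ≤ T.toSubring := by
    intro s hs
    obtain ⟨n, c, e, hc, he, he0, rfl, -, heS'⟩ := hfrac s hs
    have hcT := div_pow_mem_of_monomial_mem_normRees hRT hT hzdiv hc
    have heT := div_pow_mem_of_monomial_mem_normRees hRT hT hzdiv he
    have hne : e / (z : K) ^ n ≠ 0 := div_ne_zero he0 (pow_ne_zero _ hz0)
    -- The element `e / zⁿ` of `T` is invertible in `V`, hence in `T` by domination; this allows it
    -- as a denominator in `T`.
    have hinv : (e / (z : K) ^ n)⁻¹ ∈ V.toSubring := by
      have h1 : (e / (z : K) ^ n)⁻¹ =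
          algebraMap R K a ^ n / e * (z / algebraMap R K a : K) ^ n := by
        rw [div_pow]
        field_simp
      rw [h1]
      exact mul_mem (hSV.1 heS') (pow_mem hza n)
    have h2 := hTV' _ heT hne hinv
    have h3 : c / e = c / (z : K) ^ n * (e / (z : K) ^ n)⁻¹ := by
      field_simp
    rw [h3]
    exact mul_mem hcT h2
  rw [le_iff_inv_mem]
  exact ⟨hST, fun s hs h0 hi => (le_iff_inv_mem.1 hSV).2 s hs h0 (hTV.1 hi)⟩

end Blowup

/-! ### Extensions of the ideal and localization -/

section Extension

variable {R K : Type*} [CommRing R] [Field K] [Algebra R K] {I : Ideal R}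

theorem map_extension {A B : Subring K} (h : A ≤ B) (hRA : ∀ r, algebraMap R K r ∈ A) :
    (extension I A).map (Subring.inclusion h) = extension I B := by
  rw [extension, Ideal.map_span]
  congr 1
  ext b
  constructor
  · rintro ⟨a, ⟨r, hr, har⟩, rfl⟩
    exact ⟨r, hr, har⟩
  · rintro ⟨r, hr, hbr⟩
    exact ⟨⟨_, hRA r⟩, ⟨r, hr, rfl⟩, Subtype.ext hbr.symm⟩

theorem extension_eq_span_of_le {A B : Subring K} (h : A ≤ B) (hRA : ∀ r, algebraMap R K r ∈ A)
    {z : A} (hz : extension I A = Ideal.span {z}) :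
    extension I B = Ideal.span {Subring.inclusion h z} := by
  rw [← map_extension h hRA, hz, Ideal.map_span, Set.image_singleton]

theorem exists_mul_mem_extension_of_mem_ofPrime {T : Subring K} (hRT : ∀ r, algebraMap R K r ∈ T)
    {𝔭 : Ideal T} [𝔭.IsPrime] {w : (LocalSubring.ofPrime T 𝔭).toSubring}
    (hw : w ∈ extension I (LocalSubring.ofPrime T 𝔭).toSubring) :
    ∃ u : T, u ∉ 𝔭 ∧ ∃ t ∈ extension I T, (u : K) * w = t := by
  refine Submodule.span_induction
    (p := fun (w : (LocalSubring.ofPrime T 𝔭).toSubring) _ =>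
      ∃ u : T, u ∉ 𝔭 ∧ ∃ t ∈ extension I T, (u : K) * w = t) ?_ ?_ ?_ ?_ hw
  · rintro w ⟨r, hr, hwr⟩
    refine ⟨1, fun h => Ideal.IsPrime.ne_top ‹_› ((Ideal.eq_top_iff_one _).2 h), ⟨_, hRT r⟩,
      Ideal.subset_span ⟨r, hr, rfl⟩, by simp [hwr]⟩
  · exact ⟨1, fun h => Ideal.IsPrime.ne_top ‹_› ((Ideal.eq_top_iff_one _).2 h), 0,
      Ideal.zero_mem _, by simp⟩
  · rintro v w - - ⟨u₁, hu₁, t₁, ht₁, h₁⟩ ⟨u₂, hu₂, t₂, ht₂, h₂⟩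
    refine ⟨u₁ * u₂, fun h => (Ideal.IsPrime.mem_or_mem ‹_› h).elim hu₁ hu₂, u₂ * t₁ + u₁ * t₂,
      Ideal.add_mem _ (Ideal.mul_mem_left _ _ ht₁) (Ideal.mul_mem_left _ _ ht₂), ?_⟩
    push_cast
    rw [← h₁, ← h₂]
    ring
  · rintro o w - ⟨u, hu, t, ht, h⟩
    obtain ⟨a, s, hs, has⟩ := mem_ofPrime_iff.1 o.2
    refine ⟨s * u, fun h => (Ideal.IsPrime.mem_or_mem ‹_› h).elim hs hu, a * t,
      Ideal.mul_mem_left _ _ ht, ?_⟩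
    have hs0 : (s : K) ≠ 0 := fun h0 => hs ((Subtype.ext h0 : s = 0) ▸ 𝔭.zero_mem)
    change ((s * u : T) : K) * ((o : K) * w) = _
    push_cast
    rw [has, ← h]
    field_simp

/-- If the transform of `I` in `T` lies in a prime `𝔭` and contains a product of primes, then `I`
does not become principal in `T` localized at `𝔭`. -/
theorem extension_ofPrime_ne_span {T : Subring K} (hRT : ∀ r, algebraMap R K r ∈ T)
    {𝔭 : Ideal T} [𝔭.IsPrime] {a : T} {J : Ideal T} (ha : a ≠ 0)
    (hleast : IsLeast {P : Ideal T | P.IsPrincipal ∧ extension I T ≤ P} (Ideal.span {a}))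
    (haJ : Ideal.span {a} * J = extension I T) (hJ : J ≤ 𝔭) {s : Multiset T}
    (hs : ∀ p ∈ s, Prime p) (hsJ : s.prod ∈ J) (γ : (LocalSubring.ofPrime T 𝔭).toSubring) :
    extension I (LocalSubring.ofPrime T 𝔭).toSubring ≠ Ideal.span {γ} := by
  intro hγ
  have ha0 : (a : K) ≠ 0 := fun h => ha (Subtype.ext h)
  obtain ⟨u, hu, t, ht, hut⟩ := exists_mul_mem_extension_of_mem_ofPrime hRT
    (hγ ▸ Ideal.mem_span_singleton_self γ)
  rw [← haJ] at ht
  -- Up to a factor outside `𝔭`, the generator `γ` is `a g` with `g ∈ J`; so `g` divides every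
  -- element of `J` up to such factors.
  obtain ⟨g, hg, rfl⟩ := Ideal.mem_span_singleton_mul.1 ht
  have key : ∀ j ∈ J, ∃ v ∉ 𝔭, ∃ b, v * j = g * b := by
    intro j hj
    have h1 : a * j ∈ extension I T := haJ ▸ Ideal.mul_mem_mul (Ideal.mem_span_singleton_self a) hj
    have h2 := Ideal.mem_map_of_mem (Subring.inclusion (LocalSubring.le_ofPrime T 𝔭)) h1
    rw [map_extension _ hRT, hγ, Ideal.mem_span_singleton] at h2
    obtain ⟨w, hw⟩ := h2
    obtain ⟨b, s, hs, hbs⟩ := mem_ofPrime_iff.1 w.2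
    refine ⟨s * u, fun h => (Ideal.IsPrime.mem_or_mem ‹_› h).elim hs hu, b, Subtype.ext ?_⟩
    have hs0 : (s : K) ≠ 0 := fun h0 => hs ((Subtype.ext h0 : s = 0) ▸ 𝔭.zero_mem)
    have hw' : (a : K) * j = γ * w := congrArg Subtype.val hw
    rw [hbs] at hw'
    push_cast at hut ⊢
    apply mul_left_cancel₀ ha0
    calc (a : K) * (s * u * j) = s * u * (a * j) := by ring
      _ = u * γ * b := by rw [hw']; field_simp
      _ = a * (g * b) := by rw [hut]; ring
  obtain ⟨v, hv, b, hvb⟩ := key _ hsJ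
  obtain ⟨p, hp𝔭, hp, hpg⟩ := exists_prime_dvd_of_mul_prod_eq hs hv (hJ hg) hvb
  -- A prime `p ∈ 𝔭` dividing `g` divides each `v j`, and not `v ∉ 𝔭`; so it divides all of `J`.
  refine not_le_span_prime_of_isLeast ha hleast haJ hp.not_isUnit fun j hj => ?_
  obtain ⟨v, hv, b, hvb⟩ := key j hj
  rw [Ideal.mem_span_singleton]
  refine (hp.dvd_or_dvd (hvb ▸ hpg.mul_right b)).resolve_left fun hpv => hv ?_
  exact Ideal.mem_of_dvd _ hpv hp𝔭

end Extension

/-- The only possible primes are zero and the maximal ideal, and the latter has at most one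
generator by regularity. -/
theorem isPrincipalIdealRing_of_ringKrullDim_lt_two {A : Type*} [CommRing A] [IsDomain A]
    [IsRegularLocalRing A] (h : ringKrullDim A < 2) : IsPrincipalIdealRing A := by
  rw [← maximalIdeal_height_eq_ringKrullDim] at h
  have h' : (maximalIdeal A).height < 2 := WithBot.coe_lt_coe.1 h
  have hfg := (maximalIdeal A).fg_of_isNoetherianRing
  refine IsPrincipalIdealRing.of_prime fun P hP => ?_
  by_cases hP0 : P = ⊥
  · rw [hP0]
    infer_instance
  by_cases hPm : P = maximalIdeal A
  · rw [hPm]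
    rw [height_maximalIdeal_eq_spanFinrank] at h'
    have h1 : (maximalIdeal A).spanFinrank < 2 := by exact_mod_cast h'
    have h2 : (maximalIdeal A).spanFinrank ≠ 0 := by
      rw [Ne, Submodule.spanFinrank_eq_zero_iff_eq_bot hfg]
      intro h0
      exact hP0 (le_bot_iff.1 (h0 ▸ le_maximalIdeal hP.ne_top))
    exact ((Submodule.spanFinrank_eq_one_iff _).1 (by omega)).1
  · exfalso
    have h1 := Ideal.height_add_one_le_of_lt_of_isPrime
      (lt_of_le_of_ne (le_maximalIdeal hP.ne_top) hPm)
    have h2 := Ideal.height_add_one_le_of_lt_of_isPrime (bot_lt_iff_ne_bot.2 hP0)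
    have h4 : (2 : ℕ∞) ≤ (maximalIdeal A).height := by
      calc (2 : ℕ∞) = 0 + 1 + 1 := by norm_num
        _ ≤ (⊥ : Ideal A).height + 1 + 1 := by gcongr; exact zero_le
        _ ≤ P.height + 1 := by gcongr
        _ ≤ (maximalIdeal A).height := h1
    exact absurd h' (not_lt.2 h4)

/-! ### Points reached from `R` by quadratic transforms -/

section GoodPoints

variable {R K : Type*} [CommRing R] [IsRegularLocalRing R] [Field K] [Algebra R K] {I : Ideal R}

/-- The regular local rings obtained from `R` by successive centers, with the property that the
extension of `I` contains a product of prime elements. -/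
structure IsGoodPoint (I : Ideal R) (T : LocalSubring K) : Prop where
  regular : IsRegularLocalRing T.toSubring
  le : LocalSubring.range (algebraMap R K) ≤ T
  chain : Relation.ReflTransGen IsLocalQuadraticTransform (LocalSubring.range (algebraMap R K)) T
  primes : T = LocalSubring.range (algebraMap R K) ∨
    ∃ s : Multiset T.toSubring, (∀ p ∈ s, Prime p) ∧ s.prod ∈ extension I T.toSubring

theorem algebraMap_mem_of_le {T : LocalSubring K} (h : LocalSubring.range (algebraMap R K) ≤ T)
    (r : R) : algebraMap R K r ∈ T.toSubring := h.1 ⟨r, rfl⟩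

theorem exists_pow_mem_extension (hI : I.radical = maximalIdeal R) {A : Subring K}
    {t : K} (ht : t ∈ A) (hr : ∃ r ∈ maximalIdeal R, algebraMap R K r = t) :
    ∃ N : ℕ, (⟨t, ht⟩ : A) ^ N ∈ extension I A := by
  obtain ⟨r, hr, rfl⟩ := hr
  rw [← hI] at hr
  obtain ⟨N, hN⟩ := hr
  exact ⟨N, Ideal.subset_span ⟨r ^ N, hN, by simp⟩⟩

/-- At a point that is not a base point, the ideal becomes principal. -/
theorem IsGoodPoint.exists_extension_eq_span {T : LocalSubring K} (hT : IsGoodPoint I T)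
    (hs : ∃ s : Multiset T.toSubring, (∀ p ∈ s, Prime p) ∧ s.prod ∈ extension I T.toSubring)
    (hbase : ¬IsBasePoint I T) : ∃ z, extension I T.toSubring = Ideal.span {z} := by
  have := hT.regular
  rcases lt_or_ge (ringKrullDim T.toSubring) 2 with hdim | hdim
  · have := isPrincipalIdealRing_of_ringKrullDim_lt_two hdim
    obtain ⟨z, hz⟩ := (IsPrincipalIdealRing.principal (extension I T.toSubring)).principal
    exact ⟨z, hz⟩
  · obtain ⟨s, hs, hsI⟩ := hs
    obtain ⟨a, J, ha, hleast, haJ, -⟩ := exists_isLeast_principal _ hs hsI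
    have hJ : J = ⊤ := by
      by_contra hJ
      exact hbase ⟨⟨hT.regular, hdim, hT.le, hT.chain⟩, J, ⟨a, ha, hleast, haJ⟩, hJ⟩
    exact ⟨a, by rw [← haJ, hJ, Ideal.mul_top]⟩

variable [IsFractionRing R K]

theorem isFractionRing_of_le {T : LocalSubring K} (h : LocalSubring.range (algebraMap R K) ≤ T) :
    IsFractionRing T.toSubring K := by
  refine IsFractionRing.of_field T.toSubring K fun z => ?_
  obtain ⟨a, b, -, rfl⟩ := IsFractionRing.div_surjective (A := R) z
  exact ⟨⟨_, algebraMap_mem_of_le h a⟩, ⟨_, algebraMap_mem_of_le h b⟩, rfl⟩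

theorem mem_of_isIntegral_of_le {T : LocalSubring K} [IsRegularLocalRing T.toSubring]
    (h : LocalSubring.range (algebraMap R K) ≤ T) {k : K} (hk : IsIntegral T.toSubring k) :
    k ∈ T.toSubring := by
  have := isFractionRing_of_le h
  obtain ⟨y, rfl⟩ := mem_range_of_isIntegral_of_isRegularLocalRing hk
  exact y.2

theorem isGoodPoint_range : IsGoodPoint I (LocalSubring.range (algebraMap R K)) where
  regular := by
    have hinj : Function.Injective (algebraMap R K) := IsFractionRing.injective R K
    exact IsRegularLocalRing.of_ringEquiv (RingEquiv.ofBijective (algebraMap R K).rangeRestrict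
      ⟨fun a b hab => hinj (congrArg Subtype.val hab), (algebraMap R K).rangeRestrict_surjective⟩)
  le := le_rfl
  chain := Relation.ReflTransGen.refl
  primes := Or.inl rfl

theorem mem_maximalIdeal_range_iff {r : R}
    (h : algebraMap R K r ∈ (LocalSubring.range (algebraMap R K)).toSubring) :
    (⟨_, h⟩ : (LocalSubring.range (algebraMap R K)).toSubring) ∈ maximalIdeal _ ↔
      r ∈ maximalIdeal R := by
  have hinj : Function.Injective (algebraMap R K) := IsFractionRing.injective R K
  rw [mem_maximalIdeal, mem_maximalIdeal, mem_nonunits_iff, mem_nonunits_iff, not_iff_not]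
  constructor
  · rw [isUnit_iff_exists_inv]
    rintro ⟨⟨_, ⟨b, rfl⟩⟩, hb⟩
    refine IsUnit.of_mul_eq_one b (hinj ?_)
    rw [map_mul, map_one]
    exact congrArg Subtype.val hb
  · rintro ⟨u, rfl⟩
    refine IsUnit.of_mul_eq_one ⟨algebraMap R K ((u⁻¹ : Rˣ) : R), ⟨_, rfl⟩⟩ (Subtype.ext ?_)
    change algebraMap R K _ * algebraMap R K _ = 1
    rw [← map_mul, Units.mul_inv, map_one]

theorem exists_mem_maximalIdeal_of_mem_range
    {t : (LocalSubring.range (algebraMap R K)).toSubring} (ht : t ∈ maximalIdeal _) :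
    ∃ r ∈ maximalIdeal R, algebraMap R K r = t := by
  obtain ⟨_, ⟨r, rfl⟩⟩ := t
  exact ⟨r, (mem_maximalIdeal_range_iff _).1 ht, rfl⟩

/-- The product of primes first arises on leaving `R`: the extension of the `𝔪`-primary ideal `I`
contains a power of the exceptional prime. Later transforms carry the product along through strict
transforms. -/
theorem IsGoodPoint.of_isQuadraticCenter (hI : I.radical = maximalIdeal R)
    {T T' : LocalSubring K} (hT : IsGoodPoint I T) {x : T.toSubring}
    (h : IsQuadraticCenter T x T') :
    IsGoodPoint I T' ∧
      ∃ s : Multiset T'.toSubring, (∀ p ∈ s, Prime p) ∧ s.prod ∈ extension I T'.toSubring := by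
  have hs : ∃ s : Multiset T'.toSubring, (∀ p ∈ s, Prime p) ∧
      s.prod ∈ extension I T'.toSubring := by
    rcases hT.primes with rfl | ⟨s, hs, hsI⟩
    · obtain ⟨N, hN⟩ := exists_pow_mem_extension (I := I) hI (h.transform.2.1 x.2)
        (exists_mem_maximalIdeal_of_mem_range h.mem)
      refine ⟨Multiset.replicate N (Subring.inclusion h.transform.2.1 x), fun p hp => ?_, ?_⟩
      · rw [Multiset.eq_of_mem_replicate hp]
        exact h.prime
      · rw [Multiset.prod_replicate]
        exact hN
    · obtain ⟨u, s', hu, hs', he⟩ := h.exists_prime_multiset hs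
      refine ⟨s', hs', ?_⟩
      have h1 := Ideal.mem_map_of_mem (Subring.inclusion h.transform.2.1) hsI
      rw [map_extension _ (algebraMap_mem_of_le hT.le), he] at h1
      exact (Ideal.unit_mul_mem_iff_mem _ hu).1 h1
  exact ⟨⟨h.regular, hT.le.trans h.transform.2, hT.chain.tail h.transform, Or.inr hs⟩, hs⟩

theorem maximalIdeal_le_of_extension_range_le (hI : I.radical = maximalIdeal R)
    {𝔭 : Ideal (LocalSubring.range (algebraMap R K)).toSubring} (h𝔭 : 𝔭.IsPrime)
    (h : extension I (LocalSubring.range (algebraMap R K)).toSubring ≤ 𝔭) :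
    maximalIdeal _ ≤ 𝔭 := by
  intro t ht
  obtain ⟨N, hN⟩ := exists_pow_mem_extension (I := I) hI t.2
    (exists_mem_maximalIdeal_of_mem_range ht)
  exact h𝔭.mem_of_pow_mem N (h hN)

/-- A proper principal ideal containing the `𝔪`-primary extension would have `𝔪` as a minimal prime,
against height at least two. -/
theorem isLeast_extension_range (hI : I.radical = maximalIdeal R)
    (hdim : 2 ≤ ringKrullDim (LocalSubring.range (algebraMap R K)).toSubring) :
    IsLeast {P : Ideal (LocalSubring.range (algebraMap R K)).toSubring | P.IsPrincipal ∧
      extension I (LocalSubring.range (algebraMap R K)).toSubring ≤ P} (Ideal.span {1}) := by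
  have := (isGoodPoint_range (I := I) (K := K)).regular
  refine ⟨⟨⟨⟨1, rfl⟩⟩, by simp⟩, ?_⟩
  rintro P ⟨hP, hIP⟩
  have hPtop : P = ⊤ := by
    by_contra hne
    have hmin : maximalIdeal (LocalSubring.range (algebraMap R K)).toSubring ∈
        P.minimalPrimes :=
      ⟨⟨inferInstance, le_maximalIdeal hne⟩, fun q hq _ =>
        maximalIdeal_le_of_extension_range_le hI hq.1 (hIP.trans hq.2)⟩
    have h1 := Ideal.height_le_one_of_isPrincipal_of_mem_minimalPrimes _ _ hmin
    exact absurd ((two_le_height hdim).trans h1) (by decide)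
  rw [hPtop]
  exact le_top

theorem isBasePoint_range (hI : I.radical = maximalIdeal R)
    (hdim : 2 ≤ ringKrullDim (LocalSubring.range (algebraMap R K)).toSubring) :
    IsBasePoint I (LocalSubring.range (algebraMap R K)) := by
  refine ⟨⟨(isGoodPoint_range (I := I) (K := K)).regular, hdim, le_rfl,
    Relation.ReflTransGen.refl⟩, extension I _,
    ⟨1, one_ne_zero, isLeast_extension_range hI hdim, by simp⟩, ?_⟩
  refine ne_top_of_le_ne_top (maximalIdeal.isMaximal
    (LocalSubring.range (algebraMap R K)).toSubring).ne_top (Ideal.span_le.2 ?_)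
  rintro ⟨_, hs⟩ ⟨r, hr, rfl⟩
  exact (mem_maximalIdeal_range_iff _).2 (hI ▸ Ideal.le_radical hr)

end GoodPoints

/-! ### Composition of a localization with a valuation of its residue field -/

section Composite

variable {K : Type*} [Field K]

/-- The preimage in a local subring `O` of a valuation ring of its residue field. -/
theorem exists_composite_localSubring (O : LocalSubring K)
    (W : ValuationSubring (ResidueField O.toSubring)) :
    ∃ D : LocalSubring K, ∀ k : K, k ∈ D.toSubring ↔
      ∃ h : k ∈ O.toSubring, residue O.toSubring ⟨k, h⟩ ∈ W := by
  let D₀ : Subring O.toSubring := W.toSubring.comap (residue O.toSubring)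
  let φ : D₀ →+* W.toSubring := (residue O.toSubring).restrict D₀ W.toSubring fun _ h => h
  -- An element reducing to a unit of `W` is a unit of `O`, and its inverse again reduces into `W`;
  -- this makes the preimage local.
  have hφ : IsLocalHom φ := by
    refine ⟨fun d hd => ?_⟩
    obtain ⟨w, hw⟩ := isUnit_iff_exists_inv.1 hd
    have hw' : residue O.toSubring d * (w : ResidueField O.toSubring) = 1 :=
      congrArg Subtype.val hw
    have hd0 : residue O.toSubring d ≠ 0 := fun h => by simp [h] at hw'
    rw [residue_ne_zero_iff_isUnit] at hd0
    obtain ⟨e, he⟩ := isUnit_iff_exists_inv.1 hd0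
    have he' : residue O.toSubring e = w := by
      have h1 : residue O.toSubring d * residue O.toSubring e = 1 := by
        rw [← map_mul, he, map_one]
      exact mul_left_cancel₀ (left_ne_zero_of_mul_eq_one hw') (h1.trans hw'.symm)
    have heD : e ∈ D₀ := by
      change residue O.toSubring e ∈ W.toSubring
      rw [he']
      exact w.2
    exact IsUnit.of_mul_eq_one ⟨e, heD⟩ (Subtype.ext he)
  have : IsLocalRing W.toSubring := inferInstanceAs (IsLocalRing W)
  have : IsLocalRing D₀ := φ.domain_isLocalRing
  refine ⟨LocalSubring.map O.toSubring.subtype ⟨D₀⟩, fun k => ?_⟩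
  constructor
  · rintro ⟨k, hk, rfl⟩
    exact ⟨k.2, hk⟩
  · rintro ⟨h, hk⟩
    exact ⟨⟨k, h⟩, hk, rfl⟩

theorem _root_.ValuationSubring.exists_div_mem {F : Type*} [Field F] (W : ValuationSubring F)
    {ι : Type*} (s : Finset ι) (f : ι → F) (h : ∃ i ∈ s, f i ≠ 0) :
    ∃ i ∈ s, f i ≠ 0 ∧ ∀ j ∈ s, f j / f i ∈ W := by
  obtain ⟨i₀, hi₀, h0⟩ := h
  obtain ⟨i, hi, hmax⟩ := s.exists_max_image (fun i => W.valuation (f i)) ⟨i₀, hi₀⟩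
  have hi0 : f i ≠ 0 := by
    intro hi0
    have := hmax i₀ hi₀
    rw [hi0, map_zero, le_zero_iff, map_eq_zero] at this
    exact h0 this
  refine ⟨i, hi, hi0, fun j hj => ?_⟩
  rw [← W.valuation_le_one_iff, map_div₀]
  exact div_le_one_of_le₀ (hmax j hj) zero_le

theorem div_mem_of_mem_span {A B : Subring K} (hAB : A ≤ B) {x : K} {g : Set A}
    (h : ∀ y ∈ g, (y : K) / x ∈ B) {y : A} (hy : y ∈ Ideal.span g) : (y : K) / x ∈ B := by
  refine Submodule.span_induction (p := fun (y : A) _ => (y : K) / x ∈ B) h (by simp) ?_ ?_ hy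
  · intro y z _ _ h1 h2
    rw [Subring.coe_add, add_div]
    exact add_mem h1 h2
  · intro c y _ h
    rw [smul_eq_mul, Subring.coe_mul, mul_div_assoc]
    exact mul_mem (hAB c.2) h

/-- A local subring `T` is dominated by some `D` inside the localization `O` of `T` at `𝔭` such
that, among finitely many elements of `O` that are not all nonunits, one divides the others
in `D`. -/
theorem exists_le_ofPrime_forall_exists_div_mem (T : LocalSubring K) (𝔭 : Ideal T.toSubring)
    [𝔭.IsPrime] :
    ∃ D : LocalSubring K, T ≤ D ∧ D.toSubring ≤ (LocalSubring.ofPrime T.toSubring 𝔭).toSubring ∧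
      ∀ s : Finset K, (∀ k ∈ s, k ∈ (LocalSubring.ofPrime T.toSubring 𝔭).toSubring) →
        (∃ k ∈ s, k ≠ 0 ∧ k⁻¹ ∈ (LocalSubring.ofPrime T.toSubring 𝔭).toSubring) →
        ∃ x ∈ s, x ≠ 0 ∧ ∀ k ∈ s, k / x ∈ D.toSubring := by
  set O := LocalSubring.ofPrime T.toSubring 𝔭 with hO
  have hTO : T.toSubring ≤ O.toSubring := LocalSubring.le_ofPrime _ _
  -- `W` is taken so that `T` maps to it by a local homomorphism; this is what makes the composite
  -- `D` dominate `T`.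
  obtain ⟨W, hW, hloc⟩ := IsLocalRing.exists_factor_valuationRing
    ((residue O.toSubring).comp (Subring.inclusion hTO))
  obtain ⟨D, hD⟩ := exists_composite_localSubring O W
  refine ⟨D, le_iff_inv_mem.2 ⟨fun a ha => (hD a).2 ⟨hTO ha, hW ⟨a, ha⟩⟩, ?_⟩,
    fun k hk => ((hD k).1 hk).1, ?_⟩
  · intro a ha ha0 hainv
    obtain ⟨h, hr⟩ := (hD _).1 hainv
    rw [← isUnit_iff_inv_mem ha ha0]
    refine hloc.map_nonunit ⟨a, ha⟩ (IsUnit.of_mul_eq_one ⟨_, hr⟩ (Subtype.ext ?_))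
    change residue O.toSubring ⟨a, hTO ha⟩ * residue O.toSubring ⟨a⁻¹, h⟩ = 1
    rw [← map_mul, ← map_one (residue O.toSubring)]
    exact congrArg _ (Subtype.ext (mul_inv_cancel₀ ha0))
  · intro s hs hex
    classical
    let f : K → ResidueField O.toSubring := fun k =>
      if h : k ∈ O.toSubring then residue O.toSubring ⟨k, h⟩ else 0
    have hf : ∀ k (h : k ∈ O.toSubring), f k = residue O.toSubring ⟨k, h⟩ := fun k h => dif_pos h
    obtain ⟨k₀, hk₀, h0, hinv⟩ := hex
    -- The residue of largest value is nonzero, so it comes from a unit of `O`, and quotients by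
    -- that unit reduce into `W`.
    obtain ⟨x, hx, hx0, hmax⟩ := W.exists_div_mem s f ⟨k₀, hk₀, by
      rw [hf _ (hs _ hk₀), residue_ne_zero_iff_isUnit]
      exact (isUnit_iff_inv_mem _ h0).2 hinv⟩
    rw [hf _ (hs _ hx), residue_ne_zero_iff_isUnit] at hx0
    have hxne : x ≠ 0 := fun h => hx0.ne_zero (Subtype.ext h)
    have hxinv : x⁻¹ ∈ O.toSubring := (isUnit_iff_inv_mem _ hxne).1 hx0
    refine ⟨x, hx, hxne, fun k hk => (hD _).2 ⟨?_, ?_⟩⟩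
    · rw [div_eq_mul_inv]
      exact mul_mem (hs k hk) hxinv
    · have h1 := hmax k hk
      rw [hf _ (hs _ hx), hf _ (hs _ hk)] at h1
      convert h1
      have hne : residue O.toSubring ⟨x, hs x hx⟩ ≠ 0 := (residue_ne_zero_iff_isUnit _).2 hx0
      rw [eq_div_iff hne, ← map_mul]
      exact congrArg _ (Subtype.ext (div_mul_cancel₀ _ hxne))

end Composite

/-! ### Transforms at base points are primary to the maximal ideal -/

section Primary

variable {R K : Type*} [CommRing R] [IsRegularLocalRing R] [Field K] [Algebra R K]
  [IsFractionRing R K] {I : Ideal R}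

/-- If the maximal ideals of the base points dominated by `D` become principal in `D`, then the
sequence of centers of `D` reaches a point where `I` is principal. -/
theorem exists_isQuadraticCenter_extension_eq_span (hI : I.radical = maximalIdeal R)
    (hfin : IsFinitelySupported K I) {T D : LocalSubring K} (hT : IsGoodPoint I T)
    (hbase : IsBasePoint I T) (hTD : T ≤ D)
    (hx : ∀ T' : LocalSubring K, IsGoodPoint I T' → IsBasePoint I T' → T ≤ T' → T' ≤ D →
      ∃ x ∈ maximalIdeal T'.toSubring, x ≠ 0 ∧
        ∀ y ∈ maximalIdeal T'.toSubring, (y : K) / x ∈ D.toSubring) :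
    ∃ (T₁ T₂ : LocalSubring K) (x : T₁.toSubring), IsBasePoint I T₁ ∧ IsGoodPoint I T₂ ∧
      IsQuadraticCenter T₁ x T₂ ∧ T₂ ≤ D ∧ ∃ z, extension I T₂.toSubring = Ideal.span {z} := by
  -- Finite support provides a maximal base point below `D`; the next center is strictly larger and
  -- so cannot be a base point.
  obtain ⟨T₁, hT₁⟩ := (Set.Finite.subset hfin (t := {T' : LocalSubring K | IsBasePoint I T' ∧
    IsGoodPoint I T' ∧ T ≤ T' ∧ T' ≤ D}) fun _ h => h.1).exists_maximal
    ⟨T, hbase, hT, le_rfl, hTD⟩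
  obtain ⟨hb₁, hg₁, hTT₁, hT₁D⟩ := hT₁.prop
  obtain ⟨x, hxm, hx0, hdiv⟩ := hx T₁ hg₁ hb₁ hTT₁ hT₁D
  have := hg₁.regular
  obtain ⟨T₂, hc, hT₂D⟩ := exists_isQuadraticCenter hT₁D hxm hx0 hdiv
  obtain ⟨hg₂, hs⟩ := hg₁.of_isQuadraticCenter hI hc
  have hlt := hc.lt hb₁.1.2.1
  refine ⟨T₁, T₂, x, hb₁, hg₂, hc, hT₂D, hg₂.exists_extension_eq_span hs fun hb₂ => ?_⟩
  exact hlt.not_ge (hT₁.le_of_ge ⟨hb₂, hg₂, hTT₁.trans hlt.le, hT₂D⟩ hlt.le)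

/-- The transform of `I` in a base point is primary to the maximal ideal. -/
theorem IsGoodPoint.eq_maximalIdeal_of_transform_le (hI : I.radical = maximalIdeal R)
    (hfin : IsFinitelySupported K I) {T : LocalSubring K} (hT : IsGoodPoint I T)
    (hdim : 2 ≤ ringKrullDim T.toSubring) {J : Ideal T.toSubring}
    (hJ : IsTransform I T.toSubring J) {𝔭 : Ideal T.toSubring} (h𝔭 : 𝔭.IsPrime) (hJ𝔭 : J ≤ 𝔭) :
    𝔭 = maximalIdeal T.toSubring := by
  obtain ⟨a, ha, hleast, haJ⟩ := hJ
  rcases hT.primes with rfl | ⟨s, hs, hsI⟩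
  · refine le_antisymm (le_maximalIdeal h𝔭.ne_top)
      (maximalIdeal_le_of_extension_range_le hI h𝔭 (le_trans ?_ hJ𝔭))
    rw [← haJ, hleast.unique (isLeast_extension_range hI hdim)]
    simp
  by_contra hne
  have hbase : IsBasePoint I T := ⟨⟨hT.regular, hdim, hT.le, hT.chain⟩, J, ⟨a, ha, hleast, haJ⟩,
    fun h => h𝔭.ne_top (top_le_iff.1 (h ▸ hJ𝔭))⟩
  obtain ⟨t, htm, ht𝔭⟩ := SetLike.exists_of_lt (lt_of_le_of_ne (le_maximalIdeal h𝔭.ne_top) hne)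
  obtain ⟨s', hs', hsJ⟩ : ∃ s' : Multiset T.toSubring, (∀ p ∈ s', Prime p) ∧ s'.prod ∈ J := by
    obtain ⟨a', J', ha', hleast', haJ', s', hs', hsJ'⟩ := exists_isLeast_principal _ hs hsI
    refine ⟨s', hs', ?_⟩
    have h1 : Ideal.span {a} * J = Ideal.span {a} * J' := by
      rw [haJ, hleast.unique hleast', haJ']
    rw [(Ideal.span_singleton_mul_right_inj ha).1 h1]
    exact hsJ'
  have ht0 : (t : K) ≠ 0 := fun h => ht𝔭 ((Subtype.ext h : t = 0) ▸ 𝔭.zero_mem)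
  have htinv : (t : K)⁻¹ ∈ (LocalSubring.ofPrime T.toSubring 𝔭).toSubring :=
    mem_ofPrime_iff.2 ⟨1, t, ht𝔭, by simp⟩
  -- The element `t` lies in the maximal ideal of every point between `T` and `D`, yet is a unit of
  -- the localization at `𝔭`. So each such maximal ideal, generated by finitely many elements
  -- together with `t`, becomes principal in `D`.
  obtain ⟨D, hTD, hDO, hD⟩ := exists_le_ofPrime_forall_exists_div_mem T 𝔭
  suffices hx : ∀ T' : LocalSubring K, IsGoodPoint I T' → IsBasePoint I T' → T ≤ T' → T' ≤ D →
      ∃ x ∈ maximalIdeal T'.toSubring, x ≠ 0 ∧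
        ∀ y ∈ maximalIdeal T'.toSubring, (y : K) / x ∈ D.toSubring by
    obtain ⟨-, T₂, -, -, hg₂, -, hT₂D, z, hz⟩ :=
      exists_isQuadraticCenter_extension_eq_span hI hfin hT hbase hTD hx
    exact extension_ofPrime_ne_span (algebraMap_mem_of_le hT.le) ha hleast haJ hJ𝔭 hs' hsJ _
      (extension_eq_span_of_le (hT₂D.1.trans hDO) (algebraMap_mem_of_le hg₂.le) hz)
  intro T' hg' _ hTT' hT'D
  have := hg'.regular
  obtain ⟨g, hg⟩ := (maximalIdeal T'.toSubring).fg_of_isNoetherianRing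
  have htm' : (⟨t, hTT'.1 t.2⟩ : T'.toSubring) ∈ maximalIdeal T'.toSubring :=
    (mem_maximalIdeal_iff_of_le hTT' t.2).1 htm
  classical
  obtain ⟨x, hx, hx0, hdiv⟩ := hD ((insert ⟨t, hTT'.1 t.2⟩ g).image Subtype.val) (by
      intro k hk
      obtain ⟨y, -, rfl⟩ := Finset.mem_image.1 hk
      exact hDO (hT'D.1 y.2))
    ⟨t, Finset.mem_image.2 ⟨_, Finset.mem_insert_self _ _, rfl⟩, ht0, htinv⟩
  obtain ⟨x, hxg, rfl⟩ := Finset.mem_image.1 hx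
  refine ⟨x, ?_, fun h => hx0 (congrArg Subtype.val h), fun y hy => ?_⟩
  · rcases Finset.mem_insert.1 hxg with rfl | h
    · exact htm'
    · rw [← hg]
      exact Ideal.subset_span h
  · rw [← hg] at hy
    exact div_mem_of_mem_span hT'D.1
      (fun y hy => hdiv y (Finset.mem_image.2 ⟨y, Finset.mem_insert_of_mem hy, rfl⟩)) hy

end Primary

/-! ### Homogeneous prime avoidance over arbitrary residue fields -/

section Avoidance

/-- If `u = v` the sum is `ℓ u ^ (ℓ - 1)`. Otherwise its product with `u - v` is `u ^ ℓ - v ^ ℓ`,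
whose vanishing would give `u / v` order exactly `ℓ`. So all but at most two primes work, even over
a finite field. -/
theorem geom_sum₂_ne_zero_of_prime {F : Type*} [Field F] {u v : F} (h : u ≠ 0 ∨ v ≠ 0) {ℓ : ℕ}
    (hℓ : ℓ.Prime) (hord : ℓ ≠ orderOf (u / v)) (hchar : ℓ ≠ ringChar F) :
    ∑ j ∈ Finset.range ℓ, u ^ j * v ^ (ℓ - 1 - j) ≠ 0 := by
  intro hsum
  by_cases huv : u = v
  · subst huv
    have hu : u ≠ 0 := h.elim id id
    have h1 : ∑ j ∈ Finset.range ℓ, u ^ j * u ^ (ℓ - 1 - j) = ℓ * u ^ (ℓ - 1) := by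
      rw [Finset.sum_congr rfl fun j hj => by
        rw [← pow_add, Nat.add_sub_cancel' (Nat.le_sub_one_of_lt (Finset.mem_range.1 hj))]]
      simp
    rw [h1, mul_eq_zero, or_iff_left (pow_ne_zero _ hu), ringChar.spec] at hsum
    have hone : ringChar F ≠ 1 := fun h1 => by
      have := (ringChar.spec F 1).2 (by rw [h1])
      simp at this
    exact hchar ((hℓ.eq_one_or_self_of_dvd _ hsum).resolve_left hone).symm
  · have hpow : u ^ ℓ = v ^ ℓ := by
      rw [← sub_eq_zero, ← (Commute.all u v).geom_sum₂_mul, hsum, zero_mul]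
    have hv : v ≠ 0 := by
      rintro rfl
      rw [zero_pow hℓ.ne_zero] at hpow
      exact huv (pow_eq_zero_iff hℓ.ne_zero |>.1 hpow)
    have : Fact ℓ.Prime := ⟨hℓ⟩
    refine hord (orderOf_eq_prime ?_ fun h1 => huv ((div_eq_one_iff_eq hv).1 h1)).symm
    rw [div_pow, hpow, div_self (pow_ne_zero _ hv)]

variable {K : Type*} [Field K]

/-- Prime avoidance for homogeneous elements: a form that generates a power of the maximal ideal
of `T` in finitely many local rings where this ideal is principal. -/
theorem exists_mem_pow_forall_pow_div_mem {T : LocalSubring K}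
    (hT : ∃ t ∈ maximalIdeal T.toSubring, t ≠ 0) {ι : Type*} (s : Finset ι)
    (B : ι → LocalSubring K) (x : ι → T.toSubring)
    (hTB : ∀ i ∈ s, T.toSubring ≤ (B i).toSubring) (hx0 : ∀ i ∈ s, x i ≠ 0)
    (hxm : ∀ i ∈ s, x i ∈ maximalIdeal T.toSubring)
    (hdiv : ∀ i ∈ s, ∀ y ∈ maximalIdeal T.toSubring, (y : K) / x i ∈ (B i).toSubring) :
    ∃ e, 0 < e ∧ ∃ f ∈ maximalIdeal T.toSubring ^ e, f ≠ 0 ∧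
      ∀ i ∈ s, (x i : K) ^ e / f ∈ (B i).toSubring := by
  classical
  induction s using Finset.induction_on with
  | empty =>
    obtain ⟨t, ht, ht0⟩ := hT
    exact ⟨1, one_pos, t, by simpa using ht, ht0, by simp⟩
  | insert i₀ s _ ih =>
    obtain ⟨e, he, f, hf, hf0, hfs⟩ := ih (fun i hi => hTB i (Finset.mem_insert_of_mem hi))
      (fun i hi => hx0 i (Finset.mem_insert_of_mem hi))
      (fun i hi => hxm i (Finset.mem_insert_of_mem hi))
      (fun i hi => hdiv i (Finset.mem_insert_of_mem hi))
    -- With `g = (x i₀) ^ e`, this is `(f ^ ℓ - g ^ ℓ) / (f - g)`, a form of degree `e (ℓ - 1)`. It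
    -- stays nonzero at every residue field for large primes `ℓ`, as long as `f` and `g` do not
    -- vanish together.
    let h : ℕ → T.toSubring := fun ℓ =>
      ∑ j ∈ Finset.range ℓ, f ^ j * (x i₀ ^ e) ^ (ℓ - 1 - j)
    have hf0' : (f : K) ≠ 0 := fun h => hf0 (Subtype.ext h)
    have hg := hxm i₀ (Finset.mem_insert_self _ _)
    have hev : ∀ i ∈ insert i₀ s, ∀ᶠ ℓ : ℕ in Filter.atTop, ℓ.Prime →
        h ℓ ≠ 0 ∧ (x i : K) ^ (e * (ℓ - 1)) / h ℓ ∈ (B i).toSubring := by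
      intro i hi
      have hxi : (x i : K) ≠ 0 := fun h => hx0 i hi (Subtype.ext h)
      let u : (B i).toSubring := ⟨f / x i ^ e, div_pow_mem (hTB i hi) (hdiv i hi) hf⟩
      let v : (B i).toSubring := ⟨(x i₀ / x i) ^ e, pow_mem (hdiv i hi _ hg) e⟩
      -- At `i₀` the second quotient is `1`; at the earlier indices the first is a unit by
      -- induction.
      have huv : residue _ u ≠ 0 ∨ residue _ v ≠ 0 := by
        rcases Finset.mem_insert.1 hi with rfl | his
        · right
          have : v = 1 := Subtype.ext (by simp [v, hxi])
          simp [this]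
        · left
          rw [residue_ne_zero_iff_isUnit]
          refine IsUnit.of_mul_eq_one ⟨_, hfs i his⟩ (Subtype.ext ?_)
          change (f : K) / x i ^ e * (x i ^ e / f) = 1
          field_simp
      filter_upwards [Filter.eventually_gt_atTop (orderOf (residue _ u / residue _ v)),
        Filter.eventually_gt_atTop (ringChar (ResidueField (B i).toSubring))] with ℓ h1 h2 hℓ
      have hne := geom_sum₂_ne_zero_of_prime huv hℓ h1.ne' h2.ne'
      simp only [← map_pow, ← map_mul, ← map_sum] at hne
      rw [residue_ne_zero_iff_isUnit] at hne
      have hw : ((∑ j ∈ Finset.range ℓ, u ^ j * v ^ (ℓ - 1 - j) : (B i).toSubring) : K) =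
          h ℓ / x i ^ (e * (ℓ - 1)) := by
        simp only [h, AddSubmonoidClass.coe_finsetSum, Subring.coe_mul, Subring.coe_pow,
          Finset.sum_div]
        refine Finset.sum_congr rfl fun j hj => ?_
        have hj' : e * (ℓ - 1) = e * j + e * (ℓ - 1 - j) := by
          rw [← mul_add, Nat.add_sub_cancel' (Nat.le_sub_one_of_lt (Finset.mem_range.1 hj))]
        simp only [u, v]
        rw [hj', pow_add, div_pow, div_pow, div_pow, ← pow_mul, ← pow_mul, ← pow_mul,
          div_mul_div_comm]
      generalize (∑ j ∈ Finset.range ℓ, u ^ j * v ^ (ℓ - 1 - j)) = w at hne hw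
      have hw0 : (w : K) ≠ 0 := fun h0 => hne.ne_zero (Subtype.ext h0)
      have hinv := (isUnit_iff_inv_mem w.2 hw0).1 hne
      rw [hw, inv_div] at hinv
      refine ⟨fun h0 => hw0 ?_, hinv⟩
      rw [hw, h0]
      simp
    obtain ⟨N, hN⟩ := Filter.eventually_atTop.1 ((Finset.eventually_all _).2 hev)
    obtain ⟨ℓ, hNℓ, hℓ⟩ := Nat.exists_infinite_primes N
    refine ⟨e * (ℓ - 1), Nat.mul_pos he (Nat.sub_pos_of_lt hℓ.one_lt), h ℓ, ?_,
      (hN ℓ hNℓ i₀ (Finset.mem_insert_self _ _) hℓ).1, fun i hi => (hN ℓ hNℓ i hi hℓ).2⟩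
    refine Ideal.sum_mem _ fun j hj => ?_
    have hj' : e * (ℓ - 1) = e * j + e * (ℓ - 1 - j) := by
      rw [← mul_add, Nat.add_sub_cancel' (Nat.le_sub_one_of_lt (Finset.mem_range.1 hj))]
    rw [hj', pow_add, pow_mul, pow_mul]
    exact Ideal.mul_mem_mul (Ideal.pow_mem_pow hf j)
      (Ideal.pow_mem_pow (Ideal.pow_mem_pow hg e) _)

end Avoidance

/-! ### Maximal ideals of base points become principal in a factorial `S` -/

section Factorial

theorem _root_.ValuationSubring.exists_forall_div_mem_of_fg {K : Type*} [Field K]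
    (V : ValuationSubring K) {A : Subring K} (hAV : A ≤ V.toSubring) {L : Ideal A} (hL : L.FG)
    (hL0 : L ≠ ⊥) : ∃ x ∈ L, x ≠ 0 ∧ ∀ y ∈ L, (y : K) / x ∈ V.toSubring := by
  obtain ⟨g, rfl⟩ := hL
  obtain ⟨x, hx, hx0, hdiv⟩ := V.exists_div_mem g (fun y : A => (y : K)) (by
    by_contra! h
    refine hL0 (Ideal.span_eq_bot.2 fun y hy => Subtype.ext (h y hy)))
  refine ⟨x, Ideal.subset_span hx, fun h => hx0 (congrArg Subtype.val h), fun y hy => ?_⟩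
  exact div_mem_of_mem_span hAV hdiv hy

variable {R K : Type*} [CommRing R] [IsRegularLocalRing R] [Field K] [Algebra R K]
  [IsFractionRing R K] {I : Ideal R}

/-- The maximal ideal of a base point `T` dominated by `S` is contained in a height one prime
of `S`. -/
theorem IsGoodPoint.exists_prime_forall_dvd (hI : I.radical = maximalIdeal R)
    (hfin : IsFinitelySupported K I) {S T : LocalSubring K}
    (hS : IsOnNormalizedBlowup I S) (hUFD : UniqueFactorizationMonoid S.toSubring)
    (hT : IsGoodPoint I T) (hbase : IsBasePoint I T) (hTS : T ≤ S) :
    ∃ p : S.toSubring, Prime p ∧ ∀ y ∈ maximalIdeal T.toSubring, p ∣ Subring.inclusion hTS.1 y := by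
  obtain ⟨α, hα, hα0, hαS, -⟩ := hS.exists_generator
  obtain ⟨-, J, ⟨a, ha, hleast, haJ⟩, hJ⟩ := id hbase
  have ha0 : (a : K) ≠ 0 := fun h => ha (Subtype.ext h)
  have hRT := algebraMap_mem_of_le hT.le
  have hαT : (⟨_, hRT α⟩ : T.toSubring) ∈ Ideal.span {a} * J := by
    rw [haJ]
    exact Ideal.subset_span ⟨α, hα, rfl⟩
  -- As `α = a g` generates the extension of `I` to `S`, the element `g` generates that of `J`. It
  -- is a nonunit because `J` is proper and `S` dominates `T`.
  obtain ⟨g, hg, hαg⟩ := Ideal.mem_span_singleton_mul.1 hαT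
  have hαg' : (a : K) * g = algebraMap R K α := congrArg Subtype.val hαg
  have hdvd : ∀ j ∈ J, Subring.inclusion hTS.1 g ∣ Subring.inclusion hTS.1 j := by
    intro j hj
    have h1 : a * j ∈ extension I T.toSubring :=
      haJ ▸ Ideal.mul_mem_mul (Ideal.mem_span_singleton_self a) hj
    have h2 := Ideal.mem_map_of_mem (Subring.inclusion hTS.1) h1
    rw [map_extension _ hRT] at h2
    have h3 : extension I S.toSubring ≤ Ideal.span {⟨_, hTS.1 (hRT α)⟩} := by
      refine Ideal.span_le.2 ?_
      rintro s ⟨i, hi, his⟩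
      refine Ideal.mem_span_singleton.2 ⟨⟨_, hαS i hi⟩, Subtype.ext ?_⟩
      change (s : K) = algebraMap R K α * (algebraMap R K i / algebraMap R K α)
      rw [his, mul_div_cancel₀ _ hα0]
    obtain ⟨w, hw⟩ := Ideal.mem_span_singleton.1 (h3 h2)
    refine ⟨w, Subtype.ext (mul_left_cancel₀ ha0 ?_)⟩
    have hw' : (a : K) * j = algebraMap R K α * w := congrArg Subtype.val hw
    change (a : K) * j = a * (g * w)
    rw [hw', ← hαg', mul_assoc]
  have hg0 : Subring.inclusion hTS.1 g ≠ 0 := by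
    intro h
    have h' : (g : K) = 0 := congrArg Subtype.val h
    rw [h', mul_zero] at hαg'
    exact hα0 hαg'.symm
  have hgu : ¬IsUnit (Subring.inclusion hTS.1 g) := by
    have := (mem_maximalIdeal_iff_of_le hTS g.2).1 (le_maximalIdeal hJ hg)
    exact (mem_maximalIdeal _).1 this
  obtain ⟨p, hp, hpg⟩ := WfDvdMonoid.exists_irreducible_factor hgu hg0
  have hp' := hp.prime
  refine ⟨p, hp', fun y hy => ?_⟩
  have hprime : (Ideal.span {p}).IsPrime := (Ideal.span_singleton_prime hp'.ne_zero).2 hp'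
  -- The contraction of `(p)` to `T` is a prime containing the primary ideal `J`, so it is the
  -- maximal ideal.
  have hmax := hT.eq_maximalIdeal_of_transform_le hI hfin hbase.1.2.1 ⟨a, ha, hleast, haJ⟩
    (hprime.comap (Subring.inclusion hTS.1)) fun j hj =>
      Ideal.mem_span_singleton.2 (hpg.trans (hdvd j hj))
  rw [← hmax] at hy
  exact Ideal.mem_span_singleton.1 hy

/-- If `S` is factorial, the maximal ideal of a base point dominated by `S` becomes principal
in `S`. -/
theorem IsGoodPoint.exists_forall_div_mem (hI : I.radical = maximalIdeal R)
    (hfin : IsFinitelySupported K I) {S T : LocalSubring K}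
    (hS : IsOnNormalizedBlowup I S) (hUFD : UniqueFactorizationMonoid S.toSubring)
    (hT : IsGoodPoint I T) (hbase : IsBasePoint I T) (hTS : T ≤ S) :
    ∃ x ∈ maximalIdeal T.toSubring, x ≠ 0 ∧
      ∀ y ∈ maximalIdeal T.toSubring, (y : K) / x ∈ S.toSubring := by
  have := hT.regular
  have hm0 : maximalIdeal T.toSubring ≠ ⊥ := by
    intro h
    have h2 := two_le_height hbase.1.2.1
    rw [h, Ideal.height_bot] at h2
    exact absurd h2 (by decide)
  obtain ⟨t, htm, ht0⟩ := Submodule.exists_mem_ne_zero_of_ne_bot hm0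
  set ι := Subring.inclusion hTS.1 with hι
  have hinj : Function.Injective ι := Subring.inclusion_injective _
  obtain ⟨s, hs, hst⟩ := UniqueFactorizationMonoid.exists_prime_factors (ι t)
    ((map_ne_zero_iff _ hinj).2 ht0)
  -- `b` is the greatest common divisor in `S` of the elements of the maximal ideal of `T`.
  obtain ⟨b, -, hb0, hleast, -, -⟩ := exists_isLeast_principal
    ((maximalIdeal T.toSubring).map ι) hs
      (Ideal.mem_of_dvd _ hst.symm.dvd (Ideal.mem_map_of_mem ι htm))
  have hbK : (b : K) ≠ 0 := fun h => hb0 (Subtype.ext h)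
  have hbdvd : ∀ y ∈ maximalIdeal T.toSubring, b ∣ ι y := fun y hy =>
    Ideal.mem_span_singleton.1 (hleast.1.2 (Ideal.mem_map_of_mem ι hy))
  have hbleast : ∀ q : S.toSubring, (∀ y ∈ maximalIdeal T.toSubring, q ∣ ι y) → q ∣ b := by
    intro q hq
    refine Ideal.span_singleton_le_span_singleton.1 (hleast.2 ⟨⟨⟨q, rfl⟩⟩, ?_⟩)
    exact Ideal.map_le_iff_le_comap.2 fun y hy => Ideal.mem_span_singleton.2 (hq y hy)
  have hbu : ¬IsUnit b := by
    obtain ⟨p, hp, hpy⟩ := hT.exists_prime_forall_dvd hI hfin hS hUFD hbase hTS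
    exact fun hu => hp.not_isUnit (isUnit_of_dvd_unit (hbleast p hpy) hu)
  by_contra! hno
  have hnonunit : ∀ y ∈ maximalIdeal T.toSubring, ∀ c, ι y = b * c →
      c ∈ maximalIdeal S.toSubring := by
    intro y hy c hc
    rw [mem_maximalIdeal, mem_nonunits_iff]
    intro hcu
    obtain ⟨c', hc'⟩ := isUnit_iff_exists_inv.1 hcu
    have hb' : b = ι y * c' := by rw [hc, mul_assoc, hc', mul_one]
    have hy0 : (y : K) ≠ 0 := by
      intro h
      refine hb0 (hb'.trans ?_)
      rw [(Subtype.ext h : y = 0), map_zero, zero_mul]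
    obtain ⟨z, hz, hzS⟩ := hno y hy fun h => hy0 (congrArg Subtype.val h)
    apply hzS
    obtain ⟨w, hw⟩ := hbdvd z hz
    have hz' : (z : K) = y * (c' * w) := by
      rw [hb', mul_assoc] at hw
      exact congrArg Subtype.val hw
    rw [hz', mul_div_cancel_left₀ _ hy0]
    exact (c' * w).2
  have hfin' : {B : LocalSubring K | IsBasePoint I B ∧ T.toSubring ≤ B.toSubring ∧
      ∃ x ∈ maximalIdeal T.toSubring, x ≠ 0 ∧
        ∀ y ∈ maximalIdeal T.toSubring, (y : K) / x ∈ B.toSubring}.Finite :=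
    Set.Finite.subset hfin fun _ h => h.1
  have hchoose : ∀ B : LocalSubring K, ∃ x : T.toSubring, B ∈ hfin'.toFinset →
      x ∈ maximalIdeal T.toSubring ∧ x ≠ 0 ∧
        ∀ y ∈ maximalIdeal T.toSubring, (y : K) / x ∈ B.toSubring := by
    intro B
    by_cases hB : B ∈ hfin'.toFinset
    · obtain ⟨-, -, x, hx⟩ := hfin'.mem_toFinset.1 hB
      exact ⟨x, fun _ => hx⟩
    · exact ⟨0, fun h => absurd h hB⟩
  choose χ hχ using hchoose
  -- `f` generates the `e`-th power of the maximal ideal of `T` at every base point where that ideal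
  -- is principal; finite support leaves finitely many to treat.
  obtain ⟨e, he, f, hf, hf0, hfB⟩ := exists_mem_pow_forall_pow_div_mem ⟨t, htm, ht0⟩
    hfin'.toFinset id χ (fun B hB => (hfin'.mem_toFinset.1 hB).2.1) (fun B hB => (hχ B hB).2.1)
    (fun B hB => (hχ B hB).1) (fun B hB => (hχ B hB).2.2)
  have hf0' : (f : K) ≠ 0 := fun h => hf0 (Subtype.ext h)
  obtain ⟨c, hc, hfc⟩ : ∃ c ∈ maximalIdeal S.toSubring, ι f = b ^ e * c := by
    have hle : (maximalIdeal T.toSubring).map ι ≤ Ideal.span {b} * maximalIdeal S.toSubring := by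
      refine Ideal.map_le_iff_le_comap.2 fun y hy => ?_
      obtain ⟨c, hc⟩ := hbdvd y hy
      rw [Ideal.mem_comap, hc]
      exact Ideal.mul_mem_mul (Ideal.mem_span_singleton_self b) (hnonunit y hy c hc)
    have h1 := Ideal.pow_right_mono hle e (Ideal.map_pow ι _ e ▸ Ideal.mem_map_of_mem ι hf)
    rw [mul_pow, Ideal.span_singleton_pow] at h1
    obtain ⟨c, hc, hfc⟩ := Ideal.mem_span_singleton_mul.1 h1
    exact ⟨c, Ideal.pow_le_self he.ne' hc, hfc.symm⟩
  have hfc' : (f : K) = b ^ e * c := congrArg Subtype.val hfc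
  have hc0 : c ≠ 0 := by
    rintro rfl
    exact hf0' (by simpa using hfc')
  obtain ⟨p, hp, hpc⟩ := WfDvdMonoid.exists_irreducible_factor ((mem_maximalIdeal _).1 hc) hc0
  have hp' := hp.prime
  -- Since `b` is the greatest common divisor, `b p` cannot divide all of `𝔪_T`. The resulting `d =
  -- y / b` is prime to `p`, so `c` does not divide `d ^ e`.
  obtain ⟨y, hy, hpy⟩ : ∃ y ∈ maximalIdeal T.toSubring, ¬b * p ∣ ι y := by
    by_contra! h
    have h1 : b * p ∣ b * 1 := by
      rw [mul_one]
      exact hbleast _ h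
    exact hp.not_isUnit (isUnit_of_dvd_one ((mul_dvd_mul_iff_left hb0).1 h1))
  obtain ⟨d, hd⟩ := hbdvd y hy
  have hpd : ¬p ∣ d := fun h => hpy (hd ▸ mul_dvd_mul_left b h)
  have hcK : (c : K) ≠ 0 := fun h => hc0 (Subtype.ext h)
  have hzS : (d : K) ^ e / c ∉ S.toSubring := by
    intro h
    refine hpd (hp'.dvd_of_dvd_pow (hpc.trans (⟨⟨_, h⟩, Subtype.ext ?_⟩ : c ∣ d ^ e)))
    exact (mul_div_cancel₀ _ hcK).symm
  have hRS := hT.le.trans hTS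
  have := isFractionRing_of_le hRS
  have : IsIntegrallyClosedIn S.toSubring K :=
    (isIntegrallyClosed_iff_isIntegrallyClosedIn K).1 inferInstance
  -- `S` is integrally closed, being factorial, so some valuation ring dominating `S` omits `d ^ e /
  -- c = y ^ e / f`.
  obtain ⟨V, hSV, hzV⟩ := LocalSubring.exists_le_valuationSubring_of_isIntegrallyClosedIn hzS
  obtain ⟨x, hxm, hx0, hdiv⟩ := V.exists_forall_div_mem_of_fg (hTS.1.trans hSV.1)
    (maximalIdeal T.toSubring).fg_of_isNoetherianRing hm0
  obtain ⟨T', hcen, hT'V⟩ := exists_isQuadraticCenter (hTS.trans hSV) hxm hx0 hdiv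
  obtain ⟨hg', hs'⟩ := hT.of_isQuadraticCenter hI hcen
  have hxK : (x : K) ≠ 0 := fun h => hx0 (Subtype.ext h)
  -- At a base point, `f` would generate the same ideal as `x ^ e`, and then `y ^ e / f = (y / x) ^
  -- e (x ^ e / f)` would lie in `V`.
  have hnb : ¬IsBasePoint I T' := by
    intro hb'
    have hT' : T' ∈ hfin'.toFinset := hfin'.mem_toFinset.2
      ⟨hb', hcen.transform.2.1, x, hxm, hx0, hcen.div_mem⟩
    have hχ0 : (χ T' : K) ≠ 0 := fun h => (hχ T' hT').2.1 (Subtype.ext h)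
    have h1 : (x : K) ^ e / f ∈ T'.toSubring := by
      have h2 := mul_mem (pow_mem ((hχ T' hT').2.2 x hxm) e) (hfB T' hT')
      rwa [div_pow, div_mul_div_cancel₀ (pow_ne_zero _ hχ0)] at h2
    have h3 := mul_mem (pow_mem (hdiv y hy) e) (hT'V.1 h1)
    have hd' : (y : K) = b * d := congrArg Subtype.val hd
    rw [div_pow, div_mul_div_cancel₀ (pow_ne_zero _ hxK), hfc', hd', mul_pow,
      mul_div_mul_left _ _ (pow_ne_zero _ hbK)] at h3
    exact hzV h3
  obtain ⟨z, hz⟩ := hg'.exists_extension_eq_span hs' hnb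
  have := hcen.regular
  have hST' : S ≤ T' := hS.le_of_extension_eq hSV hT'V (algebraMap_mem_of_le hg'.le)
    (fun k hk => mem_of_isIntegral_of_le hg'.le hk) hz
  obtain ⟨v, hv⟩ := hbdvd x hxm
  have hloc := hST'.2
  have hxbv : Subring.inclusion hcen.transform.2.1 x =
      Subring.inclusion hST'.1 b * Subring.inclusion hST'.1 v := by
    rw [← map_mul, ← hv]
    rfl
  -- `x` is irreducible in `T'` but equals `b v`, and a unit of `T'` coming from `S` is a unit of
  -- `S` by domination; neither `b` nor `v` is one.
  rcases hcen.prime.irreducible.isUnit_or_isUnit hxbv with h | h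
  · exact hbu (hloc.map_nonunit _ h)
  · exact (mem_maximalIdeal _).1 (hnonunit x hxm v hv) (hloc.map_nonunit _ h)

end Factorial

end FinSupp

end

/-! ### Assembly of the main theorem -/

theorem theorem2p13 {R K : Type*} [CommRing R] [IsDomain R] [IsRegularLocalRing R]
    [Field K] [Algebra R K] [IsFractionRing R K] (hdim : 2 ≤ ringKrullDim R)
    (I : Ideal R) (hI : I.radical = IsLocalRing.maximalIdeal R)
    (hfin : FinSupp.IsFinitelySupported K I)
    (S : LocalSubring K) (hS : FinSupp.IsOnNormalizedBlowup I S)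
    (hdom : LocalSubring.range (algebraMap R K) ≤ S)
    (hUFD : UniqueFactorizationMonoid S.toSubring) :
    IsRegularLocalRing S.toSubring ∧
      ((∃ T : LocalSubring K, FinSupp.IsBasePoint I T ∧
          (S.toSubring : Set K) = FinSupp.ordValuationRing T) ∨
        FinSupp.IsInfinitelyNear (LocalSubring.range (algebraMap R K)) S) := by
  have hdim' : 2 ≤ ringKrullDim (LocalSubring.range (algebraMap R K)).toSubring := by
    have hinj : Function.Injective (algebraMap R K) := IsFractionRing.injective R K
    exact hdim.trans_eq (ringKrullDim_eq_of_ringEquiv (RingEquiv.ofBijective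
      (algebraMap R K).rangeRestrict ⟨fun a b hab => hinj (congrArg Subtype.val hab),
        (algebraMap R K).rangeRestrict_surjective⟩))
  obtain ⟨T, T', x, hbase, hgood, hcen, hT'S, z, hz⟩ :=
    FinSupp.exists_isQuadraticCenter_extension_eq_span hI hfin FinSupp.isGoodPoint_range
      (FinSupp.isBasePoint_range hI hdim') hdom fun T hT hbase _ hTS =>
        hT.exists_forall_div_mem hI hfin hS hUFD hbase hTS
  have hreg := hgood.regular
  -- The dominating ring required by the universal property can be `S` itself, as `T' ≤ S`.
  have hS' : S ≤ T' := hS.le_of_extension_eq le_rfl hT'S (FinSupp.algebraMap_mem_of_le hgood.le)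
    (fun k hk => FinSupp.mem_of_isIntegral_of_le hgood.le hk) hz
  obtain rfl := le_antisymm hS' hT'S
  refine ⟨hreg, ?_⟩
  rcases lt_or_ge (ringKrullDim S.toSubring) 2 with h | h
  · exact Or.inl ⟨T, hbase, hcen.eq_ord h⟩
  · exact Or.inr ⟨hreg, h, hgood.le, hgood.chain⟩
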